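/- Let $D \ge 0$ and $N \ge 2$ be integers. For $p\in\mathbb N$ write $p=(N-1)n_p+r_p$ with $0\le r_p\le N-2$, and let $Y_p$ be the Young diagram with $n_p$ rows of $N-1$ cells followed by one row of $r_p$ cells. Let $\mathbf Y_p$ be the Young symmetrizer of $Y_p$ on covariant tensors of degree $p$ on $\mathbb R^D$ (the indices in each row are symmetrized, then the indices in each column are antisymmetrized). Let $\Omega_N^p(\mathbb R^D)$ be the space of smooth covariant tensor fields of degree $p$ on $\mathbb R^D$ with values in the image of $\mathbf Y_p$, put $\Omega_N(\mathbb R^D)=\bigoplus_p\Omega_N^p(\mathbb R^D)$, and let $d=\mathbf Y_{p+1}\circ\partial:\Omega_N^p(\mathbb R^D)\to\Omega_N^{p+1}(\mathbb R^D)$, where $(\partial T)_{\mu_1\dots\mu_{p+1}}=\partial_{\mu_1}T_{\mu_2\dots\mu_{p+1}}$ and the index $\mu_1$ is placed in the cell of $Y_{p+1}$ that is not in $Y_p$, the other indices keeping their cells. Then $d^N=0$. For $k\in\{1,\dots,N-1\}$ let $H^p_{(k)}(\Omega_N(\mathbb R^D))$ be the degree $p$ part of $\operatorname{Ker}(d^k)/\operatorname{Im}(d^{N-k})$,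 that is, $\operatorname{Ker}(d^k:\Omega_N^p\to\Omega_N^{p+k})/d^{N-k}(\Omega_N^{p+k-N})$, where $\Omega_N^q=0$ for $q<0$. Then, for every $k\in\{1,\dots,N-1\}$: 1. $H^{(N-1)n}_{(k)}(\Omega_N(\mathbb R^D))=0$ for all $n\ge 1$; 2. $H^0_{(k)}(\Omega_N(\mathbb R^D))$ is the space of real polynomial functions on $\mathbb R^D$ of degree at most $k-1$: sending the class of a function $f\in\operatorname{Ker}(d^k)\subset\Omega_N^0(\mathbb R^D)=C^\infty(\mathbb R^D)$ to $f$ is a linear isomorphism onto that space. -/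

import Mathlib

open scoped ContDiff DirectSum

noncomputable section

namespace GenPoincare

/-- The Young diagram with `p` cells whose rows are filled maximally with `N - 1` cells:
`p / (N - 1)` rows of length `N - 1`, followed by one row of length `p % (N - 1)`. -/
def maxDiagram (N p : ℕ) (hN : 2 ≤ N) : YoungDiagram :=
  YoungDiagram.ofRowLens (List.replicate (p / (N - 1)) (N - 1) ++ [p % (N - 1)]) (by
    have h : p % (N - 1) < N - 1 := Nat.mod_lt _ (by omega)
    rw [List.sortedGE_iff_pairwise, List.pairwise_append]
    refine ⟨?_, by simp, ?_⟩
    · rw [List.pairwise_replicate]; right; exact le_rfl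
    · intro a ha b hb
      rw [List.eq_of_mem_replicate ha, List.mem_singleton.1 hb]
      exact h.le)

/-- The cell `(row, column)` carrying the `i`-th index of a tensor of degree `p`.  The cells are
filled row by row, starting with the last index, so that the first index of a tensor of
degree `p + 1` sits in the cell that is added to the diagram with `p` cells, while the
other indices stay in the cells they have in degree `p`. -/
def cell (N p : ℕ) (i : Fin p) : ℕ × ℕ :=
  ((i.rev : ℕ) / (N - 1), (i.rev : ℕ) % (N - 1))

/-- `cell` is a numbering of the cells of `maxDiagram N p`. -/
theorem cell_bijOn (N p : ℕ) (hN : 2 ≤ N) :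
    Set.BijOn (cell N p) Set.univ ((maxDiagram N p hN).cells : Set (ℕ × ℕ)) := by
  have hm : 0 < N - 1 := by omega
  have hmem : ∀ c : ℕ × ℕ, c ∈ (maxDiagram N p hN).cells ↔
      c.2 < N - 1 ∧ c.2 + (N - 1) * c.1 < p := by
    rintro ⟨a, b⟩
    rw [YoungDiagram.mem_cells, maxDiagram, YoungDiagram.mem_ofRowLens]
    generalize hmm : N - 1 = m at *
    have hp := Nat.div_add_mod p m
    have hr := Nat.mod_lt p hm
    generalize p / m = q at *
    generalize p % m = r at *
    have hlen : (List.replicate q m ++ [r]).length = q + 1 := by simp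
    constructor
    · rintro ⟨h3, h4⟩
      change a < _ at h3
      change b < (List.replicate q m ++ [r])[a] at h4
      change b < m ∧ b + m * a < p
      rw [hlen] at h3
      rcases Nat.lt_or_ge a q with h | h
      · rw [List.getElem_append_left (by simpa using h), List.getElem_replicate] at h4
        have h1 : m * (a + 1) ≤ m * q := Nat.mul_le_mul_left _ h
        rw [Nat.mul_succ] at h1
        omega
      · obtain rfl : a = q := by omega
        rw [List.getElem_append_right (by simp)] at h4
        simp only [List.getElem_singleton] at h4
        omega
    · rintro ⟨h3, h4⟩
      change b < m at h3
      change b + m * a < p at h4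
      have h5 : a ≤ q := by
        by_contra hc
        have h1 : m * (q + 1) ≤ m * a := Nat.mul_le_mul_left _ (by omega)
        rw [Nat.mul_succ] at h1
        omega
      refine ⟨by rw [hlen]; exact Nat.lt_succ_of_le h5, ?_⟩
      change b < (List.replicate q m ++ [r])[a]
      rcases Nat.lt_or_ge a q with h | h
      · rw [List.getElem_append_left (by simpa using h), List.getElem_replicate]
        exact h3
      · obtain rfl : a = q := by omega
        rw [List.getElem_append_right (by simp)]
        simp only [List.getElem_singleton]
        omega
  refine ⟨?_, ?_, ?_⟩
  · intro i _
    rw [Finset.mem_coe, hmem]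
    refine ⟨Nat.mod_lt _ hm, ?_⟩
    have := Nat.mod_add_div (i.rev : ℕ) (N - 1)
    have := i.rev.isLt
    simp only [cell]
    omega
  · intro i _ j _ hij
    simp only [cell, Prod.mk.injEq] at hij
    have h1 := Nat.mod_add_div (i.rev : ℕ) (N - 1)
    have h2 := Nat.mod_add_div (j.rev : ℕ) (N - 1)
    rw [hij.1, hij.2] at h1
    exact Fin.rev_injective (Fin.ext (h1.symm.trans h2))
  · rintro ⟨a, b⟩ hc
    rw [Finset.mem_coe, hmem] at hc
    obtain ⟨hb, hlt⟩ := hc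
    simp only at hb hlt
    refine ⟨(⟨b + (N - 1) * a, hlt⟩ : Fin p).rev, trivial, ?_⟩
    simp only [cell, Fin.rev_rev, Prod.mk.injEq]
    exact ⟨by rw [Nat.add_mul_div_left _ _ hm, Nat.div_eq_of_lt hb, zero_add],
      by rw [Nat.add_mul_mod_self_left, Nat.mod_eq_of_lt hb]⟩

/-- Covariant tensors of degree `p` on `ℝ^D`, given by their components `T_{μ₁…μ_p}`. -/
abbrev Tensor (D p : ℕ) : Type := (Fin p → Fin D) → ℝ

/-- The permutation `σ` of the indices: `(σ T)_μ = T_{μ ∘ σ}`. -/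
def permute (D : ℕ) {p : ℕ} (σ : Equiv.Perm (Fin p)) : Tensor D p →ₗ[ℝ] Tensor D p :=
  LinearMap.funLeft ℝ ℝ (fun μ : Fin p → Fin D => μ ∘ σ)

/-- The permutations of the indices that preserve each row. -/
def rowPerms (N p : ℕ) : Finset (Equiv.Perm (Fin p)) :=
  {σ | ∀ i, (cell N p (σ i)).1 = (cell N p i).1}

/-- The permutations of the indices that preserve each column. -/
def colPerms (N p : ℕ) : Finset (Equiv.Perm (Fin p)) :=
  {σ | ∀ i, (cell N p (σ i)).2 = (cell N p i).2}

/-- Symmetrization in the indices of each row. -/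
def rowSym (N D p : ℕ) : Tensor D p →ₗ[ℝ] Tensor D p :=
  ((rowPerms N p).card : ℝ)⁻¹ • ∑ σ ∈ rowPerms N p, permute D σ

/-- Antisymmetrization in the indices of each column. -/
def colAlt (N D p : ℕ) : Tensor D p →ₗ[ℝ] Tensor D p :=
  ((colPerms N p).card : ℝ)⁻¹ •
    ∑ σ ∈ colPerms N p, ((Equiv.Perm.sign σ : ℤ) : ℝ) • permute D σ

/-- The Young symmetrizer of the diagram `maxDiagram N p`: rows are symmetrized, then columns
are antisymmetrized. -/
def young (N D p : ℕ) : Tensor D p →ₗ[ℝ] Tensor D p :=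
  colAlt N D p ∘ₗ rowSym N D p

/-- `∂T`, with components `∂_{μ₁} T_{μ₂…μ_{p+1}}`. -/
def grad {D p : ℕ} (T : (Fin D → ℝ) → Tensor D p) : (Fin D → ℝ) → Tensor D (p + 1) :=
  fun x μ => fderiv ℝ (fun y => T y (Fin.tail μ)) x (Pi.single (μ 0) 1)

/-- The space `Ω_N^p(ℝ^D)` of smooth tensor fields of degree `p` on `ℝ^D` whose values have the
Young symmetry type `maxDiagram N p`. -/
def Omega (N D p : ℕ) : Submodule ℝ ((Fin D → ℝ) → Tensor D p) where
  carrier := {T | ContDiff ℝ ∞ T ∧ ∀ x, T x ∈ LinearMap.range (young N D p)}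
  add_mem' := fun ha hb =>
    ⟨ha.1.add hb.1, fun x => Submodule.add_mem _ (ha.2 x) (hb.2 x)⟩
  zero_mem' := ⟨contDiff_const, fun _ => Submodule.zero_mem _⟩
  smul_mem' := fun c _ ha =>
    ⟨ha.1.const_smul c, fun x => Submodule.smul_mem _ c (ha.2 x)⟩

theorem contDiff_grad {D p : ℕ} {T : (Fin D → ℝ) → Tensor D p} (hT : ContDiff ℝ ∞ T) :
    ContDiff ℝ ∞ (grad T) := by
  rw [contDiff_pi]
  intro μ
  have h : ContDiff ℝ ∞ (fun y => T y (Fin.tail μ)) := (contDiff_pi.1 hT) _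
  exact (h.fderiv_right (m := ∞) (by simp)).clm_apply contDiff_const

/-- The vector space `Ω_N^p(ℝ^D)` as a type. -/
def TField (N D p : ℕ) : Type := Omega N D p

instance (N D p : ℕ) : AddCommGroup (TField N D p) :=
  inferInstanceAs (AddCommGroup (Omega N D p))

instance (N D p : ℕ) : Module ℝ (TField N D p) :=
  inferInstanceAs (Module ℝ (Omega N D p))

/-- The components of a tensor field. -/
def comps {N D p : ℕ} : TField N D p →ₗ[ℝ] ((Fin D → ℝ) → Tensor D p) :=
  (Omega N D p).subtype

/-- The operator `d = Y ∘ ∂` from degree `p` to degree `p + 1`. -/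
def dDeg (N D p : ℕ) : TField N D p →ₗ[ℝ] TField N D (p + 1) where
  toFun T := ⟨fun x => young N D (p + 1) (grad T.1 x),
    ((young N D (p + 1)).toContinuousLinearMap.contDiff).comp (contDiff_grad T.2.1),
    fun _ => ⟨_, rfl⟩⟩
  map_add' S T := by
    apply Subtype.ext
    funext x
    have hS : ∀ ν, DifferentiableAt ℝ (fun y => S.1 y ν) x := fun ν =>
      ((contDiff_pi.1 S.2.1) ν).differentiable (by simp) x
    have hT : ∀ ν, DifferentiableAt ℝ (fun y => T.1 y ν) x := fun ν =>
      ((contDiff_pi.1 T.2.1) ν).differentiable (by simp) x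
    have h : grad (S + T).1 x = grad S.1 x + grad T.1 x := by
      funext μ
      have := fderiv_fun_add (hS (Fin.tail μ)) (hT (Fin.tail μ))
      exact congrArg (fun L => L (Pi.single (μ 0) (1 : ℝ))) this
    exact (congrArg _ h).trans (map_add _ _ _)
  map_smul' c T := by
    apply Subtype.ext
    funext x
    have hT : ∀ ν, DifferentiableAt ℝ (fun y => T.1 y ν) x := fun ν =>
      ((contDiff_pi.1 T.2.1) ν).differentiable (by simp) x
    have h : grad (c • T).1 x = c • grad T.1 x := by
      funext μ
      have := fderiv_fun_const_smul (hT (Fin.tail μ)) c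
      exact congrArg (fun L => L (Pi.single (μ 0) (1 : ℝ))) this
    exact (congrArg _ h).trans (map_smul _ _ _)

/-- The graded vector space `Ω_N(ℝ^D)`. -/
abbrev OmegaTot (N D : ℕ) : Type := ⨁ p : ℕ, TField N D p

/-- The endomorphism `d` of `Ω_N(ℝ^D)`, of degree one. -/
def d (N D : ℕ) : Module.End ℝ (OmegaTot N D) :=
  DirectSum.toModule ℝ ℕ (OmegaTot N D) fun p =>
    DirectSum.lof ℝ ℕ (fun q => TField N D q) (p + 1) ∘ₗ dDeg N D p

/-- The degree `p` part of `Ker d^k`. -/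
def Z (N D k p : ℕ) : Submodule ℝ (TField N D p) :=
  (LinearMap.ker (d N D ^ k)).comap (DirectSum.lof ℝ ℕ (fun q => TField N D q) p)

/-- The degree `p` part of `Im d^j`. -/
def B (N D j p : ℕ) : Submodule ℝ (TField N D p) :=
  (LinearMap.range (d N D ^ j)).comap (DirectSum.lof ℝ ℕ (fun q => TField N D q) p)

/-- The generalized cohomology `H^p_{(k)} = Ker d^k / Im d^{N-k}` in degree `p`. -/
abbrev H (N D k p : ℕ) : Type :=
  Z N D k p ⧸ (B N D (N - k) p).submoduleOf (Z N D k p)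

/-- Real polynomial functions on `ℝ^D` of degree at most `m`. -/
def polyFun (D m : ℕ) : Submodule ℝ ((Fin D → ℝ) → ℝ) :=
  (MvPolynomial.restrictTotalDegree (Fin D) ℝ m).map
    (LinearMap.pi fun x => (MvPolynomial.aeval x).toLinearMap)

end GenPoincare

end

namespace GenPoincare

noncomputable section

/-! ### Calculus on smooth functions: radial integrals and the Euler operator -/

section

/-! Write `m = N - 1`. A tensor that is antisymmetric in columns is the same as a multi-form: its
indices become anticommuting generators `θ_{j,ν}`, one family for each column `j < m`. On
multi-forms act the exterior derivatives `d_j`, the contractions `ι_j` with the radial vector field,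
the moves of an index between columns (a copy of `gl`), and the Euler operator `E`. They are tied
together by a Cartan formula, `contr_mul_extD`. Up to a nonzero constant the operator `d` of the
theorem becomes `rowD`, the derivative of the column being filled, corrected by moves
(`exists_form_dDeg`).

Start from the rectangle with `n ≥ 1` full rows. Going up, `d^k` is a multiple of `d_{k-1} ⋯ d_0`,
called `extLow` (`rowD_extLow`). Going down, contracting the last `q` columns gives again an element
of `Ω` (`contrTop_mem_range_form`, which rests on the Garnir identity). Applying `d^q` to that
contraction gives, up to a constant, the product over `r < q` of the factors `A - r (E + n - m + r)`
applied to the original form, where `A = ∑ d_j ι_j` (`rowD_contrTop`, `sum_extD_contr_contrTop`). So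
every value of this product lies in the image of `d^q`.

It remains to solve for a given `v` with `extLow k v = 0`, where `k + q = N`. On the kernel of
`extLow (k+1)`, and modulo the kernel of `extLow k`, the operator `A` acts as `(m - k)(E + n - k)`,
so the factor with index `r` acts as `(m - r - k)(E + n + r - k)` (`extLow_rootFactor`). The scalar
is nonzero in the range needed. The Euler factor is invertible up to homogeneous polynomials
(`exists_euler_add_inverse`) whose degree `k - n - r` is less than `k`, and these are killed by the
`k` derivatives in `extLow k`. Hence the product is onto between successive kernels, and induction
on `k` ends the argument (`mem_of_extLow_eq_zero`).

The identity `d^N = 0` is a pigeonhole: `N` symmetric derivative indices cannot occupy different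
columns among `N - 1`. In degree zero nothing is exact, and `d^k f` for `k < N` is the full `k`-th
derivative of `f`, which vanishes exactly on polynomials of degree less than `k`
(`gradPow_eq_zero_iff`). -/

theorem hasFDerivAt_integral_pow_smul {V F : Type} [NormedAddCommGroup V] [NormedSpace ℝ V]
    [FiniteDimensional ℝ V] [NormedAddCommGroup F] [NormedSpace ℝ F] {f : V → F}
    (hf : ContDiff ℝ ∞ f) (a : ℕ) (x : V) :
    HasFDerivAt (fun y => ∫ t in (0 : ℝ)..1, t ^ a • f (t • y))
      (∫ t in (0 : ℝ)..1, t ^ (a + 1) • fderiv ℝ f (t • x)) x := by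
  have hc : Continuous f := hf.continuous
  have hc' : Continuous (fderiv ℝ f) := hf.continuous_fderiv (by simp)
  have hd : Differentiable ℝ f := hf.differentiable (by simp)
  -- The dominating function is a constant: the derivative of the integrand is jointly continuous,
  -- hence bounded on this compact set.
  have hK : IsCompact ((Set.Icc (0 : ℝ) 1) ×ˢ (Metric.closedBall x 1)) :=
    isCompact_Icc.prod (isCompact_closedBall x 1)
  have hg : Continuous (fun q : ℝ × V => ‖q.1 ^ (a + 1) • fderiv ℝ f (q.1 • q.2)‖) := by fun_prop
  obtain ⟨C, hC⟩ := hK.bddAbove_image hg.continuousOn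
  have hI : Set.uIoc (0 : ℝ) 1 ⊆ Set.Icc 0 1 := by
    rw [Set.uIoc_of_le zero_le_one]; exact Set.Ioc_subset_Icc_self
  refine intervalIntegral.hasFDerivAt_integral_of_dominated_of_fderiv_le
    (F' := fun y t => t ^ (a + 1) • fderiv ℝ f (t • y))
    (bound := fun _ => C) (Metric.ball_mem_nhds x one_pos) ?_ ?_ ?_ ?_ ?_ ?_
  · refine Filter.Eventually.of_forall fun y => ?_
    exact Continuous.aestronglyMeasurable (by fun_prop)
  · exact Continuous.intervalIntegrable (by fun_prop) _ _
  · exact Continuous.aestronglyMeasurable (by fun_prop)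
  · refine Filter.Eventually.of_forall fun t ht y hy => ?_
    exact hC ⟨(t, y), ⟨hI ht, Metric.ball_subset_closedBall hy⟩, rfl⟩
  · exact intervalIntegrable_const
  · refine Filter.Eventually.of_forall fun t _ y _ => ?_
    have h := ((hd (t • y)).hasFDerivAt.comp y ((hasFDerivAt_id y).const_smul t)).const_smul (t ^ a)
    refine h.congr_fderiv ?_
    ext v
    simp [pow_succ, mul_smul]

/-- The derivative of such an integral is one of the same kind, with `a + 1` and `fderiv ℝ f`; hence
the induction varies the target space and the exponent. -/
theorem contDiff_integral_pow_smul {V : Type} [NormedAddCommGroup V] [NormedSpace ℝ V]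
    [FiniteDimensional ℝ V] (n : ℕ) : ∀ {F : Type} [NormedAddCommGroup F] [NormedSpace ℝ F]
    {f : V → F} (_ : ContDiff ℝ ∞ f) (a : ℕ),
    ContDiff ℝ n (fun y => ∫ t in (0 : ℝ)..1, t ^ a • f (t • y)) := by
  induction n with
  | zero =>
    intro F _ _ f hf a
    have : Differentiable ℝ (fun y => ∫ t in (0 : ℝ)..1, t ^ a • f (t • y)) := fun x =>
      (hasFDerivAt_integral_pow_smul hf a x).differentiableAt
    exact contDiff_zero.2 this.continuous
  | succ n ih =>
    intro F _ _ f hf a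
    rw [Nat.cast_succ, contDiff_succ_iff_fderiv]
    refine ⟨fun x => (hasFDerivAt_integral_pow_smul hf a x).differentiableAt, by simp, ?_⟩
    rw [show fderiv ℝ (fun y => ∫ t in (0 : ℝ)..1, t ^ a • f (t • y)) =
      fun x => ∫ t in (0 : ℝ)..1, t ^ (a + 1) • fderiv ℝ f (t • x) from
      funext fun x => (hasFDerivAt_integral_pow_smul hf a x).fderiv]
    exact ih (hf.fderiv_right (by simp)) (a + 1)

/-- Smooth real functions on `ℝ^D`. -/
def Smooth (D : ℕ) : Submodule ℝ ((Fin D → ℝ) → ℝ) where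
  carrier := {f | ContDiff ℝ ∞ f}
  add_mem' := fun {f g} (ha : ContDiff ℝ ∞ f) (hb : ContDiff ℝ ∞ g) => ha.add hb
  zero_mem' := (contDiff_const : ContDiff ℝ ∞ fun _ : Fin D → ℝ => (0 : ℝ))
  smul_mem' := fun c f (ha : ContDiff ℝ ∞ f) => ha.const_smul c

theorem contDiff_coe {D : ℕ} (f : Smooth D) : ContDiff ℝ ∞ f.1 := f.2

theorem differentiable_coe {D : ℕ} (f : Smooth D) : Differentiable ℝ f.1 :=
  (contDiff_coe f).differentiable (by simp)

/-- The partial derivative `∂_ν`. -/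
def partialD {D : ℕ} (ν : Fin D) : Smooth D →ₗ[ℝ] Smooth D where
  toFun f := ⟨fun x => fderiv ℝ f.1 x (Pi.single ν 1),
    ((contDiff_coe f).fderiv_right (m := ∞) (by simp)).clm_apply contDiff_const⟩
  map_add' f g := by
    ext x
    exact congrArg (fun L : (Fin D → ℝ) →L[ℝ] ℝ => L (Pi.single ν (1 : ℝ)))
      (fderiv_add ((differentiable_coe f) x) ((differentiable_coe g) x))
  map_smul' c f := by
    ext x
    exact congrArg (fun L : (Fin D → ℝ) →L[ℝ] ℝ => L (Pi.single ν (1 : ℝ)))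
      (fderiv_const_smul ((differentiable_coe f) x) c)

/-- Multiplication by the coordinate `x_ν`. -/
def coordMul {D : ℕ} (ν : Fin D) : Smooth D →ₗ[ℝ] Smooth D where
  toFun f := ⟨fun x => x ν * f.1 x, (contDiff_apply ℝ ℝ ν).mul (contDiff_coe f)⟩
  map_add' f g := by ext x; exact mul_add _ _ _
  map_smul' c f := by ext x; exact mul_left_comm _ _ _

/-- The operator `f ↦ ∫₀¹ t^a f(t x) dt`. -/
def radialInt {D : ℕ} (a : ℕ) : Smooth D →ₗ[ℝ] Smooth D where
  toFun f := ⟨fun x => ∫ t in (0 : ℝ)..1, t ^ a • f.1 (t • x),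
    contDiff_infty.2 fun n => contDiff_integral_pow_smul n (contDiff_coe f) a⟩
  map_add' f g := by
    ext x
    have hf := (contDiff_coe f).continuous
    have hg := (contDiff_coe g).continuous
    change (∫ t in (0 : ℝ)..1, t ^ a • (f.1 (t • x) + g.1 (t • x))) = _
    simp only [smul_add]
    exact intervalIntegral.integral_add (Continuous.intervalIntegrable (by fun_prop) _ _)
      (Continuous.intervalIntegrable (by fun_prop) _ _)
  map_smul' c f := by
    ext x
    change (∫ t in (0 : ℝ)..1, t ^ a • (c • f.1 (t • x))) = _
    simp only [smul_comm _ c]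
    exact intervalIntegral.integral_smul _ _

/-- Evaluation at the origin, as a constant function. -/
def evalZero {D : ℕ} : Smooth D →ₗ[ℝ] Smooth D where
  toFun f := ⟨fun _ => f.1 0, (contDiff_const : ContDiff ℝ ∞ fun _ : Fin D → ℝ => f.1 0)⟩
  map_add' _ _ := rfl
  map_smul' _ _ := rfl

/-- The Euler operator `∑ x_ν ∂_ν`. -/
def euler {D : ℕ} : Smooth D →ₗ[ℝ] Smooth D := ∑ ν, coordMul ν ∘ₗ partialD ν

theorem sum_coord_fderiv {D : ℕ} (L : (Fin D → ℝ) →L[ℝ] ℝ) (x : Fin D → ℝ) :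
    ∑ ν, x ν * L (Pi.single ν 1) = L x := by
  conv_rhs => rw [pi_eq_sum_univ' x]
  rw [map_sum]
  refine Finset.sum_congr rfl fun ν _ => ?_
  rw [map_smul, smul_eq_mul]

theorem smooth_coe_sum {D : ℕ} {ι : Type*} (s : Finset ι) (f : ι → Smooth D) (x : Fin D → ℝ) :
    (∑ i ∈ s, f i).1 x = ∑ i ∈ s, (f i).1 x := by
  rw [← Submodule.subtype_apply, map_sum, Finset.sum_apply]; rfl

theorem euler_apply {D : ℕ} (f : Smooth D) (x : Fin D → ℝ) :
    (euler f).1 x = fderiv ℝ f.1 x x := by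
  rw [euler, LinearMap.sum_apply, smooth_coe_sum]
  exact sum_coord_fderiv (fderiv ℝ f.1 x) x

theorem partialD_coordMul {D : ℕ} (μ ν : Fin D) (f : Smooth D) :
    partialD μ (coordMul ν f) = coordMul ν (partialD μ f) + if μ = ν then f else 0 := by
  ext x
  have h1 : HasFDerivAt (fun y : Fin D → ℝ => y ν)
      (ContinuousLinearMap.proj (R := ℝ) ν : (Fin D → ℝ) →L[ℝ] ℝ) x :=
    (ContinuousLinearMap.proj (R := ℝ) ν : (Fin D → ℝ) →L[ℝ] ℝ).hasFDerivAt
  have h := (h1.mul ((differentiable_coe f) x).hasFDerivAt).fderiv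
  have h2 := congrArg (fun L => L (Pi.single μ (1 : ℝ))) h
  refine h2.trans ?_
  rcases eq_or_ne μ ν with rfl | hne
  · simp [partialD, coordMul]
  · simp [partialD, coordMul, hne, hne.symm]

theorem coordMul_comm {D : ℕ} (μ ν : Fin D) (f : Smooth D) :
    coordMul μ (coordMul ν f) = coordMul ν (coordMul μ f) := by
  ext x; exact mul_left_comm _ _ _

theorem partialD_comm {D : ℕ} (μ ν : Fin D) (f : Smooth D) :
    partialD μ (partialD ν f) = partialD ν (partialD μ f) := by
  ext x
  have hs : IsSymmSndFDerivAt ℝ f.1 x :=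
    (contDiff_coe f).contDiffAt.isSymmSndFDerivAt
      (by simpa using WithTop.coe_le_coe.2 (le_top : (2 : ℕ∞) ≤ ⊤))
  have hd : DifferentiableAt ℝ (fderiv ℝ f.1) x :=
    ((contDiff_coe f).fderiv_right (m := ∞) (by simp)).differentiable (by simp) x
  have key : ∀ μ ν : Fin D, (partialD μ (partialD ν f)).1 x =
      fderiv ℝ (fderiv ℝ f.1) x (Pi.single μ 1) (Pi.single ν 1) := by
    intro μ ν
    change fderiv ℝ (fun y => fderiv ℝ f.1 y (Pi.single ν 1)) x (Pi.single μ 1) = _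
    rw [fderiv_clm_apply hd (differentiableAt_const _)]
    simp
  rw [key, key]
  exact hs _ _

theorem partialD_radialInt {D : ℕ} (ν : Fin D) (a : ℕ) (f : Smooth D) :
    partialD ν (radialInt a f) = radialInt (a + 1) (partialD ν f) := by
  ext x
  change fderiv ℝ (fun y => ∫ t in (0 : ℝ)..1, t ^ a • f.1 (t • y)) x (Pi.single ν 1) = _
  rw [(hasFDerivAt_integral_pow_smul (contDiff_coe f) a x).fderiv]
  have hc := (contDiff_coe f).continuous_fderiv (n := ∞) (by simp)
  rw [ContinuousLinearMap.intervalIntegral_apply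
    (Continuous.intervalIntegrable (by fun_prop) _ _)]
  rfl

theorem coordMul_radialInt {D : ℕ} (ν : Fin D) (a : ℕ) (f : Smooth D) :
    coordMul ν (radialInt (a + 1) f) = radialInt a (coordMul ν f) := by
  ext x
  change x ν * (∫ t in (0 : ℝ)..1, t ^ (a + 1) • f.1 (t • x)) =
    ∫ t in (0 : ℝ)..1, t ^ a • ((t • x) ν * f.1 (t • x))
  rw [← intervalIntegral.integral_const_mul]
  congr 1
  funext t
  simp only [smul_eq_mul, Pi.smul_apply]
  ring

/-- A partial derivative raises the exponent by one and a coordinate lowers it again. -/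
theorem euler_radialInt {D : ℕ} (a : ℕ) (f : Smooth D) :
    euler (radialInt a f) = radialInt a (euler f) := by
  simp only [euler, LinearMap.sum_apply, LinearMap.comp_apply, partialD_radialInt,
    coordMul_radialInt, map_sum]

theorem hasDerivAt_radial {D : ℕ} (f : Smooth D) (x : Fin D → ℝ) (t : ℝ) :
    HasDerivAt (fun s : ℝ => f.1 (s • x)) (fderiv ℝ f.1 (t • x) x) t := by
  have h := ((differentiable_coe f) (t • x)).hasFDerivAt.comp_hasDerivAt t
    ((hasDerivAt_id t).smul_const x)
  refine h.congr_deriv ?_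
  simp

/-- Integrate the derivative of `t ^ (a + 1) * f (t x)` over `[0, 1]`. Since `E` commutes with the
integral, this inverts `E + a + 1` on both sides. -/
theorem radialInt_euler_add {D : ℕ} (a : ℕ) (f : Smooth D) :
    radialInt a (euler f) + ((a : ℝ) + 1) • radialInt a f = f := by
  ext x
  have hc := (contDiff_coe f).continuous
  have hc' := (contDiff_coe f).continuous_fderiv (n := ∞) (by simp)
  have hd : ∀ t ∈ Set.uIcc (0 : ℝ) 1, HasDerivAt (fun s : ℝ => s ^ (a + 1) * f.1 (s • x))
      (t ^ a * ((a + 1 : ℝ) * f.1 (t • x)) + t ^ a * (t * fderiv ℝ f.1 (t • x) x)) t := by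
    intro t _
    have h := (hasDerivAt_pow (a + 1) t).mul (hasDerivAt_radial f x t)
    refine h.congr_deriv ?_
    push_cast
    ring
  have h := intervalIntegral.integral_eq_sub_of_hasDerivAt hd
    (Continuous.intervalIntegrable (by fun_prop) _ _)
  rw [intervalIntegral.integral_add (Continuous.intervalIntegrable (by fun_prop) _ _)
    (Continuous.intervalIntegrable (by fun_prop) _ _)] at h
  simp only [one_pow, one_smul, one_mul, ne_eq, Nat.succ_ne_zero, not_false_eq_true, zero_pow,
    zero_mul, sub_zero] at h
  rw [← h]
  change (∫ t in (0 : ℝ)..1, t ^ a • (euler f).1 (t • x)) +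
    ((a : ℝ) + 1) * (∫ t in (0 : ℝ)..1, t ^ a • f.1 (t • x)) = _
  rw [← intervalIntegral.integral_const_mul, add_comm]
  congr 1
  · congr 1; funext t; simp only [smul_eq_mul]; ring
  · congr 1; funext t; rw [euler_apply]; simp

/-- The fundamental theorem of calculus along the ray to `x`. This division by coordinates lowers
the constant in `exists_euler_add_inverse` and later recognizes polynomials. -/
theorem eq_evalZero_add {D : ℕ} (f : Smooth D) :
    f = evalZero f + ∑ ν, coordMul ν (radialInt 0 (partialD ν f)) := by
  ext x
  have hc' := (contDiff_coe f).continuous_fderiv (n := ∞) (by simp)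
  have h := intervalIntegral.integral_eq_sub_of_hasDerivAt
    (fun t (_ : t ∈ Set.uIcc (0 : ℝ) 1) => hasDerivAt_radial f x t)
    (Continuous.intervalIntegrable (by fun_prop) _ _)
  simp only [one_smul, zero_smul] at h
  have h2 : (∑ ν, coordMul ν (radialInt 0 (partialD ν f))).1 x =
      ∫ t in (0 : ℝ)..1, fderiv ℝ f.1 (t • x) x := by
    rw [smooth_coe_sum]
    change ∑ ν, x ν * (∫ t in (0 : ℝ)..1, t ^ 0 • fderiv ℝ f.1 (t • x) (Pi.single ν 1)) = _
    simp only [← intervalIntegral.integral_const_mul]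
    rw [← intervalIntegral.integral_finsetSum
      (fun i _ => Continuous.intervalIntegrable (by fun_prop) _ _)]
    congr 1
    funext t
    simpa using sum_coord_fderiv (fderiv ℝ f.1 (t • x)) x
  change f.1 x = f.1 0 + (∑ ν, coordMul ν (radialInt 0 (partialD ν f))).1 x
  rw [h2, h]; ring

theorem euler_coordMul {D : ℕ} (ν : Fin D) (f : Smooth D) :
    euler (coordMul ν f) = coordMul ν (euler f) + coordMul ν f := by
  simp only [euler, LinearMap.sum_apply, LinearMap.comp_apply, partialD_coordMul, map_add, map_sum,
    Finset.sum_add_distrib, coordMul_comm ν]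
  congr 1
  rw [Finset.sum_eq_single ν]
  · simp
  · intro b _ hb; simp [hb]
  · simp

theorem euler_evalZero {D : ℕ} (f : Smooth D) : euler (evalZero f) = 0 := by
  ext x
  rw [euler_apply]
  change fderiv ℝ (fun _ => f.1 0) x x = 0
  simp

/-- Up to homogeneous polynomials, `E + c` is invertible on smooth functions. -/
theorem exists_euler_add_inverse {D : ℕ} (c : ℤ) : ∃ G : Smooth D →ₗ[ℝ] Smooth D, ∀ f,
    euler (euler (G f) + (c : ℝ) • G f - f) + (c : ℝ) • (euler (G f) + (c : ℝ) • G f - f) = 0 := by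
  rcases lt_or_ge 0 c with hc | hc
  · obtain ⟨a, rfl⟩ : ∃ a : ℕ, c = a + 1 := ⟨(c - 1).toNat, by omega⟩
    refine ⟨radialInt a, fun f => ?_⟩
    have h : euler (radialInt a f) + ((a + 1 : ℤ) : ℝ) • radialInt a f - f = 0 := by
      have := radialInt_euler_add a f
      rw [euler_radialInt]; push_cast; rw [this, sub_self]
    rw [h]; simp
  · obtain ⟨j, rfl⟩ : ∃ j : ℕ, c = -j := ⟨(-c).toNat, by omega⟩
    clear hc
    -- Descent from `c + 1` to `c`: in `f = f(0) + ∑ x_ν g_ν` one has `(E + c) x_ν = x_ν (E + c +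
    -- 1)`, so the operator known for `c + 1` is applied to each `g_ν`, and the constant is divided
    -- by `c`.
    have step : ∀ (c : ℝ) (G : Smooth D →ₗ[ℝ] Smooth D),
        (∀ f, euler (euler (G f) + (c + 1) • G f - f) +
          (c + 1) • (euler (G f) + (c + 1) • G f - f) = 0) →
        ∃ G' : Smooth D →ₗ[ℝ] Smooth D, ∀ f, euler (euler (G' f) + c • G' f - f) +
          c • (euler (G' f) + c • G' f - f) = 0 := by
      intro c G hG
      obtain ⟨G', hG'⟩ : ∃ G' : Smooth D →ₗ[ℝ] Smooth D, ∀ f, G' f =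
          c⁻¹ • evalZero f + ∑ ν, coordMul ν (G (radialInt 0 (partialD ν f))) :=
        ⟨c⁻¹ • evalZero + ∑ ν, coordMul ν ∘ₗ G ∘ₗ radialInt 0 ∘ₗ partialD ν, fun f => by
          simp [LinearMap.sum_apply]⟩
      refine ⟨G', fun f => ?_⟩
      have h1 : euler (G' f) + c • G' f - f = (c * c⁻¹ - 1) • evalZero f + ∑ ν, coordMul ν
            (euler (G (radialInt 0 (partialD ν f))) + (c + 1) • G (radialInt 0 (partialD ν f))
              - radialInt 0 (partialD ν f)) := by
        have hf := eq_evalZero_add f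
        have hs : ∀ g : Fin D → Smooth D, ∑ ν, coordMul ν
            (euler (G (g ν)) + (c + 1) • G (g ν) - g ν) =
            euler (∑ ν, coordMul ν (G (g ν))) + c • ∑ ν, coordMul ν (G (g ν)) -
              ∑ ν, coordMul ν (g ν) := by
          intro g
          rw [map_sum, Finset.smul_sum, ← Finset.sum_add_distrib, ← Finset.sum_sub_distrib]
          refine Finset.sum_congr rfl fun ν _ => ?_
          rw [euler_coordMul, map_sub, map_add, map_smul]
          module
        rw [hs fun ν => radialInt 0 (partialD ν f), hG', map_add, map_smul, euler_evalZero]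
        generalize ∑ ν, coordMul ν (radialInt 0 (partialD ν f)) = S at *
        generalize evalZero f = e at *
        subst hf
        module
      rw [h1]
      simp only [map_add, map_smul, map_sum, euler_evalZero, euler_coordMul, smul_add,
        Finset.smul_sum, smul_zero, zero_add]
      -- For `c = 0` the convention `0⁻¹ = 0` leaves the constant unsolved; it is then a homogeneous
      -- polynomial of degree zero, the error that the statement allows.
      rw [show c • (c * c⁻¹ - 1) • evalZero f = 0 by
        rcases eq_or_ne c 0 with rfl | hc
        · simp
        · simp [mul_inv_cancel₀ hc], zero_add, ← Finset.sum_add_distrib]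
      refine Finset.sum_eq_zero fun ν _ => ?_
      generalize radialInt 0 (partialD ν f) = g
      have h2 := congrArg (coordMul ν) (hG g)
      simp only [map_add, map_sub, map_smul, smul_add, smul_sub, map_zero, add_smul, one_smul]
        at h2 ⊢
      rw [← h2]
      abel
    induction j with
    | zero =>
      -- The descent starts at `c + 1 = 1`, where `radialInt 0` is an exact inverse.
      obtain ⟨G, hG⟩ := step 0 (radialInt 0) (fun f => by
        have h : euler (radialInt 0 f) + ((0 : ℝ) + 1) • radialInt 0 f - f = 0 := by
          have := radialInt_euler_add 0 f
          rw [euler_radialInt]; push_cast at this; rw [this, sub_self]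
        rw [h]; simp)
      exact ⟨G, fun f => by simpa using hG f⟩
    | succ j ih =>
      obtain ⟨G, hG⟩ := ih
      obtain ⟨G', hG'⟩ := step (-((j : ℝ) + 1)) G (fun f => by simpa using hG f)
      exact ⟨G', fun f => by simpa using hG' f⟩

end

/-! ### Multi-forms and the commutation relations of their operators -/

section


open scoped TensorProduct

/-- The exterior algebra on generators `θ_{j,ν}`, with `j` a column and `ν` a coordinate. -/
def Ext (D : ℕ) : Type := ExteriorAlgebra ℝ (ℕ × Fin D →₀ ℝ)

instance (D : ℕ) : AddCommGroup (Ext D) :=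
  inferInstanceAs (AddCommGroup (ExteriorAlgebra ℝ (ℕ × Fin D →₀ ℝ)))

instance (D : ℕ) : Module ℝ (Ext D) :=
  inferInstanceAs (Module ℝ (ExteriorAlgebra ℝ (ℕ × Fin D →₀ ℝ)))

/-- Multi-forms on `ℝ^D` with smooth coefficients. -/
def Multiform (D : ℕ) : Type := Ext D ⊗[ℝ] Smooth D

instance (D : ℕ) : AddCommGroup (Multiform D) := inferInstanceAs (AddCommGroup (Ext D ⊗[ℝ] Smooth D))

instance (D : ℕ) : Module ℝ (Multiform D) := inferInstanceAs (Module ℝ (Ext D ⊗[ℝ] Smooth D))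

/-- The multi-form `w ⊗ f`. -/
def pureForm {D : ℕ} : Ext D →ₗ[ℝ] Smooth D →ₗ[ℝ] Multiform D := TensorProduct.mk ℝ (Ext D) (Smooth D)

/-- The vector `θ_{j,ν}` of the generating space. -/
abbrev oddVec {D : ℕ} (z : ℕ × Fin D) : ℕ × Fin D →₀ ℝ := Finsupp.single z 1

/-- Left multiplication by `θ_{j,ν}`. -/
def create {D : ℕ} (j : ℕ) (ν : Fin D) : Module.End ℝ (Ext D) :=
  LinearMap.mulLeft ℝ (ExteriorAlgebra.ι ℝ (oddVec (j, ν)))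

/-- Contraction with the dual of `θ_{j,ν}`. -/
def annih {D : ℕ} (j : ℕ) (ν : Fin D) : Module.End ℝ (Ext D) :=
  CliffordAlgebra.contractLeft (Q := (0 : QuadraticForm ℝ (ℕ × Fin D →₀ ℝ)))
    (Finsupp.lapply (j, ν))

theorem annih_create {D : ℕ} (i j : ℕ) (μ ν : Fin D) (w : Ext D) :
    annih i μ (create j ν w) = (if i = j ∧ μ = ν then (1 : ℝ) else 0) • w
      - create j ν (annih i μ w) := by
  refine (CliffordAlgebra.contractLeft_ι_mul (Q := (0 : QuadraticForm ℝ (ℕ × Fin D →₀ ℝ)))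
    (d := Finsupp.lapply (i, μ)) (Finsupp.single (j, ν) 1) w).trans ?_
  have h : (Finsupp.lapply (i, μ) : (ℕ × Fin D →₀ ℝ) →ₗ[ℝ] ℝ) (Finsupp.single (j, ν) 1) =
      if i = j ∧ μ = ν then (1 : ℝ) else 0 := by
    simp [Finsupp.single_apply, eq_comm]
  rw [h]; rfl

theorem create_create {D : ℕ} (i j : ℕ) (μ ν : Fin D) (w : Ext D) :
    create i μ (create j ν w) = - create j ν (create i μ w) := by
  have h : ∀ a b : ℕ × Fin D →₀ ℝ, ∀ w : ExteriorAlgebra ℝ (ℕ × Fin D →₀ ℝ),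
      ExteriorAlgebra.ι ℝ a * (ExteriorAlgebra.ι ℝ b * w) =
      - (ExteriorAlgebra.ι ℝ b * (ExteriorAlgebra.ι ℝ a * w)) := by
    intro a b w
    rw [← mul_assoc, ← mul_assoc, ← neg_mul]
    exact congrArg (· * w) (eq_neg_of_add_eq_zero_left (ExteriorAlgebra.ι_add_mul_swap _ _))
  exact h _ _ w

theorem create_mul_create {D : ℕ} (i j : ℕ) (μ ν : Fin D) :
    create i μ * create j ν = - (create j ν * create i μ) :=
  LinearMap.ext fun w => create_create i j μ ν w

theorem annih_mul_annih {D : ℕ} (i j : ℕ) (μ ν : Fin D) :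
    annih i μ * annih j ν = - (annih j ν * annih i μ) :=
  LinearMap.ext fun _ => CliffordAlgebra.contractLeft_comm _ _ _

theorem annih_mul_create {D : ℕ} (i j : ℕ) (μ ν : Fin D) :
    annih i μ * create j ν =
      (if i = j ∧ μ = ν then (1 : ℝ) else 0) • (1 : Module.End ℝ (Ext D))
        - create j ν * annih i μ :=
  LinearMap.ext fun w => annih_create i j μ ν w

/-- `f ⊗ g` as an endomorphism of multi-forms. -/
def tensorEnd {D : ℕ} : Module.End ℝ (Ext D) →ₗ[ℝ] Module.End ℝ (Smooth D) →ₗ[ℝ]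
    Module.End ℝ (Multiform D) :=
  TensorProduct.mapBilinear (RingHom.id ℝ) (Ext D) (Smooth D) (Ext D) (Smooth D)

theorem tensorEnd_pureForm {D : ℕ} (f : Module.End ℝ (Ext D)) (g : Module.End ℝ (Smooth D))
    (w : Ext D) (h : Smooth D) : tensorEnd f g (pureForm w h) = pureForm (f w) (g h) := rfl

theorem tensorEnd_mul {D : ℕ} (f f' : Module.End ℝ (Ext D)) (g g' : Module.End ℝ (Smooth D)) :
    tensorEnd f g * tensorEnd f' g' = tensorEnd (f * f') (g * g') :=
  (TensorProduct.map_comp f g f' g').symm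

theorem tensorEnd_one {D : ℕ} : tensorEnd (1 : Module.End ℝ (Ext D)) (1 : Module.End ℝ (Smooth D))
    = 1 := TensorProduct.map_id

/-- The exterior derivative in column `i`. -/
def extD (D i : ℕ) : Module.End ℝ (Multiform D) := ∑ ν : Fin D, tensorEnd (create i ν) (partialD ν)

/-- The contraction of column `i` with the radial vector field. -/
def contr (D i : ℕ) : Module.End ℝ (Multiform D) := ∑ ν : Fin D, tensorEnd (annih i ν) (coordMul ν)

/-- The operator moving an index from column `j` to column `i`. -/
def move (D i j : ℕ) : Module.End ℝ (Multiform D) :=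
  ∑ ν : Fin D, tensorEnd (create i ν * annih j ν) 1

/-- The Euler operator on the coefficients. -/
def eulerF (D : ℕ) : Module.End ℝ (Multiform D) := tensorEnd 1 euler

theorem partialD_mul_coordMul {D : ℕ} (μ ν : Fin D) :
    (partialD μ : Module.End ℝ (Smooth D)) * coordMul ν =
      coordMul ν * partialD μ + (if μ = ν then (1 : ℝ) else 0) • (1 : Module.End ℝ (Smooth D)) :=
  LinearMap.ext fun f => (partialD_coordMul μ ν f).trans (by
    rw [LinearMap.add_apply]; congr 1; split_ifs <;> simp)

theorem extD_mul_extD (D i j : ℕ) : extD D i * extD D j = - (extD D j * extD D i) := by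
  simp only [extD, Finset.sum_mul_sum, tensorEnd_mul]
  rw [Finset.sum_comm, ← Finset.sum_neg_distrib]
  refine Finset.sum_congr rfl fun μ _ => ?_
  rw [← Finset.sum_neg_distrib]
  refine Finset.sum_congr rfl fun ν _ => ?_
  rw [create_mul_create, show (partialD ν : Module.End ℝ (Smooth D)) * partialD μ =
    partialD μ * partialD ν from LinearMap.ext fun f => partialD_comm ν μ f, map_neg,
    LinearMap.neg_apply]

theorem contr_mul_contr (D i j : ℕ) : contr D i * contr D j = - (contr D j * contr D i) := by
  simp only [contr, Finset.sum_mul_sum, tensorEnd_mul]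
  rw [Finset.sum_comm, ← Finset.sum_neg_distrib]
  refine Finset.sum_congr rfl fun μ _ => ?_
  rw [← Finset.sum_neg_distrib]
  refine Finset.sum_congr rfl fun ν _ => ?_
  rw [annih_mul_annih, show (coordMul ν : Module.End ℝ (Smooth D)) * coordMul μ =
    coordMul μ * coordMul ν from LinearMap.ext fun f => coordMul_comm ν μ f, map_neg,
    LinearMap.neg_apply]

/-- Cartan's formula for several columns. The Kronecker term of the anticommutator of `annih` and
`create` leaves `x_ν ∂_ν`, that is `E`; the one of the commutator of `∂_μ` and `x_ν` leaves the
move. -/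
theorem contr_mul_extD (D i j : ℕ) : contr D j * extD D i =
    move D i j + (if i = j then eulerF D else 0) - extD D i * contr D j := by
  rw [eq_sub_iff_add_eq]
  simp only [contr, extD, Finset.sum_mul_sum, tensorEnd_mul]
  rw [Finset.sum_comm, ← Finset.sum_add_distrib]
  have h : ∀ μ ν : Fin D, tensorEnd (annih j ν * create i μ) (coordMul ν * partialD μ) +
      tensorEnd (create i μ * annih j ν) (partialD μ * coordMul ν) =
      (if μ = ν then (1 : ℝ) else 0) • (tensorEnd (create i μ * annih j ν) 1 +
        (if i = j then (1 : ℝ) else 0) • tensorEnd 1 (coordMul ν * partialD μ)) := by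
    intro μ ν
    rw [annih_mul_create, partialD_mul_coordMul]
    simp only [map_sub, map_add, map_smul, LinearMap.sub_apply, LinearMap.smul_apply]
    rcases eq_or_ne μ ν with rfl | hne
    · rcases eq_or_ne i j with rfl | hij
      · simp; abel
      · simp [hij, hij.symm]
    · simp [hne, hne.symm]
  simp only [← Finset.sum_add_distrib, h]
  simp only [ite_smul, one_smul, zero_smul, Finset.sum_ite_eq, Finset.mem_univ, if_true,
    Finset.sum_add_distrib, move]
  congr 1
  split_ifs
  · rw [eulerF, euler, map_sum]; rfl
  · simp

theorem create_mul_annih_mul_create {D : ℕ} (i j l : ℕ) (μ ν : Fin D) :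
    create i μ * annih j μ * create l ν = create l ν * (create i μ * annih j μ) +
      (if j = l ∧ μ = ν then (1 : ℝ) else 0) • create i μ := by
  rw [mul_assoc, annih_mul_create, mul_sub, mul_smul_comm, mul_one, ← mul_assoc,
    create_mul_create i l, neg_mul, sub_neg_eq_add, mul_assoc, add_comm]

theorem create_mul_annih_mul_annih {D : ℕ} (i j l : ℕ) (μ ν : Fin D) :
    create i μ * annih j μ * annih l ν = annih l ν * (create i μ * annih j μ) -
      (if l = i ∧ ν = μ then (1 : ℝ) else 0) • annih j μ := by
  rw [← mul_assoc, annih_mul_create, sub_mul, smul_mul_assoc, one_mul, mul_assoc, mul_assoc,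
    annih_mul_annih j l, mul_neg]
  abel

theorem move_mul_extD (D i j l : ℕ) : move D i j * extD D l =
    extD D l * move D i j + (if j = l then extD D i else 0) := by
  simp only [move, extD, Finset.sum_mul_sum, tensorEnd_mul, create_mul_annih_mul_create, one_mul,
    mul_one, map_add, map_smul, LinearMap.add_apply, LinearMap.smul_apply, Finset.sum_add_distrib]
  congr 1
  · rw [Finset.sum_comm]
  · split_ifs with h <;> simp [h]

theorem move_mul_contr (D i j l : ℕ) : move D i j * contr D l =
    contr D l * move D i j - (if i = l then contr D j else 0) := by
  have h : ∀ μ ν : Fin D, tensorEnd (create i μ * annih j μ) 1 * tensorEnd (annih l ν) (coordMul ν) =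
      tensorEnd (annih l ν) (coordMul ν) * tensorEnd (create i μ * annih j μ) 1 -
        if ν = μ then (if i = l then tensorEnd (annih j ν) (coordMul ν) else 0) else 0 := by
    intro μ ν
    rw [tensorEnd_mul, tensorEnd_mul, create_mul_annih_mul_annih, one_mul, mul_one, map_sub,
      LinearMap.sub_apply]
    congr 1
    rcases eq_or_ne i l with rfl | hil
    · rcases eq_or_ne ν μ with rfl | hne
      · simp
      · simp [hne]
    · simp [hil, hil.symm]
  simp only [move, contr, Finset.sum_mul_sum, h, Finset.sum_sub_distrib, Finset.sum_ite_eq',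
    Finset.mem_univ, if_true]
  refine congrArg₂ (· - ·) Finset.sum_comm ?_
  split_ifs <;> simp

theorem eulerF_mul_contr (D l : ℕ) : eulerF D * contr D l = contr D l * eulerF D + contr D l := by
  simp only [eulerF, contr, Finset.mul_sum, Finset.sum_mul, tensorEnd_mul, one_mul, mul_one,
    ← Finset.sum_add_distrib]
  refine Finset.sum_congr rfl fun ν _ => ?_
  rw [← map_add]
  congr 1
  exact LinearMap.ext fun f => euler_coordMul ν f

theorem partialD_euler {D : ℕ} (ν : Fin D) (f : Smooth D) :
    partialD ν (euler f) = euler (partialD ν f) + partialD ν f := by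
  simp only [euler, LinearMap.sum_apply, LinearMap.comp_apply, map_sum, partialD_coordMul,
    Finset.sum_add_distrib, partialD_comm ν]
  simp

theorem eulerF_mul_extD (D l : ℕ) : eulerF D * extD D l = extD D l * eulerF D - extD D l := by
  rw [eq_sub_iff_add_eq]
  simp only [eulerF, extD, Finset.mul_sum, Finset.sum_mul, tensorEnd_mul, one_mul, mul_one,
    ← Finset.sum_add_distrib]
  refine Finset.sum_congr rfl fun ν _ => ?_
  rw [← map_add]
  congr 1
  exact LinearMap.ext fun f => (partialD_euler ν f).symm

/-- Radial integration of the coefficients is a left inverse of `E + a + 1`; no polynomial has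
negative degree of homogeneity. -/
theorem eulerF_add_injective {D : ℕ} (a : ℕ) {v : Multiform D}
    (h : eulerF D v + ((a : ℝ) + 1) • v = 0) : v = 0 := by
  have h1 : (tensorEnd 1 (radialInt a) : Module.End ℝ (Multiform D)) * (eulerF D + ((a : ℝ) + 1) • (1 : Module.End ℝ (Multiform D))) = 1 := by
    rw [eulerF, mul_add, tensorEnd_mul, mul_smul_comm, mul_one, mul_one, ← map_smul, ← map_add,
      ← tensorEnd_one]
    congr 1
    exact LinearMap.ext fun f => radialInt_euler_add a f
  calc v = ((tensorEnd 1 (radialInt a) : Module.End ℝ (Multiform D)) * (eulerF D + ((a : ℝ) + 1) • (1 : Module.End ℝ (Multiform D)))) v := by rw [h1]; rfl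
    _ = tensorEnd 1 (radialInt a) (eulerF D v + ((a : ℝ) + 1) • v) := rfl
    _ = 0 := by rw [h, map_zero]

end

/-! ### Derivatives and contractions of balanced multi-forms -/

section


theorem extD_extD_apply {D : ℕ} (i j : ℕ) (v : Multiform D) :
    extD D i (extD D j v) = - extD D j (extD D i v) := LinearMap.congr_fun (extD_mul_extD D i j) v

theorem self_eq_neg_multiform {D : ℕ} {v : Multiform D} (h : v = -v) : v = 0 := by
  have h2 : (2 : ℝ) • v = 0 := by
    rw [two_smul]; nth_rewrite 1 [h]; exact neg_add_cancel v
  exact (smul_eq_zero.1 h2).resolve_left two_ne_zero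

theorem extD_extD_self {D : ℕ} (i : ℕ) (v : Multiform D) : extD D i (extD D i v) = 0 :=
  self_eq_neg_multiform (extD_extD_apply i i v)

theorem contr_contr_apply {D : ℕ} (i j : ℕ) (v : Multiform D) :
    contr D i (contr D j v) = - contr D j (contr D i v) :=
  LinearMap.congr_fun (contr_mul_contr D i j) v

theorem contr_extD_apply {D : ℕ} (i j : ℕ) (v : Multiform D) : contr D j (extD D i v) =
    move D i j v + (if i = j then eulerF D v else 0) - extD D i (contr D j v) := by
  refine (LinearMap.congr_fun (contr_mul_extD D i j) v).trans ?_
  split_ifs <;> rfl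

theorem move_extD_apply {D : ℕ} (i j l : ℕ) (v : Multiform D) : move D i j (extD D l v) =
    extD D l (move D i j v) + (if j = l then extD D i v else 0) := by
  refine (LinearMap.congr_fun (move_mul_extD D i j l) v).trans ?_
  split_ifs <;> rfl

theorem move_contr_apply {D : ℕ} (i j l : ℕ) (v : Multiform D) : move D i j (contr D l v) =
    contr D l (move D i j v) - (if i = l then contr D j v else 0) := by
  refine (LinearMap.congr_fun (move_mul_contr D i j l) v).trans ?_
  split_ifs <;> rfl

theorem eulerF_contr_apply {D : ℕ} (l : ℕ) (v : Multiform D) :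
    eulerF D (contr D l v) = contr D l (eulerF D v) + contr D l v :=
  LinearMap.congr_fun (eulerF_mul_contr D l) v

theorem eulerF_extD_apply {D : ℕ} (l : ℕ) (v : Multiform D) :
    eulerF D (extD D l v) = extD D l (eulerF D v) - extD D l v :=
  LinearMap.congr_fun (eulerF_mul_extD D l) v

/-- The multi-form `v` has weight `n` for each of the first `m` columns and is annihilated by all
moves between these columns. -/
def IsBalanced {D : ℕ} (m n : ℕ) (v : Multiform D) : Prop :=
  ∀ i < m, ∀ j < m, move D i j v = if i = j then (n : ℝ) • v else 0

/-- The operator `∑ d_j ι_j`. -/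
def casimir (D m : ℕ) : Module.End ℝ (Multiform D) := ∑ j ∈ Finset.range m, extD D j * contr D j

/-- The product of the contractions of the last `r` of `m` columns. -/
def contrTop (D m : ℕ) : ℕ → Module.End ℝ (Multiform D)
  | 0 => 1
  | r + 1 => contr D (m - 1 - r) * contrTop D m r

/-- The product of the exterior derivatives of the first `r` columns. -/
def extLow (D : ℕ) : ℕ → Module.End ℝ (Multiform D)
  | 0 => 1
  | r + 1 => extD D r * extLow D r

/-- The exterior derivative of column `c`, corrected by moves into the preceding columns. -/
def rowD (D c : ℕ) : Module.End ℝ (Multiform D) :=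
  extD D c - ∑ j ∈ Finset.range c, extD D j * move D c j

/-- The roots `r (E + n - m + r)`, as operators. -/
def rootOp (D m n r : ℕ) : Module.End ℝ (Multiform D) :=
  (r : ℝ) • (eulerF D + ((n : ℝ) - m + r) • (1 : Module.End ℝ (Multiform D)))

variable {D m n : ℕ} {v : Multiform D}

theorem eulerF_contrTop (r : ℕ) (v : Multiform D) : eulerF D (contrTop D m r v) =
    contrTop D m r (eulerF D v) + (r : ℝ) • contrTop D m r v := by
  induction r with
  | zero => simp [contrTop]
  | succ r ih =>
    simp only [contrTop, Module.End.mul_apply, eulerF_contr_apply, ih, map_add, map_smul]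
    push_cast
    module

/-- A move into column `j` fails to commute only with the contraction of `j`, and `j < m - r` is not
among the contracted columns. -/
theorem move_contrTop (hv : IsBalanced m n v) {r : ℕ} (hr : r ≤ m) {j l : ℕ} (hj : j < m - r)
    (hl : l < m) : move D j l (contrTop D m r v) =
      if j = l then (n : ℝ) • contrTop D m r v else 0 := by
  induction r with
  | zero => exact hv j (by omega) l hl
  | succ r ih =>
    simp only [contrTop, Module.End.mul_apply, move_contr_apply]
    rw [ih (by omega) (by omega), if_neg (show j ≠ m - 1 - r by omega)]
    split_ifs <;> simp

/-- With `c = m - 1 - r` and `u = contrTop D m r v`, moving an index from `j < c` to `c` in `ι_c u`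
gives `-ι_j u`. The corrections subtracted in `rowD` therefore supply the terms `d_j ι_j u` with `j
< c`. -/
theorem rowD_contrTop (hv : IsBalanced m n v) {r : ℕ} (hr : r < m) :
    rowD D (m - 1 - r) (contrTop D m (r + 1) v) =
      ∑ j ∈ Finset.range (m - r), extD D j (contr D j (contrTop D m r v)) := by
  obtain ⟨c, hc⟩ : ∃ c, m - r = c + 1 := ⟨m - r - 1, by omega⟩
  rw [show m - 1 - r = c by omega, hc, Finset.sum_range_succ, rowD]
  simp only [contrTop, Module.End.mul_apply, show m - 1 - r = c by omega, LinearMap.sub_apply,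
    LinearMap.sum_apply]
  rw [sub_eq_iff_eq_add, add_right_comm, ← Finset.sum_add_distrib, Finset.sum_eq_zero, zero_add]
  intro j hj
  rw [Finset.mem_range] at hj
  rw [move_contr_apply, move_contrTop hv hr.le (by omega) (by omega),
    if_neg (show c ≠ j by omega), if_pos rfl, map_zero, zero_sub, map_neg, add_neg_cancel]

/-- Pulling the contractions to the left past the partial sums of `d_j ι_j` costs one affine
function of `E` per column, and these add up to `rootOp`. Together with `rowD_contrTop`, a step
`rowD` on `contrTop (r + 1)` becomes the factor `A - rootOp r` inside `contrTop r`. -/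
theorem sum_extD_contr_contrTop (hv : IsBalanced m n v) {r : ℕ} (hr : r ≤ m) :
    ∑ j ∈ Finset.range (m - r), extD D j (contr D j (contrTop D m r v)) =
      contrTop D m r (casimir D m v - rootOp D m n r v) := by
  induction r with
  | zero => simp [contrTop, casimir, rootOp, LinearMap.sum_apply]
  | succ r ih =>
    have ih := ih (by omega)
    have hm := fun {j l : ℕ} => move_contrTop hv (r := r) (by omega) (j := j) (l := l)
    obtain ⟨c, hc⟩ : ∃ c, m - r = c + 1 := ⟨m - r - 1, by omega⟩
    rw [hc] at ih hm
    have hE := eulerF_contrTop (m := m) r v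
    rw [show m - (r + 1) = c by omega]
    simp only [contrTop, Module.End.mul_apply, show m - 1 - r = c by omega]
    set u := contrTop D m r v with hu
    -- Each `j < c` contributes `-1` through the move it creates; `j = c` contributes `E + n - 1`,
    -- since `ι_c u` has weight `n - 1` in column `c`.
    have key : contr D c (∑ j ∈ Finset.range (c + 1), extD D j (contr D j u)) =
        ∑ j ∈ Finset.range c, extD D j (contr D j (contr D c u)) +
          (eulerF D (contr D c u) + ((n : ℝ) - 1 - c) • contr D c u) := by
      rw [Finset.sum_range_succ, map_add, map_sum]
      have h1 : ∀ j ∈ Finset.range c, contr D c (extD D j (contr D j u)) =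
          extD D j (contr D j (contr D c u)) - contr D c u := by
        intro j hj
        rw [Finset.mem_range] at hj
        rw [contr_extD_apply, if_neg (show j ≠ c by omega), move_contr_apply, if_pos rfl,
          hm (by omega) (by omega), if_neg (show j ≠ c by omega), contr_contr_apply c j]
        simp only [map_zero, map_neg]
        abel
      rw [Finset.sum_congr rfl h1, Finset.sum_sub_distrib, contr_extD_apply, if_pos rfl,
        move_contr_apply, if_pos rfl, hm (by omega) (by omega), if_pos rfl,
        self_eq_neg_multiform (contr_contr_apply c c u)]
      simp only [Finset.sum_const, Finset.card_range, map_smul, map_zero, sub_zero]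
      rw [← Nat.cast_smul_eq_nsmul ℝ]
      module
    rw [ih] at key
    rw [← sub_eq_iff_eq_add] at key
    rw [← key, eulerF_contr_apply, hE]
    have hcm : (m : ℝ) = c + 1 + r := by
      have : m = c + 1 + r := by omega
      exact_mod_cast this
    simp only [rootOp, map_sub, map_add, map_smul, LinearMap.smul_apply, LinearMap.add_apply,
      Module.End.one_apply, hcm, Nat.cast_succ, ← hu]
    module

theorem eulerF_extLow (r : ℕ) (v : Multiform D) : eulerF D (extLow D r v) =
    extLow D r (eulerF D v) - (r : ℝ) • extLow D r v := by
  induction r with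
  | zero => simp [extLow]
  | succ r ih =>
    simp only [extLow, Module.End.mul_apply, eulerF_extD_apply, ih, map_sub, map_smul]
    push_cast
    module

theorem extD_extLow_eq_zero (v : Multiform D) {r j : ℕ} (hj : j < r) :
    extD D j (extLow D r v) = 0 := by
  induction r with
  | zero => omega
  | succ r ih =>
    rw [extLow, Module.End.mul_apply]
    rcases Nat.lt_succ_iff_lt_or_eq.1 hj with h | rfl
    · rw [extD_extD_apply, ih h]; simp
    · exact extD_extD_self _ _

theorem move_extLow (hv : IsBalanced m n v) {r : ℕ} {i j : ℕ} (hj : r ≤ j)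
    (hi : i < m) (hjm : j < m) : move D i j (extLow D r v) =
      if i = j then (n : ℝ) • extLow D r v else 0 := by
  induction r with
  | zero => exact hv i hi j hjm
  | succ r ih =>
    simp only [extLow, Module.End.mul_apply, move_extD_apply]
    rw [ih (by omega), if_neg (show j ≠ r by omega)]
    split_ifs <;> simp

/-- Each `d_j` with `j < c` kills `extLow c v`. Applying the move from `j` to `c` to this identity
turns each correction into another copy of `d_c`, so `c + 1` copies appear. -/
theorem rowD_extLow (c : ℕ) (v : Multiform D) :
    rowD D c (extLow D c v) = ((c : ℝ) + 1) • extLow D (c + 1) v := by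
  have h : ∀ j ∈ Finset.range c, extD D j (move D c j (extLow D c v)) =
      - extD D c (extLow D c v) := by
    intro j hj
    have h1 := move_extD_apply c j j (extLow D c v)
    rw [extD_extLow_eq_zero v (Finset.mem_range.1 hj), if_pos rfl, map_zero] at h1
    exact eq_neg_of_add_eq_zero_left h1.symm
  simp only [rowD, LinearMap.sub_apply, LinearMap.sum_apply, Module.End.mul_apply]
  rw [Finset.sum_congr rfl h, Finset.sum_const, Finset.card_range, ← Nat.cast_smul_eq_nsmul ℝ,
    extLow, Module.End.mul_apply]
  module

/-- The mirror image of `sum_extD_contr_contrTop`. It starts from `∑ ι_j d_j = m (E + n) - A`, which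
is Cartan's formula on a balanced form. -/
theorem sum_contr_extD_extLow (hv : IsBalanced m n v) {c : ℕ} (hc : c ≤ m) :
    ∑ j ∈ Finset.Ico c m, contr D j (extD D j (extLow D c v)) =
      extLow D c (((m : ℝ) - c) • (eulerF D v + ((n : ℝ) - c) • v) - casimir D m v) := by
  induction c with
  | zero =>
    simp only [extLow, Module.End.one_apply, casimir, LinearMap.sum_apply, Module.End.mul_apply,
      ← Finset.range_eq_Ico, contr_extD_apply, if_true, Finset.sum_sub_distrib]
    congr 1
    rw [Finset.sum_congr rfl (g := fun _ => (n : ℝ) • v + eulerF D v) fun j hj => by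
      rw [hv j (Finset.mem_range.1 hj) j (Finset.mem_range.1 hj), if_pos rfl]]
    rw [Finset.sum_const, Finset.card_range, ← Nat.cast_smul_eq_nsmul ℝ]
    push_cast
    module
  | succ c ih =>
    have ih := ih (by omega)
    have hm := fun {i j : ℕ} => move_extLow hv (r := c) (i := i) (j := j)
    have hE := eulerF_extLow c v
    simp only [extLow, Module.End.mul_apply]
    set u := extLow D c v with hu
    have key : extD D c (∑ j ∈ Finset.Ico c m, contr D j (extD D j u)) =
        ∑ j ∈ Finset.Ico (c + 1) m, contr D j (extD D j (extD D c u)) +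
          (eulerF D (extD D c u) + ((n : ℝ) + m - c) • extD D c u) := by
      rw [Finset.sum_eq_sum_Ico_succ_bot (by omega), map_add, map_sum]
      have h1 : ∀ j ∈ Finset.Ico (c + 1) m, extD D c (contr D j (extD D j u)) =
          contr D j (extD D j (extD D c u)) + extD D c u := by
        intro j hj
        rw [Finset.mem_Ico] at hj
        have h2 := contr_extD_apply c j (extD D j u)
        rw [if_neg (show c ≠ j by omega), move_extD_apply, if_pos rfl,
          hm (by omega) (by omega) (by omega), if_neg (show c ≠ j by omega),
          extD_extD_apply c j u, map_neg, map_zero, zero_add, add_zero] at h2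
        rw [neg_eq_iff_eq_neg] at h2
        rw [h2]; abel
      have h3 := contr_extD_apply c c (extD D c u)
      rw [extD_extD_self, map_zero, if_pos rfl, move_extD_apply, if_pos rfl,
        hm le_rfl (by omega) (by omega), if_pos rfl, map_smul] at h3
      rw [Finset.sum_congr rfl h1, Finset.sum_add_distrib, (sub_eq_zero.1 h3.symm).symm,
        Finset.sum_const, Nat.card_Ico, ← Nat.cast_smul_eq_nsmul ℝ, Nat.cast_sub (by omega)]
      push_cast
      module
    rw [ih] at key
    rw [← sub_eq_iff_eq_add] at key
    rw [← key, eulerF_extD_apply, hE]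
    simp only [map_sub, map_add, map_smul, Nat.cast_succ, ← hu]
    module

theorem extLow_casimir_eq (hv : IsBalanced m n v) {k : ℕ} (hk : k < m)
    (h : extLow D (k + 1) v = 0) : extLow D k (casimir D m v) =
      extLow D k (((m : ℝ) - k) • (eulerF D v + ((n : ℝ) - k) • v)) := by
  rw [extLow, Module.End.mul_apply] at h
  -- Moving an index from column `k` to `j` in `d_k (extLow k v) = 0` gives the same equation with
  -- `d_j`, so the sum of the preceding lemma vanishes.
  have h0 : ∀ j ∈ Finset.Ico k m, contr D j (extD D j (extLow D k v)) = 0 := by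
    intro j hj
    rw [Finset.mem_Ico] at hj
    have h1 := move_extD_apply j k k (extLow D k v)
    rw [h, if_pos rfl, move_extLow hv le_rfl (by omega) hk, map_zero] at h1
    rcases eq_or_ne j k with rfl | hne
    · rw [h, map_zero]
    · rw [if_neg hne, map_zero, zero_add] at h1
      rw [← h1, map_zero]
  have h1 := sum_contr_extD_extLow hv hk.le
  rw [Finset.sum_eq_zero h0, map_sub] at h1
  exact (sub_eq_zero.1 h1.symm).symm

end

/-! ### Solving modulo the kernels of `extLow` -/

section


/-- The product of the first `r` factors `A - rootOp`. -/
def rootProd (D m n : ℕ) : ℕ → Module.End ℝ (Multiform D)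
  | 0 => 1
  | r + 1 => rootProd D m n r * (casimir D m - rootOp D m n r)

variable {D m n : ℕ} {W : Submodule ℝ (Multiform D)}

theorem rootFactor_mem (hA : ∀ v ∈ W, casimir D m v ∈ W) (hE : ∀ v ∈ W, eulerF D v ∈ W) (r : ℕ)
    {v : Multiform D} (hv : v ∈ W) : (casimir D m - rootOp D m n r) v ∈ W :=
  W.sub_mem (hA v hv) (W.smul_mem _ (W.add_mem (hE v hv) (W.smul_mem _ hv)))

/-- The identity `(m - k)(E + n - k) - r (E + n - m + r) = (m - r - k)(E + n + r - k)`, with `A`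
replaced by its value from `extLow_casimir_eq`. -/
theorem extLow_rootFactor {v : Multiform D} (hv : IsBalanced m n v) {k : ℕ} (hk : k < m) (r : ℕ)
    (h : extLow D (k + 1) v = 0) : extLow D k ((casimir D m - rootOp D m n r) v) =
      ((m : ℝ) - r - k) • extLow D k (eulerF D v + ((n : ℝ) + r - k) • v) := by
  rw [LinearMap.sub_apply, map_sub, extLow_casimir_eq hv hk h]
  simp only [rootOp, map_add, map_smul, LinearMap.smul_apply, LinearMap.add_apply,
    Module.End.one_apply]
  module

/-- For positive `k`, `extLow_rootFactor` one level lower leaves only `E` and scalars, and `E`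
preserves the kernel because it commutes with `extLow` up to a scalar. -/
theorem extLow_rootFactor_eq_zero (hW : ∀ v ∈ W, IsBalanced m n v) {v : Multiform D} (hv : v ∈ W)
    {k : ℕ} (hk : k ≤ m) (r : ℕ) (h : extLow D k v = 0) :
    extLow D k ((casimir D m - rootOp D m n r) v) = 0 := by
  cases k with
  | zero => rw [extLow, Module.End.one_apply] at h; rw [h]; simp
  | succ k =>
    have hE := eulerF_extLow (k + 1) v
    rw [h, map_zero, smul_zero, sub_zero] at hE
    have h1 := extLow_rootFactor (hW v hv) (show k < m by omega) r h
    change extD D k (extLow D k _) = 0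
    rw [h1, map_smul]
    change ((m : ℝ) - r - k) • extLow D (k + 1) _ = 0
    rw [map_add, map_smul, ← hE, h]
    simp

theorem extLow_rootProd_eq_zero (hW : ∀ v ∈ W, IsBalanced m n v)
    (hA : ∀ v ∈ W, casimir D m v ∈ W) (hE : ∀ v ∈ W, eulerF D v ∈ W) {k : ℕ} (hk : k ≤ m) (r : ℕ) :
    ∀ v ∈ W, extLow D k v = 0 → extLow D k (rootProd D m n r v) = 0 := by
  induction r with
  | zero => intro v _ h; exact h
  | succ r ih =>
    intro v hv h
    exact ih _ (rootFactor_mem hA hE r hv) (extLow_rootFactor_eq_zero hW hv hk r h)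

theorem exists_extLow_rootFactor_eq (hn : 1 ≤ n) (hW : ∀ v ∈ W, IsBalanced m n v)
    (hG : ∀ c : ℤ, ∀ v ∈ W, ∃ w ∈ W, eulerF D (eulerF D w + (c : ℝ) • w - v) +
      (c : ℝ) • (eulerF D w + (c : ℝ) • w - v) = 0) {k r : ℕ} (hk : k + r < m)
    {v : Multiform D} (hv : v ∈ W) (h : extLow D (k + 1) v = 0) :
    ∃ w ∈ W, extLow D (k + 1) w = 0 ∧
      extLow D k ((casimir D m - rootOp D m n r) w) = extLow D k v := by
  -- The constant of `extLow_rootFactor`; the error `y` below is homogeneous of degree `k - n - r`.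
  obtain ⟨w, hw, hy⟩ := hG ((n : ℤ) + r - k) v hv
  have hs : (m : ℝ) - r - k ≠ 0 := by
    have : ((k + r : ℕ) : ℝ) < m := by exact_mod_cast hk
    push_cast at this
    linarith
  push_cast at hy
  set y := eulerF D w + ((n : ℝ) + r - k) • w - v with hydef
  -- Under `extLow k` the equation for `y` becomes `E + n + r`, and under `extLow (k + 1)` the one
  -- for `w` becomes `E + n + r + 1`. Since `n ≥ 1`, both constants are positive even for `r = 0`.
  obtain ⟨a, rfl⟩ : ∃ a, n = a + 1 := ⟨n - 1, by omega⟩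
  push_cast at hy hydef
  have hy0 : extLow D k y = 0 := by
    apply eulerF_add_injective (a + r)
    have := congrArg (extLow D k) hy
    rw [map_add, map_smul, map_zero] at this
    rw [eulerF_extLow, ← this]
    push_cast
    module
  have hw0 : extLow D (k + 1) w = 0 := by
    apply eulerF_add_injective (a + r + 1)
    have h1 : extLow D (k + 1) y = 0 := by
      change extD D k (extLow D k y) = 0
      rw [hy0, map_zero]
    rw [hydef, map_sub, h, sub_zero, map_add, map_smul] at h1
    rw [eulerF_extLow, ← h1]
    push_cast
    module
  refine ⟨((m : ℝ) - r - k)⁻¹ • w, W.smul_mem _ hw, by rw [map_smul, hw0, smul_zero], ?_⟩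
  rw [map_smul, map_smul, extLow_rootFactor (hW w hw) (by omega) r hw0, smul_smul,
    inv_mul_cancel₀ hs, one_smul]
  rw [hydef, map_sub, sub_eq_zero] at hy0
  push_cast
  exact hy0

/-- The factors are inverted one at a time. The error made in inverting the last one lies in the
kernel of `extLow k`, which the remaining product preserves. -/
theorem exists_extLow_rootProd_eq (hn : 1 ≤ n) (hW : ∀ v ∈ W, IsBalanced m n v)
    (hA : ∀ v ∈ W, casimir D m v ∈ W) (hE : ∀ v ∈ W, eulerF D v ∈ W)
    (hG : ∀ c : ℤ, ∀ v ∈ W, ∃ w ∈ W, eulerF D (eulerF D w + (c : ℝ) • w - v) +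
      (c : ℝ) • (eulerF D w + (c : ℝ) • w - v) = 0) {k : ℕ} (r : ℕ) (hk : k + r ≤ m) :
    ∀ v ∈ W, extLow D (k + 1) v = 0 → ∃ w ∈ W, extLow D (k + 1) w = 0 ∧
      extLow D k (rootProd D m n r w) = extLow D k v := by
  induction r with
  | zero => intro v hv h; exact ⟨v, hv, h, rfl⟩
  | succ r ih =>
    intro v hv h
    obtain ⟨w, hw, hw0, hwv⟩ := ih (by omega) v hv h
    obtain ⟨w', hw', hw0', hww'⟩ := exists_extLow_rootFactor_eq hn hW hG (r := r) (by omega) hw hw0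
    refine ⟨w', hw', hw0', ?_⟩
    rw [← hwv, ← sub_eq_zero, ← map_sub]
    change extLow D k (rootProd D m n r ((casimir D m - rootOp D m n r) w') - _) = 0
    rw [← map_sub]
    refine extLow_rootProd_eq_zero hW hA hE (by omega) r _
      (W.sub_mem (rootFactor_mem hA hE r hw') hw) ?_
    rw [map_sub, hww', sub_self]

/-- A vector killed by `extLow (k + 1)` agrees with some `rootProd q w` up to one killed by `extLow
k`. The bound on `k + q` keeps the scalars `m - r - k`, for `r < q`, nonzero at each stage; for `m =
N - 1` it is `k + q ≤ N`. -/
theorem mem_of_extLow_eq_zero (hn : 1 ≤ n) (hW : ∀ v ∈ W, IsBalanced m n v)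
    (hA : ∀ v ∈ W, casimir D m v ∈ W) (hE : ∀ v ∈ W, eulerF D v ∈ W)
    (hG : ∀ c : ℤ, ∀ v ∈ W, ∃ w ∈ W, eulerF D (eulerF D w + (c : ℝ) • w - v) +
      (c : ℝ) • (eulerF D w + (c : ℝ) • w - v) = 0) {q : ℕ} {I : Submodule ℝ (Multiform D)}
    (hI : ∀ w ∈ W, rootProd D m n q w ∈ I) {k : ℕ} (hk : k + q ≤ m + 1) :
    ∀ v ∈ W, extLow D k v = 0 → v ∈ I := by
  have hP : ∀ r, ∀ w ∈ W, rootProd D m n r w ∈ W := by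
    intro r
    induction r with
    | zero => intro w hw; exact hw
    | succ r ih => intro w hw; exact ih _ (rootFactor_mem hA hE r hw)
  induction k with
  | zero => intro v _ h; rw [extLow, Module.End.one_apply] at h; rw [h]; exact I.zero_mem
  | succ k ih =>
    intro v hv h
    obtain ⟨w, hw, -, hwv⟩ := exists_extLow_rootProd_eq hn hW hA hE hG q (by omega) v hv h
    have := ih (by omega) (v - rootProd D m n q w) (W.sub_mem hv (hP q w hw))
      (by rw [map_sub, hwv, sub_self])
    rw [← sub_add_cancel v (rootProd D m n q w)]
    exact I.add_mem this (hI w hw)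

end

/-! ### Row and column permutations and the Young symmetrizer -/

section


open Equiv

section cells

theorem cell_succ (N p : ℕ) (i : Fin p) : cell N (p + 1) i.succ = cell N p i := by
  simp [cell, Fin.rev_succ]

theorem cell_zero (N p : ℕ) : cell N (p + 1) 0 = (p / (N - 1), p % (N - 1)) := by
  simp [cell]

theorem cell_eq (N p : ℕ) (i : Fin p) :
    (N - 1) * (cell N p i).1 + (cell N p i).2 = (i.rev : ℕ) := Nat.div_add_mod _ _

theorem cell_injective (N p : ℕ) : Function.Injective (cell N p) := by
  intro i j h
  have h1 := cell_eq N p i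
  rw [h, cell_eq] at h1
  exact Fin.rev_injective (Fin.ext h1.symm)

theorem cell_snd_lt {N : ℕ} (hN : 2 ≤ N) {p : ℕ} (i : Fin p) : (cell N p i).2 < N - 1 :=
  Nat.mod_lt _ (by omega)

theorem exists_cell_eq {N : ℕ} {p a b : ℕ} (hb : b < N - 1) (h : (N - 1) * a + b < p) :
    ∃ i : Fin p, cell N p i = (a, b) := by
  refine ⟨(⟨(N - 1) * a + b, h⟩ : Fin p).rev, ?_⟩
  simp only [cell, Fin.rev_rev, Prod.mk.injEq]
  exact ⟨by rw [Nat.mul_add_div (by omega), Nat.div_eq_of_lt hb, add_zero],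
    by rw [Nat.mul_add_mod, Nat.mod_eq_of_lt hb]⟩

theorem mem_rowPerms {N p : ℕ} {σ : Perm (Fin p)} :
    σ ∈ rowPerms N p ↔ ∀ i, (cell N p (σ i)).1 = (cell N p i).1 := by
  simp [rowPerms]

theorem mem_colPerms {N p : ℕ} {σ : Perm (Fin p)} :
    σ ∈ colPerms N p ↔ ∀ i, (cell N p (σ i)).2 = (cell N p i).2 := by
  simp [colPerms]

theorem rowPerms_mul {N p : ℕ} {σ τ : Perm (Fin p)} (hσ : σ ∈ rowPerms N p)
    (hτ : τ ∈ rowPerms N p) : σ * τ ∈ rowPerms N p :=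
  mem_rowPerms.2 fun i => (mem_rowPerms.1 hσ _).trans (mem_rowPerms.1 hτ i)

theorem colPerms_mul {N p : ℕ} {σ τ : Perm (Fin p)} (hσ : σ ∈ colPerms N p)
    (hτ : τ ∈ colPerms N p) : σ * τ ∈ colPerms N p :=
  mem_colPerms.2 fun i => (mem_colPerms.1 hσ _).trans (mem_colPerms.1 hτ i)

theorem rowPerms_inv {N p : ℕ} {σ : Perm (Fin p)} (hσ : σ ∈ rowPerms N p) :
    σ⁻¹ ∈ rowPerms N p :=
  mem_rowPerms.2 fun i => by simpa using (mem_rowPerms.1 hσ (σ⁻¹ i)).symm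

theorem colPerms_inv {N p : ℕ} {σ : Perm (Fin p)} (hσ : σ ∈ colPerms N p) :
    σ⁻¹ ∈ colPerms N p :=
  mem_colPerms.2 fun i => by simpa using (mem_colPerms.1 hσ (σ⁻¹ i)).symm

theorem one_mem_rowPerms (N p : ℕ) : 1 ∈ rowPerms N p := mem_rowPerms.2 fun _ => rfl

theorem one_mem_colPerms (N p : ℕ) : 1 ∈ colPerms N p := mem_colPerms.2 fun _ => rfl

theorem swap_mem_rowPerms {N p : ℕ} {i j : Fin p} (h : (cell N p i).1 = (cell N p j).1) :
    swap i j ∈ rowPerms N p := mem_rowPerms.2 fun l => by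
  rw [swap_apply_def]; split_ifs with h1 h2
  · rw [h1, h]
  · rw [h2, h]
  · rfl

theorem swap_mem_colPerms {N p : ℕ} {i j : Fin p} (h : (cell N p i).2 = (cell N p j).2) :
    swap i j ∈ colPerms N p := mem_colPerms.2 fun l => by
  rw [swap_apply_def]; split_ifs with h1 h2
  · rw [h1, h]
  · rw [h2, h]
  · rfl

theorem card_rowPerms_ne_zero (N p : ℕ) : ((rowPerms N p).card : ℝ) ≠ 0 :=
  Nat.cast_ne_zero.2 (Finset.card_ne_zero_of_mem (one_mem_rowPerms N p))

theorem card_colPerms_ne_zero (N p : ℕ) : ((colPerms N p).card : ℝ) ≠ 0 :=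
  Nat.cast_ne_zero.2 (Finset.card_ne_zero_of_mem (one_mem_colPerms N p))

/-- If `g` sends no two cells of a row to the same column, then it is a row permutation followed by
a column permutation. -/
theorem exists_row_col_factorization {N : ℕ} (hN : 2 ≤ N) {p : ℕ} (g : Perm (Fin p))
    (hg : ∀ i j, (cell N p i).1 = (cell N p j).1 → (cell N p (g i)).2 = (cell N p (g j)).2 →
      i = j) :
    ∃ c ∈ colPerms N p, ∃ r ∈ rowPerms N p, g = c * r := by
  have key : ∀ i, ∃ j, cell N p j = ((cell N p i).1, (cell N p (g i)).2) := by
    intro i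
    have hγ := cell_snd_lt hN (g i)
    refine exists_cell_eq hγ ?_
    -- Suppose the cell in row `a` and column `γ` is missing, so that column `γ` has at most `a`
    -- cells. Each of the `a` full rows above sends a cell to column `γ` under `g`, and so does `i`:
    -- `a + 1` cells in too few places.
    by_contra hcon
    set q := N - 1 with hq
    set a := (cell N p i).1 with ha
    set γ := (cell N p (g i)).2 with hγd
    have hfull : ∀ b < a, ∃ x, (cell N p x).1 = b ∧ (cell N p (g x)).2 = γ := by
      intro b hb
      have hlt : ∀ y < q, q * b + y < p := by
        intro y hy
        have h1 := cell_eq N p i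
        have h2 := i.rev.isLt
        have h3 : q * (b + 1) ≤ q * a := Nat.mul_le_mul_left _ hb
        rw [Nat.mul_succ] at h3
        rw [← ha, ← hq] at h1
        omega
      choose x hx using fun y : Fin q => exists_cell_eq (N := N) (a := b) y.isLt (hlt y y.isLt)
      have hinj : Function.Injective fun y : Fin q =>
          (⟨(cell N p (g (x y))).2, cell_snd_lt hN _⟩ : Fin q) := by
        intro y y' h
        have := hg (x y) (x y') (by rw [hx, hx]) (Fin.mk.inj_iff.1 h)
        have h2 := congrArg (cell N p) this
        rw [hx, hx, Prod.mk.injEq] at h2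
        exact Fin.ext h2.2
      obtain ⟨y, hy⟩ := (Finite.injective_iff_surjective.1 hinj) ⟨γ, hγ⟩
      exact ⟨x y, by rw [hx], Fin.mk.inj_iff.1 hy⟩
    have hfull' : ∀ b : Fin (a + 1), ∃ x, (cell N p x).1 = b ∧ (cell N p (g x)).2 = γ := by
      intro b
      rcases Nat.lt_succ_iff_lt_or_eq.1 b.isLt with h | h
      · exact hfull b h
      · exact ⟨i, h.symm ▸ rfl, rfl⟩
    choose x hx using hfull'
    have hlt : ∀ b, (cell N p (g (x b))).1 < a := by
      intro b
      by_contra hb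
      have h1 := cell_eq N p (g (x b))
      have h2 := (g (x b)).rev.isLt
      have h3 : q * a ≤ q * (cell N p (g (x b))).1 := Nat.mul_le_mul_left _ (by omega)
      rw [(hx b).2, ← hq] at h1
      omega
    have hinj : Function.Injective fun b : Fin (a + 1) =>
        (⟨(cell N p (g (x b))).1, hlt b⟩ : Fin a) := by
      intro b b' h
      have h1 : cell N p (g (x b)) = cell N p (g (x b')) :=
        Prod.ext (Fin.mk.inj_iff.1 h) ((hx b).2.trans (hx b').2.symm)
      have h2 := g.injective (cell_injective N p h1)
      have h3 := (hx b).1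
      rw [h2, (hx b').1] at h3
      exact Fin.ext h3.symm
    have := Fintype.card_le_of_injective _ hinj
    simp at this
  choose h hh using key
  have hinj : Function.Injective h := by
    intro i j hij
    have h1 := hh i
    rw [hij, hh j, Prod.mk.injEq] at h1
    exact hg i j h1.1.symm h1.2.symm
  set r : Perm (Fin p) := Equiv.ofBijective h (Finite.injective_iff_bijective.1 hinj)
  refine ⟨g * r⁻¹, ?_, r, ?_, by simp⟩
  · rw [← inv_inv (g * r⁻¹)]
    refine colPerms_inv (mem_colPerms.2 fun y => ?_)
    rw [mul_inv_rev, inv_inv, Perm.mul_apply]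
    change (cell N p (h (g⁻¹ y))).2 = _
    rw [hh]; simp
  · exact mem_rowPerms.2 fun i => by change (cell N p (h i)).1 = _; rw [hh]

end cells

section symmetrizers

variable {D p : ℕ} {M : Type} [AddCommGroup M] [Module ℝ M]

/-- The permutation `σ` of the indices of a tensor with coefficients in `M`. -/
def permT (σ : Perm (Fin p)) : ((Fin p → Fin D) → M) →ₗ[ℝ] ((Fin p → Fin D) → M) :=
  LinearMap.funLeft ℝ M (fun μ : Fin p → Fin D => μ ∘ σ)

/-- Row symmetrization of tensors with coefficients in `M`. -/
def rowSymT (N : ℕ) : ((Fin p → Fin D) → M) →ₗ[ℝ] ((Fin p → Fin D) → M) :=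
  ((rowPerms N p).card : ℝ)⁻¹ • ∑ σ ∈ rowPerms N p, permT σ

/-- Column antisymmetrization of tensors with coefficients in `M`. -/
def colAltT (N : ℕ) : ((Fin p → Fin D) → M) →ₗ[ℝ] ((Fin p → Fin D) → M) :=
  ((colPerms N p).card : ℝ)⁻¹ •
    ∑ σ ∈ colPerms N p, ((Perm.sign σ : ℤ) : ℝ) • permT σ

theorem permT_apply (σ : Perm (Fin p)) (X : (Fin p → Fin D) → M) (μ : Fin p → Fin D) :
    permT σ X μ = X (μ ∘ σ) := rfl

theorem permT_permT (σ τ : Perm (Fin p)) (X : (Fin p → Fin D) → M) :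
    permT σ (permT τ X) = permT (σ * τ) X := rfl

theorem permT_one (X : (Fin p → Fin D) → M) : permT 1 X = X := rfl

theorem rowSymT_apply (N : ℕ) (X : (Fin p → Fin D) → M) :
    rowSymT N X = ((rowPerms N p).card : ℝ)⁻¹ • ∑ σ ∈ rowPerms N p, permT σ X := by
  simp [rowSymT, LinearMap.sum_apply]

theorem colAltT_apply (N : ℕ) (X : (Fin p → Fin D) → M) :
    colAltT N X = ((colPerms N p).card : ℝ)⁻¹ •
      ∑ σ ∈ colPerms N p, ((Perm.sign σ : ℤ) : ℝ) • permT σ X := by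
  simp [colAltT, LinearMap.sum_apply]

theorem sign_mul_self (σ : Perm (Fin p)) :
    ((Perm.sign σ : ℤ) : ℝ) * ((Perm.sign σ : ℤ) : ℝ) = 1 := by
  rcases Int.units_eq_one_or (Perm.sign σ) with h | h <;> rw [h] <;> norm_num

theorem permT_rowSymT {N : ℕ} {τ : Perm (Fin p)} (hτ : τ ∈ rowPerms N p)
    (X : (Fin p → Fin D) → M) : permT τ (rowSymT N X) = rowSymT N X := by
  rw [rowSymT_apply, map_smul, map_sum]
  congr 1
  refine Finset.sum_bij' (fun σ _ => τ * σ) (fun σ _ => τ⁻¹ * σ) ?_ ?_ ?_ ?_ ?_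
  · exact fun σ h => rowPerms_mul hτ h
  · exact fun σ h => rowPerms_mul (rowPerms_inv hτ) h
  · intros; simp
  · intros; simp
  · intros; rfl

theorem rowSymT_permT {N : ℕ} {τ : Perm (Fin p)} (hτ : τ ∈ rowPerms N p)
    (X : (Fin p → Fin D) → M) : rowSymT N (permT τ X) = rowSymT N X := by
  rw [rowSymT_apply, rowSymT_apply]
  congr 1
  refine Finset.sum_bij' (fun σ _ => σ * τ) (fun σ _ => σ * τ⁻¹) ?_ ?_ ?_ ?_ ?_
  · exact fun σ h => rowPerms_mul h hτ
  · exact fun σ h => rowPerms_mul h (rowPerms_inv hτ)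
  · intros; simp
  · intros; simp
  · intros; rfl

theorem permT_colAltT {N : ℕ} {τ : Perm (Fin p)} (hτ : τ ∈ colPerms N p)
    (X : (Fin p → Fin D) → M) :
    permT τ (colAltT N X) = ((Perm.sign τ : ℤ) : ℝ) • colAltT N X := by
  rw [colAltT_apply, map_smul, map_sum, smul_comm]
  congr 1
  rw [Finset.smul_sum]
  refine Finset.sum_bij' (fun σ _ => τ * σ) (fun σ _ => τ⁻¹ * σ) ?_ ?_ ?_ ?_ ?_
  · exact fun σ h => colPerms_mul hτ h
  · exact fun σ h => colPerms_mul (colPerms_inv hτ) h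
  · intros; simp
  · intros; simp
  · intro σ _
    rw [smul_smul, Perm.sign_mul, Units.val_mul, Int.cast_mul, ← mul_assoc, sign_mul_self, one_mul,
      map_smul]
    rfl

theorem colAltT_permT {N : ℕ} {τ : Perm (Fin p)} (hτ : τ ∈ colPerms N p)
    (X : (Fin p → Fin D) → M) :
    colAltT N (permT τ X) = ((Perm.sign τ : ℤ) : ℝ) • colAltT N X := by
  rw [colAltT_apply, colAltT_apply, smul_comm]
  congr 1
  rw [Finset.smul_sum]
  refine Finset.sum_bij' (fun σ _ => σ * τ) (fun σ _ => σ * τ⁻¹) ?_ ?_ ?_ ?_ ?_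
  · exact fun σ h => colPerms_mul h hτ
  · exact fun σ h => colPerms_mul h (colPerms_inv hτ)
  · intros; simp
  · intros; simp
  · intro σ _
    rw [smul_smul, Perm.sign_mul, Units.val_mul, Int.cast_mul, mul_left_comm, sign_mul_self,
      mul_one]
    rfl

theorem rowSymT_eq_self {N : ℕ} {X : (Fin p → Fin D) → M}
    (h : ∀ τ ∈ rowPerms N p, permT τ X = X) : rowSymT N X = X := by
  rw [rowSymT_apply, Finset.sum_congr rfl h, Finset.sum_const, ← Nat.cast_smul_eq_nsmul ℝ,
    inv_smul_smul₀ (card_rowPerms_ne_zero N p)]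

theorem rowSymT_rowSymT (N : ℕ) (X : (Fin p → Fin D) → M) :
    rowSymT N (rowSymT N X) = rowSymT N X :=
  rowSymT_eq_self fun _ hτ => permT_rowSymT hτ X

theorem colAltT_colAltT (N : ℕ) (X : (Fin p → Fin D) → M) :
    colAltT N (colAltT N X) = colAltT N X := by
  rw [colAltT_apply N (colAltT N X), Finset.sum_congr rfl (g := fun _ => colAltT N X),
    Finset.sum_const, ← Nat.cast_smul_eq_nsmul ℝ, inv_smul_smul₀ (card_colPerms_ne_zero N p)]
  intro σ hσ
  rw [permT_colAltT hσ, smul_smul, sign_mul_self, one_smul]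

theorem eq_zero_of_eq_neg {V : Type*} [AddCommGroup V] [Module ℝ V] {v : V} (h : v = -v) :
    v = 0 := by
  have h2 : (2 : ℝ) • v = 0 := by
    rw [two_smul]; nth_rewrite 1 [h]; exact neg_add_cancel v
  exact (smul_eq_zero.1 h2).resolve_left two_ne_zero

theorem colAltT_swap {N : ℕ} {i j : Fin p} (hij : i ≠ j) (h : (cell N p i).2 = (cell N p j).2)
    (X : (Fin p → Fin D) → M) : colAltT N (permT (swap i j) X) = - colAltT N X := by
  rw [colAltT_permT (swap_mem_colPerms h), Perm.sign_swap hij]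
  simp

/-- Von Neumann's lemma. -/
theorem exists_colAltT_permT_rowSymT {N : ℕ} (hN : 2 ≤ N) {p : ℕ} (g : Perm (Fin p)) :
    ∃ ε : ℝ, ∀ (D : ℕ) (M : Type) [AddCommGroup M] [Module ℝ M] (X : (Fin p → Fin D) → M),
      colAltT N (permT g (rowSymT N X)) = ε • colAltT N (rowSymT N X) := by
  by_cases hg : ∀ i j, (cell N p i).1 = (cell N p j).1 →
      (cell N p (g i)).2 = (cell N p (g j)).2 → i = j
  · obtain ⟨c, hc, r, hr, rfl⟩ := exists_row_col_factorization hN g hg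
    refine ⟨((Perm.sign c : ℤ) : ℝ), fun D M _ _ X => ?_⟩
    rw [← permT_permT, permT_rowSymT hr, colAltT_permT hc]
  · push Not at hg
    obtain ⟨i, j, hrow, hcol, hij⟩ := hg
    refine ⟨0, fun D M _ _ X => ?_⟩
    rw [zero_smul]
    apply eq_zero_of_eq_neg
    conv_lhs => rw [← permT_rowSymT (swap_mem_rowPerms hrow) X, permT_permT, mul_swap_eq_swap_mul,
      ← permT_permT, colAltT_swap (g.injective.ne hij) hcol]

/-- Expanding the middle symmetrizers, von Neumann's lemma makes every term a multiple of the Young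
symmetrizer. The constant is uniform in `D` and the coefficients, so one test tensor can show that
it is nonzero. -/
theorem exists_young_sq {N : ℕ} (hN : 2 ≤ N) (p : ℕ) :
    ∃ κ : ℝ, ∀ (D : ℕ) (M : Type) [AddCommGroup M] [Module ℝ M] (X : (Fin p → Fin D) → M),
      colAltT N (rowSymT N (colAltT N (rowSymT N X))) = κ • colAltT N (rowSymT N X) := by
  choose ε hε using exists_colAltT_permT_rowSymT hN (p := p)
  refine ⟨((rowPerms N p).card : ℝ)⁻¹ * ∑ σ ∈ rowPerms N p, ((colPerms N p).card : ℝ)⁻¹ *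
    ∑ τ ∈ colPerms N p, ((Perm.sign τ : ℤ) : ℝ) * ε (σ * τ), fun D M _ _ X => ?_⟩
  rw [rowSymT_apply N (colAltT N (rowSymT N X)), map_smul, map_sum, mul_smul, Finset.sum_smul]
  congr 1
  refine Finset.sum_congr rfl fun σ _ => ?_
  conv_lhs => rw [colAltT_apply N (rowSymT N X)]
  rw [map_smul, map_smul, map_sum, map_sum, mul_smul, Finset.sum_smul]
  congr 1
  refine Finset.sum_congr rfl fun τ _ => ?_
  rw [map_smul, map_smul, permT_permT, hε, mul_smul]

/-- The standard scalar product of real tensors. -/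
def pairing (S T : (Fin p → Fin D) → ℝ) : ℝ := ∑ μ, S μ * T μ

theorem pairing_permT (σ : Perm (Fin p)) (S T : (Fin p → Fin D) → ℝ) :
    pairing (permT σ S) T = pairing S (permT σ⁻¹ T) := by
  refine Fintype.sum_equiv (σ.symm.arrowCongr (Equiv.refl (Fin D))) _ _ fun μ => ?_
  simp only [permT_apply]
  congr 2
  funext i; simp [Equiv.arrowCongr]

theorem pairing_self_eq_zero {S : (Fin p → Fin D) → ℝ} (h : pairing S S = 0) : S = 0 := by
  funext μ
  have := (Finset.sum_eq_zero_iff_of_nonneg fun μ _ => mul_self_nonneg (S μ)).1 h μ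
    (Finset.mem_univ μ)
  exact mul_self_eq_zero.1 this

/-- The scalar product as a bilinear map. -/
def pairingL : ((Fin p → Fin D) → ℝ) →ₗ[ℝ] ((Fin p → Fin D) → ℝ) →ₗ[ℝ] ℝ :=
  LinearMap.mk₂ ℝ pairing
    (fun a b c => by simp [pairing, add_mul, Finset.sum_add_distrib])
    (fun a b c => by simp [pairing, Finset.mul_sum, mul_assoc])
    (fun a b c => by simp [pairing, mul_add, Finset.sum_add_distrib])
    (fun a b c => by simp [pairing, Finset.mul_sum, mul_left_comm])

theorem pairing_rowSymT (N : ℕ) (S T : (Fin p → Fin D) → ℝ) :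
    pairingL (rowSymT N S) T = pairingL S (rowSymT N T) := by
  rw [rowSymT_apply, rowSymT_apply, map_smul, LinearMap.smul_apply, map_smul, map_sum,
    LinearMap.sum_apply, map_sum]
  congr 1
  refine Finset.sum_bij' (fun σ _ => σ⁻¹) (fun σ _ => σ⁻¹) ?_ ?_ ?_ ?_ ?_
  · exact fun σ h => rowPerms_inv h
  · exact fun σ h => rowPerms_inv h
  · intros; simp
  · intros; simp
  · exact fun σ _ => pairing_permT σ S T

theorem pairing_colAltT (N : ℕ) (S T : (Fin p → Fin D) → ℝ) :
    pairingL (colAltT N S) T = pairingL S (colAltT N T) := by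
  rw [colAltT_apply, colAltT_apply, map_smul, LinearMap.smul_apply, map_smul, map_sum,
    LinearMap.sum_apply, map_sum]
  congr 1
  refine Finset.sum_bij' (fun σ _ => σ⁻¹) (fun σ _ => σ⁻¹) ?_ ?_ ?_ ?_ ?_
  · exact fun σ h => colPerms_inv h
  · exact fun σ h => colPerms_inv h
  · intros; simp
  · intros; simp
  · intro σ _
    rw [map_smul, map_smul, LinearMap.smul_apply, Perm.sign_inv]
    congr 1
    exact pairing_permT σ S T

theorem exists_young_sq_ne_zero {N : ℕ} (hN : 2 ≤ N) (p : ℕ) :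
    ∃ κ : ℝ, κ ≠ 0 ∧ ∀ (D : ℕ) (M : Type) [AddCommGroup M] [Module ℝ M]
      (X : (Fin p → Fin D) → M),
      colAltT N (rowSymT N (colAltT N (rowSymT N X))) = κ • colAltT N (rowSymT N X) := by
  obtain ⟨κ, hκ⟩ := exists_young_sq hN p
  refine ⟨κ, ?_, hκ⟩
  rintro rfl
  have hlt : ∀ i : Fin p, (cell N p i).1 < p := fun i =>
    lt_of_le_of_lt (Nat.div_le_self _ _) i.rev.isLt
  -- The test tensor is concentrated on the filling of each cell by its row number, the smallest
  -- row-invariant choice.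
  set ρ : Fin p → Fin p := fun i => ⟨(cell N p i).1, hlt i⟩ with hρ
  set t : (Fin p → Fin p) → ℝ := fun μ => if μ = ρ then 1 else 0 with ht
  have hRt : rowSymT N t = t := by
    refine rowSymT_eq_self fun τ hτ => ?_
    funext μ
    simp only [permT_apply, ht]
    congr 1
    have hρτ : ρ ∘ τ = ρ := funext fun i => Fin.ext (mem_rowPerms.1 hτ i)
    rw [eq_iff_iff]
    exact ⟨fun h => τ.surjective.injective_comp_right (h.trans hρτ.symm), fun h => by
      rw [h, hρτ]⟩
  have h0 := hκ p ℝ t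
  rw [hRt, zero_smul] at h0
  -- Row symmetrization `R` and column antisymmetrization `C` are orthogonal projections, so `⟨RCt,
  -- RCt⟩ = ⟨t, CRCt⟩ = 0`. Then `⟨t, Ct⟩ = 0`, but this number is `1 / |colPerms|`: only the
  -- identity preserves both rows and columns.
  have h1 : rowSymT N (colAltT N t) = 0 := by
    apply pairing_self_eq_zero
    change pairingL _ _ = 0
    rw [pairing_rowSymT, rowSymT_rowSymT, pairing_colAltT, h0, map_zero]
  have h2 : pairingL t (colAltT N t) = 0 := by
    rw [← hRt, pairing_rowSymT, hRt, h1, map_zero]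
  have h3 : pairingL t (colAltT N t) = colAltT N t ρ := by
    change ∑ μ, t μ * colAltT N t μ = _
    simp [ht]
  rw [h3, colAltT_apply, Pi.smul_apply, Finset.sum_apply, Finset.sum_eq_single 1] at h2
  · rw [permT_one, Perm.sign_one, Pi.smul_apply] at h2
    simp only [ht, if_true, Units.val_one, Int.cast_one, smul_eq_mul, mul_one] at h2
    exact inv_ne_zero (card_colPerms_ne_zero N p) h2
  · intro σ hσ hne
    rw [Pi.smul_apply, permT_apply]
    simp only [ht]
    rw [if_neg, smul_zero]
    intro h
    apply hne
    ext i
    have h4 : cell N p (σ i) = cell N p i :=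
      Prod.ext (Fin.mk.inj_iff.1 (congrFun h i)) (mem_colPerms.1 hσ i)
    rw [cell_injective N p h4]; rfl
  · exact fun h => absurd (one_mem_colPerms N p) h

end symmetrizers

end

/-! ### The Garnir identity -/

section


open Equiv

variable {D p : ℕ}

/-- The identity and the transpositions with `ℓ` represent the cosets of the permutations of `L` in
those of `L ∪ {ℓ}`. -/
theorem permT_swap_sum_swap {M : Type} [AddCommGroup M] [Module ℝ M] {U : (Fin p → Fin D) → M}
    {L : Finset (Fin p)} {ℓ : Fin p} (hℓ : ℓ ∉ L)
    (hU : ∀ i ∈ L, ∀ j ∈ L, permT (swap i j) U = U) {i : Fin p} (hi : i ∈ L) :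
    permT (swap i ℓ) (U + ∑ l ∈ L, permT (swap l ℓ) U) = U + ∑ l ∈ L, permT (swap l ℓ) U := by
  rw [map_add, map_sum, ← Finset.add_sum_erase L _ hi, ← Finset.add_sum_erase L _ hi,
    permT_permT, swap_mul_self, permT_one, ← add_assoc, ← add_assoc, add_comm U]
  congr 1
  refine Finset.sum_congr rfl fun l hl => ?_
  have hil : l ≠ i := Finset.ne_of_mem_erase hl
  have hl' := Finset.mem_of_mem_erase hl
  have hlℓ : l ≠ ℓ := fun h => hℓ (h ▸ hl')
  have hiℓ : i ≠ ℓ := fun h => hℓ (h ▸ hi)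
  have h : swap i ℓ * swap l ℓ = swap l ℓ * swap i l := by
    rw [mul_swap_eq_swap_mul, swap_apply_of_ne_of_ne hil hlℓ, swap_apply_right, swap_comm l i,
      mul_swap_eq_swap_mul, swap_apply_left, swap_apply_of_ne_of_ne hiℓ.symm hlℓ.symm]
  rw [permT_permT, h, ← permT_permT, hU i hi l hl']

/-- The sum `V` is symmetric in a full row together with one more index. Such a tensor is orthogonal
to the row symmetrization of anything antisymmetric in columns, hence to `U`, and by its own
symmetry to itself. -/
theorem garnir_real {N : ℕ} (Z : (Fin p → Fin D) → ℝ) (a : ℕ)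
    (ha : ∀ b < N - 1, ∃ i : Fin p, cell N p i = (a, b)) (hN : 2 ≤ N) (ℓ : Fin p)
    (hℓ : (cell N p ℓ).1 ≠ a) :
    rowSymT N (colAltT N Z) + ∑ l with (cell N p l).1 = a,
      permT (swap l ℓ) (rowSymT N (colAltT N Z)) = 0 := by
  set L : Finset (Fin p) := {l | (cell N p l).1 = a} with hL
  set U := rowSymT N (colAltT N Z) with hUdef
  set V := U + ∑ l ∈ L, permT (swap l ℓ) U with hV
  have hmem : ∀ l, l ∈ L ↔ (cell N p l).1 = a := fun l => by simp [hL]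
  have hinv : ∀ l ∈ L, permT (swap l ℓ) V = V := fun l hl =>
    permT_swap_sum_swap (by rw [hmem]; exact hℓ) (fun i hi j hj =>
      permT_rowSymT (swap_mem_rowPerms (((hmem i).1 hi).trans ((hmem j).1 hj).symm)) _) hl
  -- As row `a` is full, it has a cell `y` in the column of `x = g⁻¹ ℓ`. After `g`, the swap of `g
  -- y` and `ℓ` negates the left tensor and fixes `V`.
  have hg : ∀ g ∈ rowPerms N p, pairingL (permT g (colAltT N Z)) V = 0 := by
    intro g hg
    set x := g⁻¹ ℓ with hx
    obtain ⟨y, hy⟩ := ha (cell N p x).2 (cell_snd_lt hN x)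
    have hrow : (cell N p x).1 = (cell N p ℓ).1 := mem_rowPerms.1 (rowPerms_inv hg) ℓ
    have hxy : x ≠ y := by
      rintro h
      rw [← h] at hy
      exact hℓ (hrow ▸ congrArg Prod.fst hy)
    have hgy : g y ∈ L := by rw [hmem, mem_rowPerms.1 hg, hy]
    have h1 : permT g (colAltT N Z) = - permT (swap (g y) ℓ) (permT g (colAltT N Z)) := by
      have h2 := permT_colAltT (N := N) (τ := swap x y) (swap_mem_colPerms (by rw [hy])) Z
      rw [Perm.sign_swap hxy] at h2
      simp only [Units.val_neg, Units.val_one, Int.cast_neg, Int.cast_one, neg_smul, one_smul] at h2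
      have h3 : g * swap x y = swap (g y) ℓ * g := by
        rw [mul_swap_eq_swap_mul, swap_comm, hx]; simp
      rw [permT_permT, ← h3, ← permT_permT, h2, map_neg, neg_neg]
    apply eq_zero_of_eq_neg
    conv_lhs => rw [h1]
    rw [map_neg, LinearMap.neg_apply]
    congr 1
    refine (pairing_permT _ _ _).trans ?_
    rw [swap_inv, hinv _ hgy]; rfl
  have hUV : pairingL U V = 0 := by
    rw [hUdef, rowSymT_apply, map_smul, map_sum, LinearMap.smul_apply, LinearMap.sum_apply,
      Finset.sum_eq_zero hg, smul_zero]
  apply pairing_self_eq_zero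
  change pairingL V V = 0
  have h0 : pairingL V V = pairingL (U + ∑ l ∈ L, permT (swap l ℓ) U) V := by rw [← hV]
  clear_value V
  rw [h0, map_add, LinearMap.add_apply, map_sum, LinearMap.sum_apply, hUV, zero_add]
  refine Finset.sum_eq_zero fun l hl => ?_
  refine (pairing_permT _ _ _).trans ?_
  rw [swap_inv, hinv _ hl]
  exact hUV

section mapCoeff

variable {M M' : Type} [AddCommGroup M] [Module ℝ M] [AddCommGroup M'] [Module ℝ M']

/-- Application of a linear map to the components of a tensor. -/
def mapT (φ : M →ₗ[ℝ] M') : ((Fin p → Fin D) → M) →ₗ[ℝ] ((Fin p → Fin D) → M') :=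
  LinearMap.compLeft φ (Fin p → Fin D)

theorem mapT_apply (φ : M →ₗ[ℝ] M') (X : (Fin p → Fin D) → M) (μ : Fin p → Fin D) :
    mapT φ X μ = φ (X μ) := rfl

theorem mapT_permT (φ : M →ₗ[ℝ] M') (σ : Perm (Fin p)) (X : (Fin p → Fin D) → M) :
    mapT φ (permT σ X) = permT σ (mapT φ X) := rfl

theorem mapT_rowSymT (N : ℕ) (φ : M →ₗ[ℝ] M') (X : (Fin p → Fin D) → M) :
    mapT φ (rowSymT N X) = rowSymT N (mapT φ X) := by
  rw [rowSymT_apply, rowSymT_apply, map_smul, map_sum]; rfl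

theorem mapT_colAltT (N : ℕ) (φ : M →ₗ[ℝ] M') (X : (Fin p → Fin D) → M) :
    mapT φ (colAltT N X) = colAltT N (mapT φ X) := by
  rw [colAltT_apply, colAltT_apply, map_smul, map_sum]
  simp only [map_smul]; rfl

end mapCoeff

/-- Tensor fields on `ℝ^D` of degree `p`, given by their components. -/
abbrev Field (D p : ℕ) : Type := (Fin p → Fin D) → Smooth D

/-- Evaluation at a point, as a linear form. -/
def evalAt (x : Fin D → ℝ) : Smooth D →ₗ[ℝ] ℝ := LinearMap.proj x ∘ₗ (Smooth D).subtype

theorem field_ext {X Y : Field D p} (h : ∀ x, mapT (evalAt x) X = mapT (evalAt x) Y) : X = Y := by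
  funext μ
  ext x
  exact congrFun (h x) μ

theorem garnir {N : ℕ} (Z : Field D p) (a : ℕ)
    (ha : ∀ b < N - 1, ∃ i : Fin p, cell N p i = (a, b)) (hN : 2 ≤ N) (ℓ : Fin p)
    (hℓ : (cell N p ℓ).1 ≠ a) :
    rowSymT N (colAltT N Z) + ∑ l with (cell N p l).1 = a,
      permT (swap l ℓ) (rowSymT N (colAltT N Z)) = 0 := by
  refine field_ext fun x => ?_
  rw [map_add, map_sum, map_zero]
  simp only [mapT_permT, mapT_rowSymT, mapT_colAltT]
  exact garnir_real _ a ha hN ℓ hℓ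

end

/-! ### Words in the generators and the multi-form of a tensor field -/

section


open Equiv

variable {D p : ℕ}

/-- The product of the generators `θ_z`, for `z` in a list of indices. -/
def word (z : Fin p → ℕ × Fin D) : Ext D := ExteriorAlgebra.ιMulti ℝ p fun l => oddVec (z l)

theorem word_perm (z : Fin p → ℕ × Fin D) (σ : Perm (Fin p)) :
    word (z ∘ σ) = ((Perm.sign σ : ℤ) : ℝ) • word z := by
  refine ((ExteriorAlgebra.ιMulti ℝ p).map_perm (fun l => oddVec (z l)) σ).trans ?_
  rcases Int.units_eq_one_or (Perm.sign σ) with h | h <;> rw [h]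
  · simp; rfl
  · simp; rfl

theorem word_succ (z : Fin (p + 1) → ℕ × Fin D) :
    word z = create (z 0).1 (z 0).2 (word (z ∘ Fin.succ)) :=
  ExteriorAlgebra.ιMulti_succ_apply _

theorem annih_word_succAbove (j : ℕ) (ν : Fin D) : ∀ {p : ℕ} (z : Fin (p + 1) → ℕ × Fin D),
    annih j ν (word z) =
      ∑ l, (if z l = (j, ν) then (-1 : ℝ) ^ (l : ℕ) else 0) • word (z ∘ l.succAbove)
  | 0, z => by
    rw [word_succ, annih_create, Fin.sum_univ_succ]
    have h : annih j ν (word (z ∘ Fin.succ)) = 0 :=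
      CliffordAlgebra.contractLeft_one (Q := (0 : QuadraticForm ℝ (ℕ × Fin D →₀ ℝ)))
        (Finsupp.lapply (j, ν))
    rw [h]
    simp only [Prod.ext_iff, eq_comm (a := j), eq_comm (a := ν)]
    simp [Function.comp_def]
  | p + 1, z => by
    rw [word_succ, annih_create, Fin.sum_univ_succ, annih_word_succAbove j ν (z ∘ Fin.succ),
      sub_eq_add_neg, map_sum, ← Finset.sum_neg_distrib]
    refine congrArg₂ (· + ·) ?_ (Finset.sum_congr rfl fun l _ => ?_)
    · simp only [Prod.ext_iff, eq_comm (a := j), eq_comm (a := ν)]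
      simp [Function.comp_def]
    · rw [word_succ (z ∘ Fin.succAbove l.succ), map_smul, ← neg_smul]
      have h1 : (z ∘ Fin.succAbove l.succ) ∘ Fin.succ = (z ∘ Fin.succ) ∘ Fin.succAbove l := by
        funext i; simp [Function.comp_def]
      have h2 : (z ∘ Fin.succAbove l.succ) 0 = z 0 := by simp
      rw [h1, h2]
      congr 1
      simp only [Function.comp_apply, Fin.val_succ, pow_succ]
      split_ifs <;> simp

/-- Deleting a letter is replaced by exchanging it with the first one. The cyclic rearrangement of
the others absorbs the alternating sign, leaving `-1` for every letter but the first. -/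
theorem annih_word (j : ℕ) (ν : Fin D) (z : Fin (p + 1) → ℕ × Fin D) :
    annih j ν (word z) = (if z 0 = (j, ν) then (1 : ℝ) else 0) • word (z ∘ Fin.succ) -
      ∑ l : Fin p, (if z l.succ = (j, ν) then (1 : ℝ) else 0) •
        word (z ∘ swap 0 l.succ ∘ Fin.succ) := by
  rw [annih_word_succAbove, Fin.sum_univ_succ, sub_eq_add_neg, ← Finset.sum_neg_distrib]
  refine congrArg₂ (· + ·) ?_ (Finset.sum_congr rfl fun l _ => ?_)
  · simp [Function.comp_def]
  · have h : z ∘ swap 0 l.succ ∘ Fin.succ = (z ∘ l.succ.succAbove) ∘ Fin.cycleRange l := by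
      funext i
      simp only [Function.comp_apply, Fin.succAbove_cycleRange]
    rw [h, word_perm, Fin.sign_cycleRange, ← neg_smul, smul_smul]
    congr 1
    split_ifs
    · push_cast
      rw [Fin.val_succ, pow_succ]; ring
    · simp

/-- Replacing an index in column `j` by one in column `i`, in all possible ways. -/
theorem sum_create_annih_word (i j : ℕ) : ∀ {p : ℕ} (κ : Fin p → ℕ) (μ : Fin p → Fin D),
    ∑ ν, create i ν (annih j ν (word fun l => (κ l, μ l))) =
      ∑ l, (if κ l = j then (1 : ℝ) else 0) •
        word fun k => (Function.update κ l i k, μ k)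
  | 0, κ, μ => by
    have h : ∀ ν : Fin D, annih j ν (word fun l => (κ l, μ l)) = 0 := fun ν =>
      CliffordAlgebra.contractLeft_one (Q := (0 : QuadraticForm ℝ (ℕ × Fin D →₀ ℝ)))
        (Finsupp.lapply (j, ν))
    simp [h]
  | p + 1, κ, μ => by
    have hs := word_succ fun l => (κ l, μ l)
    have ih := sum_create_annih_word i j (κ ∘ Fin.succ) (μ ∘ Fin.succ)
    have h : ∀ ν : Fin D, create i ν (annih j ν (word fun l => (κ l, μ l))) =
        create (κ 0) (μ 0) (create i ν (annih j ν (word fun l => (κ (Fin.succ l), μ (Fin.succ l)))))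
        + (if j = κ 0 ∧ ν = μ 0 then (1 : ℝ) else 0) •
          create i ν (word fun l => (κ (Fin.succ l), μ (Fin.succ l))) := by
      intro ν
      rw [hs]
      exact LinearMap.congr_fun (create_mul_annih_mul_create i j (κ 0) ν (μ 0)) _
    rw [Finset.sum_congr rfl fun ν _ => h ν, Finset.sum_add_distrib, ← map_sum, Fin.sum_univ_succ,
      add_comm]
    refine congrArg₂ (· + ·) ?_ ?_
    · rw [Finset.sum_eq_single (μ 0)]
      · rw [word_succ]
        simp [Function.comp_def, eq_comm]
      · intro ν _ hν; simp [hν]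
      · simp
    · refine (congrArg (create (κ 0) (μ 0)) ih).trans ?_
      rw [map_sum]
      refine Finset.sum_congr rfl fun l _ => ?_
      rw [map_smul, word_succ (fun k => (Function.update κ l.succ i k, μ k))]
      have h1 : (fun k => (Function.update κ l.succ i k, μ k)) ∘ Fin.succ =
          fun k => (Function.update (κ ∘ Fin.succ) l i k, (μ ∘ Fin.succ) k) := by
        funext k
        simp [Function.update_apply]
      rw [h1]
      simp [Function.update_apply, (Fin.succ_ne_zero l).symm]

/-- The multi-form of a tensor field, the `l`-th index being put into column `κ l`. -/
def toForm (κ : Fin p → ℕ) : Field D p →ₗ[ℝ] Multiform D :=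
  ∑ μ : Fin p → Fin D, pureForm (word fun l => (κ l, μ l)) ∘ₗ LinearMap.proj μ

theorem toForm_apply (κ : Fin p → ℕ) (X : Field D p) :
    toForm κ X = ∑ μ : Fin p → Fin D, pureForm (word fun l => (κ l, μ l)) (X μ) := by
  simp [toForm, LinearMap.sum_apply]

theorem toForm_permT (κ : Fin p → ℕ) (σ : Perm (Fin p)) (X : Field D p) :
    toForm κ (permT σ X) = ((Perm.sign σ : ℤ) : ℝ) • toForm (κ ∘ σ) X := by
  rw [toForm_apply, toForm_apply, Finset.smul_sum]
  refine Fintype.sum_equiv (σ.symm.arrowCongr (Equiv.refl (Fin D))) _ _ fun μ => ?_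
  have h1 : (σ.symm.arrowCongr (Equiv.refl (Fin D))) μ = μ ∘ σ := by
    funext i; simp [Equiv.arrowCongr]
  rw [h1, permT_apply]
  have h2 := word_perm (fun l => (κ l, μ l)) σ
  have h3 : word (fun l => ((κ ∘ σ) l, (μ ∘ σ) l)) = ((Perm.sign σ : ℤ) : ℝ) •
    word (fun l => (κ l, μ l)) := h2
  rw [h3, map_smul, LinearMap.smul_apply, smul_smul, sign_mul_self, one_smul]

theorem move_toForm (i j : ℕ) (κ : Fin p → ℕ) (X : Field D p) :
    move D i j (toForm κ X) = ∑ l with κ l = j, toForm (Function.update κ l i) X := by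
  have h : ∀ μ, move D i j (pureForm (word fun l => (κ l, μ l)) (X μ)) =
      ∑ l, (if κ l = j then (1 : ℝ) else 0) •
        pureForm (word fun k => (Function.update κ l i k, μ k)) (X μ) := by
    intro μ
    rw [move, LinearMap.sum_apply]
    simp only [tensorEnd_pureForm, Module.End.mul_apply, Module.End.one_apply]
    rw [← LinearMap.sum_apply, ← map_sum, sum_create_annih_word, map_sum, LinearMap.sum_apply]
    simp only [map_smul, LinearMap.smul_apply]
  rw [toForm_apply, map_sum, Finset.sum_congr rfl fun μ _ => h μ, Finset.sum_comm,
    Finset.sum_filter]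
  refine Finset.sum_congr rfl fun l _ => ?_
  rw [← Finset.smul_sum, ← toForm_apply]
  split_ifs <;> simp

/-- The gradient of a tensor field. -/
def gradT : Field D p →ₗ[ℝ] Field D (p + 1) :=
  LinearMap.pi fun μ => partialD (μ 0) ∘ₗ LinearMap.proj (Fin.tail μ)

theorem gradT_apply (X : Field D p) (μ : Fin (p + 1) → Fin D) :
    gradT X μ = partialD (μ 0) (X (Fin.tail μ)) := rfl

theorem sum_fin_succ_arrow {V : Type*} [AddCommMonoid V] (f : (Fin (p + 1) → Fin D) → V) :
    ∑ μ, f μ = ∑ ν, ∑ μ : Fin p → Fin D, f (Fin.cons ν μ) := by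
  rw [← Fintype.sum_prod_type']
  exact (Fintype.sum_equiv (Fin.consEquiv fun _ : Fin (p + 1) => Fin D) _ _ fun _ => rfl).symm

theorem toForm_gradT (j : ℕ) (κ : Fin p → ℕ) (X : Field D p) :
    toForm (Fin.cons j κ) (gradT X) = extD D j (toForm κ X) := by
  rw [toForm_apply, toForm_apply, sum_fin_succ_arrow, extD, LinearMap.sum_apply]
  refine Finset.sum_congr rfl fun ν _ => ?_
  rw [map_sum]
  refine Finset.sum_congr rfl fun μ _ => ?_
  rw [tensorEnd_pureForm, word_succ]
  rfl

/-- Contraction of the first index of a tensor field with the operators `φ ν`. -/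
def slotT (φ : Fin D → Module.End ℝ (Smooth D)) : Field D (p + 1) →ₗ[ℝ] Field D p :=
  LinearMap.pi fun μ => ∑ ν, φ ν ∘ₗ LinearMap.proj (Fin.cons ν μ : Fin (p + 1) → Fin D)

theorem slotT_apply (φ : Fin D → Module.End ℝ (Smooth D)) (X : Field D (p + 1))
    (μ : Fin p → Fin D) : slotT φ X μ = ∑ ν, φ ν (X (Fin.cons ν μ)) := by
  simp [slotT, LinearMap.sum_apply]

/-- The operators `φ ν` stay arbitrary for two uses: coordinates give `contr`, and the selection of
a single `ν` recovers tensor components from the form. -/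
theorem sum_annih_toForm (φ : Fin D → Module.End ℝ (Smooth D)) (j : ℕ) (κ : Fin (p + 1) → ℕ)
    (X : Field D (p + 1)) : (∑ ν, tensorEnd (annih j ν) (φ ν)) (toForm κ X) =
      (if κ 0 = j then toForm (κ ∘ Fin.succ) (slotT φ X) else 0) -
      ∑ l : Fin p with κ l.succ = j, toForm (κ ∘ swap 0 l.succ ∘ Fin.succ)
        (slotT φ (permT (swap 0 l.succ) X)) := by
  have hfirst : ∀ (κ' : Fin p → ℕ) (Y : Field D (p + 1)),
      ∑ ν, ∑ μ : Fin (p + 1) → Fin D, (if μ 0 = ν then (1 : ℝ) else 0) •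
        pureForm (word fun k => (κ' k, μ k.succ)) (φ ν (Y μ)) = toForm κ' (slotT φ Y) := by
    intro κ' Y
    rw [toForm_apply, Finset.sum_comm, sum_fin_succ_arrow, Finset.sum_comm]
    refine Finset.sum_congr rfl fun μ _ => ?_
    rw [slotT_apply, map_sum]
    refine Finset.sum_congr rfl fun ν _ => ?_
    simp
  have hμ : ∀ ν μ, tensorEnd (annih j ν) (φ ν) (pureForm (word fun l => (κ l, μ l)) (X μ)) =
      (if κ 0 = j then (1 : ℝ) else 0) • (if μ 0 = ν then (1 : ℝ) else 0) •
        pureForm (word fun k : Fin p => (κ k.succ, μ k.succ)) (φ ν (X μ)) -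
      ∑ l : Fin p, (if κ l.succ = j then (1 : ℝ) else 0) • (if μ l.succ = ν then (1 : ℝ) else 0) •
        pureForm (word fun k : Fin p => (κ (swap 0 l.succ k.succ), μ (swap 0 l.succ k.succ)))
          (φ ν (X μ)) := by
    intro ν μ
    rw [tensorEnd_pureForm, annih_word, map_sub, LinearMap.sub_apply, map_sum, LinearMap.sum_apply]
    have hite : ∀ (a : ℕ) (b : Fin D), (if (a, b) = (j, ν) then (1 : ℝ) else 0) =
        (if a = j then (1 : ℝ) else 0) * (if b = ν then (1 : ℝ) else 0) := by
      intro a b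
      by_cases ha : a = j <;> simp [ha]
    simp only [map_smul, LinearMap.smul_apply, hite, mul_smul]
    rfl
  rw [LinearMap.sum_apply]
  simp only [toForm_apply κ X, map_sum, hμ, Finset.sum_sub_distrib]
  refine congrArg₂ (· - ·) ?_ ?_
  · simp only [← Finset.smul_sum]
    refine (congrArg _ (hfirst (κ ∘ Fin.succ) X)).trans ?_
    split_ifs <;> simp
  · rw [Finset.sum_filter]
    simp only [Finset.sum_comm (s := (Finset.univ : Finset (Fin (p + 1) → Fin D)))
      (t := (Finset.univ : Finset (Fin p)))]
    rw [Finset.sum_comm]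
    refine Finset.sum_congr rfl fun l _ => ?_
    simp only [← Finset.smul_sum]
    have h := hfirst (κ ∘ swap 0 l.succ ∘ Fin.succ) (permT (swap 0 l.succ) X)
    have h2 : ∑ ν, ∑ μ : Fin (p + 1) → Fin D, (if μ l.succ = ν then (1 : ℝ) else 0) •
        pureForm (word fun k : Fin p => (κ (swap 0 l.succ k.succ), μ (swap 0 l.succ k.succ)))
          (φ ν (X μ)) = toForm (κ ∘ swap 0 l.succ ∘ Fin.succ)
            (slotT φ (permT (swap 0 l.succ) X)) := by
      rw [← h]
      refine Finset.sum_congr rfl fun ν _ => ?_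
      refine Fintype.sum_equiv ((swap 0 l.succ).arrowCongr (Equiv.refl (Fin D))) _ _ fun μ => ?_
      have h1 : ((swap 0 l.succ).arrowCongr (Equiv.refl (Fin D))) μ = μ ∘ swap 0 l.succ := by
        funext i; simp [Equiv.arrowCongr]
      have h3 : (μ ∘ swap 0 l.succ) ∘ swap 0 l.succ = μ := by funext i; simp
      rw [h1, permT_apply, h3]
      simp
    rw [h2]
    split_ifs <;> simp

end

/-! ### Tensors as multi-forms by columns, and the form of the gradient -/

section


open Equiv

variable {D p : ℕ}

/-- The multi-form of a tensor field, each index being put into the column of its cell. -/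
def colForm (N : ℕ) {D p : ℕ} : Field D p →ₗ[ℝ] Multiform D := toForm fun i => (cell N p i).2

/-- Extension of a permutation by a fixed first index. -/
def liftPerm (σ : Perm (Fin p)) : Perm (Fin (p + 1)) := Perm.decomposeFin.symm (0, σ)

@[simp] theorem liftPerm_zero (σ : Perm (Fin p)) : liftPerm σ 0 = 0 := by simp [liftPerm]

@[simp] theorem liftPerm_succ (σ : Perm (Fin p)) (i : Fin p) :
    liftPerm σ i.succ = (σ i).succ := by simp [liftPerm]

theorem sign_liftPerm (σ : Perm (Fin p)) : Perm.sign (liftPerm σ) = Perm.sign σ := by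
  simp [liftPerm]

theorem liftPerm_mem_rowPerms {N : ℕ} {σ : Perm (Fin p)} :
    liftPerm σ ∈ rowPerms N (p + 1) ↔ σ ∈ rowPerms N p := by
  rw [mem_rowPerms, mem_rowPerms, Fin.forall_fin_succ]
  simp [cell_succ]

theorem liftPerm_mem_colPerms {N : ℕ} {σ : Perm (Fin p)} :
    liftPerm σ ∈ colPerms N (p + 1) ↔ σ ∈ colPerms N p := by
  rw [mem_colPerms, mem_colPerms, Fin.forall_fin_succ]
  simp [cell_succ]

theorem liftPerm_swap (i j : Fin p) : liftPerm (swap i j) = swap i.succ j.succ := by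
  ext k
  refine Fin.cases ?_ (fun k => ?_) k
  · rw [liftPerm_zero, swap_apply_of_ne_of_ne (Fin.succ_ne_zero i).symm (Fin.succ_ne_zero j).symm]
  · rw [liftPerm_succ, ← Function.Injective.swap_apply (Fin.succ_injective p)]

theorem decomposeFin_symm_eq (l : Fin (p + 1)) (σ : Perm (Fin p)) :
    Perm.decomposeFin.symm (l, σ) = swap 0 l * liftPerm σ := by
  ext k
  refine Fin.cases ?_ (fun k => ?_) k
  · simp
  · simp

theorem cons_comp_liftPerm (ν : Fin D) (μ : Fin p → Fin D) (σ : Perm (Fin p)) :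
    (Fin.cons ν μ : Fin (p + 1) → Fin D) ∘ liftPerm σ = Fin.cons ν (μ ∘ σ) := by
  funext i
  refine Fin.cases ?_ (fun i => ?_) i <;> simp

theorem slotT_permT (φ : Fin D → Module.End ℝ (Smooth D)) (σ : Perm (Fin p))
    (X : Field D (p + 1)) : slotT φ (permT (liftPerm σ) X) = permT σ (slotT φ X) := by
  funext μ
  simp only [slotT_apply, permT_apply, cons_comp_liftPerm]

theorem gradT_permT (σ : Perm (Fin p)) (X : Field D p) :
    gradT (permT σ X) = permT (liftPerm σ) (gradT X) := by
  funext μ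
  simp only [gradT_apply, permT_apply, Function.comp_apply, liftPerm_zero]
  congr 2

theorem colForm_permT {N : ℕ} {σ : Perm (Fin p)} (hσ : σ ∈ colPerms N p) (X : Field D p) :
    colForm N (permT σ X) = ((Perm.sign σ : ℤ) : ℝ) • colForm N X := by
  rw [colForm, toForm_permT]
  congr 2
  exact congrArg toForm (funext fun i => mem_colPerms.1 hσ i)

theorem colForm_colAltT (N : ℕ) (X : Field D p) : colForm N (colAltT N X) = colForm N X := by
  rw [colAltT_apply, map_smul, map_sum, Finset.sum_congr rfl (g := fun _ => colForm N X),
    Finset.sum_const, ← Nat.cast_smul_eq_nsmul ℝ, inv_smul_smul₀ (card_colPerms_ne_zero N p)]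
  intro σ hσ
  rw [map_smul, colForm_permT hσ, smul_smul, sign_mul_self, one_smul]

theorem pureForm_word_zero_injective {z : Fin 0 → ℕ × Fin D} {f : Smooth D}
    (h : pureForm (word z) f = 0) : f = 0 := by
  have h1 := congrArg ((TensorProduct.lid ℝ (Smooth D)).toLinearMap ∘ₗ
    LinearMap.rTensor (Smooth D) (ExteriorAlgebra.algebraMapInv
      (R := ℝ) (M := ℕ × Fin D →₀ ℝ)).toLinearMap) h
  have h2 : word z = (1 : ExteriorAlgebra ℝ (ℕ × Fin D →₀ ℝ)) :=
    ExteriorAlgebra.ιMulti_zero_apply _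
  have h3 : (ExteriorAlgebra.algebraMapInv (R := ℝ) (M := ℕ × Fin D →₀ ℝ)) (word z) • f = 0 :=
    h1.trans (map_zero _)
  have h4 : (ExteriorAlgebra.algebraMapInv (R := ℝ) (M := ℕ × Fin D →₀ ℝ)) (word z) = 1 :=
    (congrArg _ h2).trans (map_one _)
  rwa [h4, one_smul] at h3

/-- Contracting the column of the first cell, antisymmetry makes all cells of that column contribute
equally. The form of each slice is thus zero after division by a positive number, and the slices
have lower degree. -/
theorem eq_zero_of_colForm_eq_zero (N : ℕ) : ∀ {p : ℕ} (X : Field D p),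
    (∀ σ ∈ colPerms N p, permT σ X = ((Perm.sign σ : ℤ) : ℝ) • X) → colForm N X = 0 → X = 0
  | 0, X, _, h => by
    rw [colForm, toForm_apply, Fintype.sum_unique] at h
    funext μ
    rw [Subsingleton.elim μ default]
    exact pureForm_word_zero_injective h
  | p + 1, X, hX, h => by
    funext μ
    rw [← Fin.cons_self_tail μ]
    generalize Fin.tail μ = μ'
    generalize μ 0 = ν₀
    set φ : Fin D → Module.End ℝ (Smooth D) := fun ν => if ν = ν₀ then 1 else 0 with hφ
    have hslot : slotT φ X μ' = X (Fin.cons ν₀ μ') := by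
      rw [slotT_apply, Finset.sum_eq_single ν₀]
      · simp [hφ]
      · intro ν _ hν; simp [hφ, hν]
      · simp
    have h1 := sum_annih_toForm φ (cell N (p + 1) 0).2 (fun i => (cell N (p + 1) i).2) X
    rw [← colForm] at h1
    have h2 : ∀ l ∈ Finset.univ.filter fun l : Fin p =>
        (cell N (p + 1) l.succ).2 = (cell N (p + 1) 0).2,
        toForm ((fun i => (cell N (p + 1) i).2) ∘ swap 0 l.succ ∘ Fin.succ)
          (slotT φ (permT (swap 0 l.succ) X)) = - colForm N (slotT φ X) := by
      intro l hl
      rw [Finset.mem_filter] at hl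
      have hs := swap_mem_colPerms (N := N) hl.2.symm
      rw [hX _ hs, Perm.sign_swap (Fin.succ_ne_zero l).symm, map_smul, map_smul]
      simp only [Units.val_neg, Units.val_one, Int.cast_neg, Int.cast_one, neg_smul, one_smul]
      congr 2
      refine congrArg toForm (funext fun i => ?_)
      exact (mem_colPerms.1 hs i.succ).trans (by rw [cell_succ])
    rw [h, map_zero, if_pos rfl, Finset.sum_congr rfl h2, Finset.sum_const, smul_neg,
      sub_neg_eq_add, ← Nat.cast_smul_eq_nsmul ℝ] at h1
    have h3 : toForm ((fun i => (cell N (p + 1) i).2) ∘ Fin.succ) (slotT φ X) =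
        colForm N (slotT φ X) := by
      refine congrArg (fun κ => toForm κ (slotT φ X)) (funext fun i => ?_)
      exact congrArg Prod.snd (cell_succ N p i)
    rw [h3] at h1
    set a : ℝ := ((Finset.univ.filter fun l : Fin p =>
        (cell N (p + 1) l.succ).2 = (cell N (p + 1) 0).2).card : ℝ)
    have h4 : (1 + a) • colForm N (slotT φ X) = 0 := by rw [h1]; module
    have ha : (1 + a) ≠ 0 := by positivity
    have h5 := eq_zero_of_colForm_eq_zero N (slotT φ X) (fun σ hσ => by
      rw [← slotT_permT, hX _ (liftPerm_mem_colPerms.2 hσ), sign_liftPerm, map_smul])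
      ((smul_eq_zero.1 h4).resolve_left ha)
    rw [← hslot, h5]; rfl

theorem colForm_injOn (N : ℕ) {X Y : Field D p} (hX : colAltT N X = X) (hY : colAltT N Y = Y)
    (h : colForm N X = colForm N Y) : X = Y := by
  rw [← sub_eq_zero]
  refine eq_zero_of_colForm_eq_zero N _ (fun σ hσ => ?_) (by rw [map_sub, h, sub_self])
  rw [← hX, ← hY, ← map_sub, permT_colAltT hσ]

section lastRow

theorem cell_fst_eq_iff {N : ℕ} (hN : 2 ≤ N) (l : Fin (p + 1)) :
    (cell N (p + 1) l).1 = p / (N - 1) ↔ (l : ℕ) ≤ p % (N - 1) := by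
  have h1 := cell_eq N (p + 1) l
  have h2 := cell_snd_lt hN l
  have h3 := Nat.div_add_mod p (N - 1)
  have h4 := Nat.mod_lt p (show 0 < N - 1 by omega)
  have h5 : ((l.rev : Fin (p + 1)) : ℕ) = p - l := by rw [Fin.val_rev]; omega
  have h6 := l.isLt
  set q := N - 1
  set a := (cell N (p + 1) l).1
  set b := p / q
  constructor
  · intro h
    rw [h] at h1
    omega
  · intro h
    rcases lt_trichotomy a b with hab | hab | hab
    · have : q * (a + 1) ≤ q * b := Nat.mul_le_mul_left _ hab
      rw [Nat.mul_succ] at this; omega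
    · exact hab
    · have : q * (b + 1) ≤ q * a := Nat.mul_le_mul_left _ hab
      rw [Nat.mul_succ] at this; omega

theorem card_lastRow {N : ℕ} (hN : 2 ≤ N) : (Finset.univ.filter fun l : Fin (p + 1) =>
    (cell N (p + 1) l).1 = p / (N - 1)).card = p % (N - 1) + 1 := by
  simp only [cell_fst_eq_iff hN]
  have h : p % (N - 1) < p + 1 := Nat.lt_succ_of_le (Nat.mod_le _ _)
  have : (Finset.univ.filter fun l : Fin (p + 1) => (l : ℕ) ≤ p % (N - 1)) =
      Finset.Iic (⟨p % (N - 1), h⟩ : Fin (p + 1)) := by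
    ext l; simp [Fin.le_def]
  rw [this, Fin.card_Iic]

theorem cell_snd_lt_of_lastRow {N : ℕ} {l : Fin p} (h : (cell N p l).1 = p / (N - 1)) :
    (cell N p l).2 < p % (N - 1) := by
  have h1 := cell_eq N p l
  have h3 := Nat.div_add_mod p (N - 1)
  have h5 := l.rev.isLt
  rw [h] at h1
  omega

theorem cell_fst_le {N : ℕ} (l : Fin p) : (cell N p l).1 ≤ p / (N - 1) :=
  Nat.div_le_div_right l.rev.isLt.le

theorem exists_cell_of_fst_lt {N : ℕ} {a b : ℕ} (ha : a < p / (N - 1)) (hb : b < N - 1) :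
    ∃ i : Fin p, cell N p i = (a, b) := by
  refine exists_cell_eq hb ?_
  have h1 := Nat.mul_le_mul_left (N - 1) (Nat.succ_le_of_lt ha)
  rw [Nat.mul_succ] at h1
  have := Nat.div_add_mod p (N - 1)
  omega

theorem sum_rowPerms_succ {N : ℕ} {V : Type*} [AddCommMonoid V] (f : Perm (Fin (p + 1)) → V) :
    ∑ σ ∈ rowPerms N (p + 1), f σ =
      ∑ l with (cell N (p + 1) l).1 = p / (N - 1), ∑ σ ∈ rowPerms N p,
        f (swap 0 l * liftPerm σ) := by
  rw [← Finset.sum_product']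
  have h0 : (cell N (p + 1) 0).1 = p / (N - 1) := by rw [cell_zero]
  refine Finset.sum_equiv Perm.decomposeFin (fun σ => ?_) (fun σ _ => ?_)
  · obtain ⟨⟨l, τ⟩, rfl⟩ := Perm.decomposeFin.symm.surjective σ
    rw [Equiv.apply_symm_apply, Finset.mem_product, Finset.mem_filter, decomposeFin_symm_eq]
    constructor
    · intro h
      have h1 := mem_rowPerms.1 h 0
      rw [Perm.mul_apply, liftPerm_zero, swap_apply_left, h0] at h1
      refine ⟨⟨Finset.mem_univ _, h1⟩, liftPerm_mem_rowPerms.1 ?_⟩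
      have h2 := rowPerms_mul (swap_mem_rowPerms (N := N) (i := 0) (j := l) (by rw [h1, h0])) h
      rwa [← mul_assoc, swap_mul_self, one_mul] at h2
    · rintro ⟨⟨-, h1⟩, h2⟩
      exact rowPerms_mul (swap_mem_rowPerms (by rw [h0, h1])) (liftPerm_mem_rowPerms.2 h2)
  · rw [← decomposeFin_symm_eq, Prod.mk.eta, Equiv.symm_apply_apply]

/-- Row symmetrization in degree `p + 1` of a tensor that is symmetric in the rows of the diagram
with `p` cells. -/
theorem rowSymT_succ {N : ℕ} (hN : 2 ≤ N) {M : Type} [AddCommGroup M] [Module ℝ M]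
    {X : (Fin (p + 1) → Fin D) → M} (hX : ∀ σ ∈ rowPerms N p, permT (liftPerm σ) X = X) :
    rowSymT N X = ((p % (N - 1) : ℕ) + 1 : ℝ)⁻¹ •
      ∑ l with (cell N (p + 1) l).1 = p / (N - 1), permT (swap 0 l) X := by
  have hcard : ((rowPerms N (p + 1)).card : ℝ) =
      ((p % (N - 1) : ℕ) + 1 : ℝ) * ((rowPerms N p).card : ℝ) := by
    have h := sum_rowPerms_succ (N := N) (p := p) (fun _ => (1 : ℝ))
    rw [Finset.sum_const, Finset.sum_const, Finset.sum_const, card_lastRow hN] at h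
    simpa using h
  rw [rowSymT_apply, hcard, sum_rowPerms_succ, mul_inv, mul_smul]
  congr 1
  rw [Finset.smul_sum]
  refine Finset.sum_congr rfl fun l _ => ?_
  rw [Finset.sum_congr rfl (g := fun _ => permT (swap 0 l) X), Finset.sum_const,
    ← Nat.cast_smul_eq_nsmul ℝ, inv_smul_smul₀ (card_rowPerms_ne_zero N p)]
  intro σ hσ
  rw [← permT_permT, hX σ hσ]

end lastRow

/-- A tensor that is symmetric in the rows. -/
def IsRowSym (N : ℕ) (X : Field D p) : Prop := ∀ σ ∈ rowPerms N p, permT σ X = X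

theorem isRowSym_rowSymT (N : ℕ) (X : Field D p) : IsRowSym N (rowSymT N X) :=
  fun _ hσ => permT_rowSymT hσ X

/-- Two indices of one row end up in one column: the tensor is symmetric in them, the generators are
antisymmetric. -/
theorem toForm_update_eq_zero {N : ℕ} {X : Field D p} (hX : IsRowSym N X) {l k : Fin p}
    (hlk : l ≠ k) (hrow : (cell N p l).1 = (cell N p k).1) :
    toForm (Function.update (fun i => (cell N p i).2) l (cell N p k).2) X = 0 := by
  apply eq_zero_of_eq_neg
  set κ := Function.update (fun i => (cell N p i).2) l (cell N p k).2 with hκ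
  have h1 : κ ∘ swap l k = κ := by
    funext i
    rw [Function.comp_apply, swap_apply_def]
    split_ifs with h2 h3
    · rw [h2, hκ, Function.update_of_ne hlk.symm, Function.update_self]
    · rw [h3, hκ, Function.update_self, Function.update_of_ne hlk.symm]
    · rfl
  conv_lhs => rw [← hX _ (swap_mem_rowPerms hrow), toForm_permT, h1, Perm.sign_swap hlk]
  simp

theorem colForm_gradT_swap {N : ℕ} (X : Field D p) (l : Fin p) :
    colForm N (permT (swap 0 l.succ) (gradT X)) =
      - extD D (cell N p l).2
        (toForm (Function.update (fun i => (cell N p i).2) l (p % (N - 1))) X) := by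
  rw [colForm, toForm_permT, Perm.sign_swap (Fin.succ_ne_zero l).symm, ← toForm_gradT]
  simp only [Units.val_neg, Units.val_one, Int.cast_neg, Int.cast_one, neg_smul, one_smul]
  congr 2
  refine congrArg toForm (funext fun i => ?_)
  rw [Function.comp_apply]
  refine Fin.cases ?_ (fun i => ?_) i
  · rw [swap_apply_left, Fin.cons_zero, cell_succ]
  · rw [Fin.cons_succ]
    rcases eq_or_ne i l with rfl | hne
    · rw [swap_apply_right, Function.update_self, cell_zero]
    · rw [swap_apply_of_ne_of_ne (Fin.succ_ne_zero i) (fun h => hne (Fin.succ_injective _ h)),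
        Function.update_of_ne hne, cell_succ]

/-- The multi-form of the row symmetrized gradient. -/
theorem colForm_rowSymT_gradT {N : ℕ} (hN : 2 ≤ N) {X : Field D p} (hX : IsRowSym N X) :
    colForm N (rowSymT N (gradT X)) =
      ((p % (N - 1) : ℕ) + 1 : ℝ)⁻¹ • rowD D (p % (N - 1)) (colForm N X) := by
  have hc : p % (N - 1) < N - 1 := Nat.mod_lt _ (by omega)
  rw [rowSymT_succ hN fun σ hσ => by rw [← gradT_permT, hX σ hσ], map_smul]
  congr 1
  rw [map_sum, Finset.sum_filter, Fin.sum_univ_succ, rowD, LinearMap.sub_apply,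
    LinearMap.sum_apply, sub_eq_add_neg, if_pos (by rw [cell_zero])]
  refine congrArg₂ (· + ·) ?_ ?_
  · rw [swap_self]
    change colForm N (gradT X) = _
    rw [colForm, colForm, ← toForm_gradT]
    refine congrArg (fun κ => toForm κ (gradT X)) (funext fun i => ?_)
    refine Fin.cases ?_ (fun i => ?_) i
    · rw [cell_zero]; rfl
    · rw [cell_succ]; rfl
  · simp only [Module.End.mul_apply]
    -- Only indices of the last row survive a move into the new column. A higher row already has a
    -- cell there, so `toForm_update_eq_zero` applies.
    have hmove : ∀ j ∈ Finset.range (p % (N - 1)), extD D j (move D (p % (N - 1)) j (colForm N X)) =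
        ∑ l : Fin p, if (cell N p l).2 = j then (if (cell N p l).1 = p / (N - 1) then
          extD D j (toForm (Function.update (fun i => (cell N p i).2) l (p % (N - 1))) X) else 0)
          else 0 := by
      intro j hj
      rw [Finset.mem_range] at hj
      rw [colForm, move_toForm, map_sum, Finset.sum_filter]
      refine Finset.sum_congr rfl fun l _ => ?_
      split_ifs with h1 h2
      · rfl
      · obtain ⟨k, hk⟩ := exists_cell_of_fst_lt (N := N)
          (lt_of_le_of_ne (cell_fst_le l) h2) hc
        have h3 := toForm_update_eq_zero hX (l := l) (k := k)
          (fun h => by rw [h, hk] at h1; exact hj.ne h1.symm) (by rw [hk])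
        rw [hk] at h3
        rw [h3, map_zero]
      · rfl
    rw [Finset.sum_congr rfl hmove, Finset.sum_comm, ← Finset.sum_neg_distrib]
    refine Finset.sum_congr rfl fun l _ => ?_
    rw [cell_succ, colForm_gradT_swap, Finset.sum_ite_eq]
    split_ifs with h1 h2 h2
    · rfl
    · exact absurd (Finset.mem_range.2 (cell_snd_lt_of_lastRow h1)) h2
    · rw [neg_zero]
    · rw [neg_zero]

theorem card_column {N n : ℕ} {j : ℕ} (hj : j < N - 1) :
    (Finset.univ.filter fun l : Fin ((N - 1) * n) => (cell N _ l).2 = j).card = n := by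
  have hq : 0 < N - 1 := by omega
  conv_rhs => rw [← Finset.card_range n]
  refine Finset.card_bij (fun l _ => (cell N _ l).1) ?_ ?_ ?_
  · intro l _
    rw [Finset.mem_range]
    have h1 := cell_eq N _ l
    have h2 := l.rev.isLt
    by_contra hcon
    have := Nat.mul_le_mul_left (N - 1) (not_lt.1 hcon)
    omega
  · intro l hl k hk h
    rw [Finset.mem_filter] at hl hk
    exact cell_injective N _ (Prod.ext h (hl.2.trans hk.2.symm))
  · intro a ha
    rw [Finset.mem_range] at ha
    obtain ⟨i, hi⟩ := exists_cell_of_fst_lt (N := N) (p := (N - 1) * n) (a := a) (b := j)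
      (by rwa [Nat.mul_div_cancel_left _ hq]) hj
    exact ⟨i, by simp [hi], by rw [hi]⟩

/-- In a rectangle every row meets every column, so a move between different columns duplicates a
column within a row and gives zero. A move within a column counts its `n` cells. -/
theorem isBalanced_colForm {N n : ℕ} {X : Field D ((N - 1) * n)}
    (hX : IsRowSym N X) : IsBalanced (N - 1) n (colForm N X) := by
  intro i hi j hj
  rw [colForm, move_toForm]
  split_ifs with hij
  · subst hij
    rw [Finset.sum_congr rfl (g := fun _ => colForm N X), Finset.sum_const, card_column hj,
      ← Nat.cast_smul_eq_nsmul ℝ]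
    · rfl
    · intro l hl
      rw [Finset.mem_filter] at hl
      rw [colForm, Function.update_eq_self_iff.2 hl.2.symm]
  · refine Finset.sum_eq_zero fun l hl => ?_
    rw [Finset.mem_filter] at hl
    have hlt : (cell N _ l).1 < (N - 1) * n / (N - 1) := by
      refine lt_of_le_of_ne (cell_fst_le l) fun h => ?_
      have := cell_snd_lt_of_lastRow h
      rw [Nat.mul_mod_right] at this
      omega
    obtain ⟨k, hk⟩ := exists_cell_of_fst_lt hlt hi
    have h3 := toForm_update_eq_zero hX (l := l) (k := k)
      (fun h => by rw [h, hk] at hl; exact hij hl.2) (by rw [hk])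
    rwa [hk] at h3

end

/-! ### Radial contraction of rectangular tensors -/

section


open Equiv

variable {D p : ℕ}

theorem slotT_slotT_swap (X : Field D (p + 2)) :
    slotT coordMul (slotT coordMul (permT (swap 0 1) X)) =
      slotT coordMul (slotT coordMul X) := by
  funext μ
  simp only [slotT_apply, permT_apply, map_sum]
  rw [Finset.sum_comm]
  refine Finset.sum_congr rfl fun α _ => Finset.sum_congr rfl fun β _ => ?_
  have h : (Fin.cons α (Fin.cons β μ : Fin (p + 1) → Fin D) : Fin (p + 2) → Fin D) ∘ swap 0 1 =
      (Fin.cons β (Fin.cons α μ : Fin (p + 1) → Fin D) : Fin (p + 2) → Fin D) := by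
    funext i
    refine Fin.cases ?_ (fun i => Fin.cases ?_ (fun i => ?_) i) i
    · simp
    · rw [Function.comp_apply, Fin.succ_zero_eq_one, swap_apply_right]; rfl
    · rw [Function.comp_apply, swap_apply_of_ne_of_ne (Fin.succ_ne_zero _) (by
        rw [← Fin.succ_zero_eq_one]
        exact fun h => Fin.succ_ne_zero _ (Fin.succ_injective _ h))]
      rfl
  rw [coordMul_comm, h]

theorem isRowSym_slotT {N : ℕ} {X : Field D (p + 1)} (hX : IsRowSym N X)
    (φ : Fin D → Module.End ℝ (Smooth D)) : IsRowSym N (slotT φ X) := fun σ hσ => by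
  rw [← slotT_permT, hX _ (liftPerm_mem_rowPerms.2 hσ)]

/-- Exchanging two cells that are neither in the same row nor in the same column kills the
multi-form of a row symmetric tensor, if one of the two other corners of the rectangle belongs to
the diagram. -/
theorem colForm_permT_swap_eq_zero {N : ℕ} {W : Field D p} (hW : IsRowSym N W) {l' l x : Fin p}
    (hrow : (cell N p x).1 = (cell N p l).1) (hcol : (cell N p x).2 = (cell N p l').2)
    (hl : (cell N p l).2 ≠ (cell N p l').2) (hl' : (cell N p l).1 ≠ (cell N p l').1) :
    colForm N (permT (swap l' l) W) = 0 := by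
  have hxl : x ≠ l := fun h => hl (by rw [← h, hcol])
  have hxl' : x ≠ l' := fun h => hl' (by rw [← hrow, h])
  have hll' : l ≠ l' := fun h => hl (by rw [h])
  apply eq_zero_of_eq_neg
  have hs := swap_mem_rowPerms (N := N) hrow
  have ht := swap_mem_colPerms (N := N) hcol
  have h1 : swap l' l * swap x l = swap x l' * swap l' l := by
    have := mul_swap_eq_swap_mul (swap l' l) x l
    rwa [swap_apply_of_ne_of_ne hxl' hxl, swap_apply_right] at this
  conv_lhs => rw [← hW _ hs, permT_permT, h1, ← permT_permT, colForm_permT ht,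
    Perm.sign_swap hxl']
  simp

/-- The identity satisfied by the iterated contractions, with the radial vector field, of a tensor
of rectangular symmetry type. -/
def IsGarnir (N a k : ℕ) (X : Field D (p + 1)) : Prop :=
  ∀ ℓ, (cell N (p + 1) ℓ).1 ≠ a → ∃ Y : Field D (p + 1),
    X + ∑ l with (cell N (p + 1) l).1 = a, permT (swap l ℓ) X + (k : ℝ) • Y = 0 ∧
      slotT coordMul Y = slotT coordMul (permT (swap 0 ℓ) X)

/-- When the first index is contracted, the term exchanging it with `ℓ` leaves the sum over the row
and joins the `k` copies already collected. -/
theorem slotT_garnir {N a k : ℕ} (ha : p / (N - 1) = a) {X : Field D (p + 1)}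
    (hX : IsGarnir N a k X) {ℓ : Fin p} (hℓ : (cell N p ℓ).1 ≠ a) :
    slotT coordMul X + ∑ l with (cell N p l).1 = a, permT (swap l ℓ) (slotT coordMul X) +
      ((k + 1 : ℕ) : ℝ) • slotT coordMul (permT (swap 0 ℓ.succ) X) = 0 := by
  obtain ⟨Y, hY, hY'⟩ := hX ℓ.succ (by rwa [cell_succ])
  have h := congrArg (slotT coordMul) hY
  rw [map_add, map_add, map_sum, map_smul, hY', Finset.sum_filter, Fin.sum_univ_succ, map_zero,
    if_pos (by rw [cell_zero, ha])] at h
  simp only [cell_succ, ← liftPerm_swap, slotT_permT] at h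
  rw [Finset.sum_filter]
  refine Eq.trans ?_ h
  push_cast
  module

/-- The new collected term has the required contraction because the first two indices lie in one row
and coordinates commute, so the two contracted slots may be exchanged. -/
theorem IsGarnir.slotT {N a k : ℕ} (ha : (p + 1) / (N - 1) = a) (ha' : p / (N - 1) = a)
    {X : Field D (p + 2)} (hrow : IsRowSym N X) (hX : IsGarnir N a k X) :
    IsGarnir N a (k + 1) (slotT coordMul X) := by
  intro ℓ hℓ
  refine ⟨_, slotT_garnir ha hX hℓ, ?_⟩
  have hmem : swap 0 1 ∈ rowPerms N (p + 2) := swap_mem_rowPerms (by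
    rw [← Fin.succ_zero_eq_one, cell_succ, cell_zero, cell_zero, ha, ha'])
  have h0 : ℓ ≠ 0 := by
    rintro rfl
    rw [cell_zero] at hℓ
    exact hℓ ha'
  have h1 : swap 0 1 * swap 1 ℓ.succ * swap 0 1 = swap (0 : Fin (p + 2)) ℓ.succ := by
    have hne : (ℓ.succ : Fin (p + 2)) ≠ 1 := by
      rw [← Fin.succ_zero_eq_one]
      exact fun h => h0 (Fin.succ_injective _ h)
    rw [swap_comm 0 1, swap_comm 1 ℓ.succ]
    exact swap_mul_swap_mul_swap hne (Fin.succ_ne_zero ℓ)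
  rw [← slotT_permT, liftPerm_swap, Fin.succ_zero_eq_one, ← h1, ← permT_permT, ← permT_permT,
    hrow _ hmem, slotT_slotT_swap]

/-- Removing `k + 1` cells from the end of the rectangle makes column `m - 1 - k` of row `n - 1` the
next cell to fill. -/
theorem mod_div_of_add_eq {m n k : ℕ} (hk : k < m) (hp : p + 1 + k = m * n) :
    p % m = m - 1 - k ∧ p / m = n - 1 := by
  obtain ⟨n, rfl⟩ : ∃ n', n = n' + 1 := ⟨n - 1, by
    have : n ≠ 0 := by rintro rfl; simp at hp
    omega⟩
  have h : p = (m - 1 - k) + m * n := by rw [Nat.mul_succ] at hp; omega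
  have hlt : m - 1 - k < m := by omega
  rw [h, Nat.add_mul_mod_self_left, Nat.mod_eq_of_lt hlt,
    Nat.add_mul_div_left _ _ (by omega), Nat.div_eq_of_lt hlt]
  simp

/-- The first index contributes the contracted tensor itself. By Garnir each of the `n - 1` other
cells of the column contributes `1 / (k + 1)` of the same form, so the factor is positive. -/
theorem contr_colForm {N n k : ℕ} (hk : k < N - 1) (hp : p + 1 + k = (N - 1) * n)
    {X : Field D (p + 1)} (hrow : IsRowSym N X) (hX : IsGarnir N (n - 1) k X) :
    contr D (N - 1 - 1 - k) (colForm N X) =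
      (1 + ((n - 1 : ℕ) : ℝ) / (k + 1)) • colForm N (slotT coordMul X) := by
  obtain ⟨hmod, hdiv⟩ := mod_div_of_add_eq hk hp
  set X' := slotT coordMul X with hX'
  have hrow' : IsRowSym N X' := isRowSym_slotT hrow _
  have hfst : ∀ l : Fin p, (cell N p l).2 = N - 1 - 1 - k → (cell N p l).1 ≠ n - 1 := by
    intro l hl h
    have := cell_snd_lt_of_lastRow (h.trans hdiv.symm)
    omega
  have hterm : ∀ l ∈ Finset.univ.filter fun l : Fin p =>
      (cell N (p + 1) l.succ).2 = N - 1 - 1 - k,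
      toForm ((fun i => (cell N (p + 1) i).2) ∘ swap 0 l.succ ∘ Fin.succ)
        (slotT coordMul (permT (swap 0 l.succ) X)) = -(((k : ℝ) + 1)⁻¹ • colForm N X') := by
    intro l hl
    rw [Finset.mem_filter, cell_succ] at hl
    have hl1 := hfst l hl.2
    have hκ : (fun i => (cell N (p + 1) i).2) ∘ swap 0 l.succ ∘ Fin.succ =
        fun i => (cell N p i).2 := by
      funext i
      have hs := swap_mem_colPerms (N := N) (i := 0) (j := l.succ) (by
        rw [cell_zero, cell_succ, hl.2, hmod])
      exact (mem_colPerms.1 hs i.succ).trans (by rw [cell_succ])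
    have h := congrArg (colForm N) (slotT_garnir hdiv hX hl1)
    -- The row of `l` is full and hence has a cell in the column of `l'`; this is the corner that
    -- `colForm_permT_swap_eq_zero` needs.
    have hzero : ∑ l' with (cell N p l').1 = n - 1, colForm N (permT (swap l' l) X') = 0 := by
      refine Finset.sum_eq_zero fun l' hl' => ?_
      rw [Finset.mem_filter] at hl'
      have h1 := cell_snd_lt_of_lastRow (hl'.2.trans hdiv.symm)
      obtain ⟨x, hx⟩ := exists_cell_of_fst_lt (N := N) (b := (cell N p l').2)
        (lt_of_le_of_ne (cell_fst_le l) (by rwa [hdiv])) (by omega)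
      exact colForm_permT_swap_eq_zero hrow' (x := x) (by rw [hx]) (by rw [hx]) (by omega)
        (by rwa [hl'.2])
    rw [map_add, map_add, map_sum, hzero, add_zero, map_smul, map_zero] at h
    rw [hκ, ← colForm]
    have hk0 : ((k : ℝ) + 1) ≠ 0 := by positivity
    rw [← smul_neg, eq_inv_smul_iff₀ hk0]
    push_cast at h
    rw [add_comm] at h
    exact eq_neg_of_add_eq_zero_left h
  have hcard : (Finset.univ.filter fun l : Fin p =>
      (cell N (p + 1) l.succ).2 = N - 1 - 1 - k).card = n - 1 := by
    conv_rhs => rw [← Finset.card_range (n - 1)]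
    refine Finset.card_bij (fun l _ => (cell N p l).1) ?_ ?_ ?_
    · intro l hl
      rw [Finset.mem_filter, cell_succ] at hl
      have h1 := hfst l hl.2
      have h2 := cell_fst_le (N := N) l
      rw [Finset.mem_range]
      omega
    · intro l hl l' hl' h
      rw [Finset.mem_filter, cell_succ] at hl hl'
      exact cell_injective N p (Prod.ext h (hl.2.trans hl'.2.symm))
    · intro a ha
      rw [Finset.mem_range] at ha
      obtain ⟨i, hi⟩ := exists_cell_of_fst_lt (N := N) (p := p) (a := a) (b := N - 1 - 1 - k)
        (by omega) (by omega)
      exact ⟨i, by simp [cell_succ, hi], by rw [hi]⟩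
  have hfirst : toForm ((fun i => (cell N (p + 1) i).2) ∘ Fin.succ) X' = colForm N X' :=
    congrArg (fun κ => toForm κ X') (funext fun i => congrArg Prod.snd (cell_succ N p i))
  have h := sum_annih_toForm coordMul (N - 1 - 1 - k) (fun i => (cell N (p + 1) i).2) X
  rw [← colForm, if_pos (by rw [cell_zero, hmod]), Finset.sum_congr rfl hterm, Finset.sum_const,
    hcard, hfirst] at h
  refine h.trans ?_
  rw [← Nat.cast_smul_eq_nsmul ℝ]
  module

theorem exists_smul_contrTop_eq_colForm_slotT {N n k : ℕ} (hk : k < N - 1)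
    (hp : p + 1 + k = (N - 1) * n) {X : Field D (p + 1)} (hrow : IsRowSym N X)
    (hX : IsGarnir N (n - 1) k X) {v : Multiform D} {c : ℝ} (hc : c ≠ 0)
    (h : colForm N X = c • contrTop D (N - 1) k v) : ∃ c : ℝ, c ≠ 0 ∧
      colForm N (slotT coordMul X) = c • contrTop D (N - 1) (k + 1) v := by
  have h1 := contr_colForm hk hp hrow hX
  have h2 : (1 + ((n - 1 : ℕ) : ℝ) / (k + 1)) ≠ 0 := by positivity
  refine ⟨(1 + ((n - 1 : ℕ) : ℝ) / (k + 1))⁻¹ * c, mul_ne_zero (inv_ne_zero h2) hc, ?_⟩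
  rw [mul_smul, eq_comm, inv_smul_eq_iff₀ h2, ← h1, h, map_smul]
  rfl

theorem exists_colForm_eq_contrTop {N n : ℕ} (hN : 2 ≤ N) (hn : 1 ≤ n) {P : ℕ}
    (hP : P = (N - 1) * n) (Z : Field D P) {k p : ℕ} (hk : k ≤ N - 1) (hp : p + k = P) :
    ∃ X : Field D p, IsRowSym N X ∧ ∃ c : ℝ, c ≠ 0 ∧
      colForm N X = c • contrTop D (N - 1) k (colForm N (rowSymT N (colAltT N Z))) := by
  set U := rowSymT N (colAltT N Z) with hU
  have hUrow : IsRowSym N U := isRowSym_rowSymT N _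
  have key : ∀ k, ∀ p, k < N - 1 → p + 1 + k = P → ∃ X : Field D (p + 1), IsRowSym N X ∧
      IsGarnir N (n - 1) k X ∧ ∃ c : ℝ, c ≠ 0 ∧
        colForm N X = c • contrTop D (N - 1) k (colForm N U) := by
    intro k
    induction k with
    | zero =>
      intro p hk hp
      obtain rfl : P = p + 1 := by omega
      -- Before any contraction the collected term has coefficient `0`, and the Garnir identity is
      -- the usual one.
      refine ⟨U, hUrow, fun ℓ hℓ => ⟨permT (swap 0 ℓ) U, ?_, rfl⟩, 1, one_ne_zero,
        by rw [one_smul]; rfl⟩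
      rw [Nat.cast_zero, zero_smul, add_zero]
      refine garnir Z (n - 1) (fun b hb => exists_cell_eq hb ?_) hN ℓ hℓ
      obtain ⟨hmod, hdiv⟩ := mod_div_of_add_eq (k := 0) hk hP
      have := Nat.div_add_mod p (N - 1)
      rw [hdiv] at this
      omega
    | succ k ih =>
      intro p hk hp
      obtain ⟨X, hX, hG, c, hc, h⟩ := ih (p + 1) (by omega) (by omega)
      have h1 := mod_div_of_add_eq (m := N - 1) (p := p + 1) (k := k) (n := n) (by omega) (by omega)
      have h2 := mod_div_of_add_eq (m := N - 1) (p := p) (k := k + 1) (n := n) hk (by omega)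
      refine ⟨slotT coordMul X, isRowSym_slotT hX _, hG.slotT h1.2 h2.2 hX, ?_⟩
      exact exists_smul_contrTop_eq_colForm_slotT (k := k) (n := n) (by omega) (by omega) hX hG hc h
  cases k with
  | zero =>
    obtain rfl : P = p := by omega
    exact ⟨U, hUrow, 1, one_ne_zero, by rw [one_smul]; rfl⟩
  | succ k =>
    obtain ⟨X, hX, hG, c, hc, h⟩ := key k p (by omega) (by omega)
    exact ⟨slotT coordMul X, isRowSym_slotT hX _, 
      exists_smul_contrTop_eq_colForm_slotT (k := k) (n := n) (by omega) (by omega) hX hG hc h⟩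

end

/-! ### The operator `d` on multi-forms, and exactness in rectangular degrees -/

section


open Equiv

variable {N D p : ℕ}

/-- The tensor fields with smooth components underlying the elements of `Ω_N^p(ℝ^D)`. -/
def toField : TField N D p →ₗ[ℝ] Field D p where
  toFun T := fun μ => ⟨fun x => comps T x μ, contDiff_pi.1 T.2.1 μ⟩
  map_add' _ _ := rfl
  map_smul' _ _ := rfl

theorem toField_apply (T : TField N D p) (μ : Fin p → Fin D) (x : Fin D → ℝ) :
    (toField T μ).1 x = comps T x μ := rfl

theorem toField_injective : Function.Injective (toField : TField N D p →ₗ[ℝ] Field D p) := by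
  intro S T h
  apply Subtype.ext
  funext x μ
  exact congrArg (fun X : Field D p => (X μ).1 x) h

/-- The Young symmetrizer of tensor fields. -/
def youngT (N : ℕ) : Field D p →ₗ[ℝ] Field D p := colAltT N ∘ₗ rowSymT N

theorem youngT_apply (X : Field D p) : youngT N X = colAltT N (rowSymT N X) := rfl

theorem young_eq (S : Tensor D p) : young N D p S = colAltT N (rowSymT N S) := rfl

theorem evalAt_youngT (X : Field D p) (x : Fin D → ℝ) :
    mapT (evalAt x) (youngT N X) = young N D p (mapT (evalAt x) X) := by
  rw [youngT_apply, young_eq, mapT_colAltT, mapT_rowSymT]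

theorem exists_toField_eq_youngT (X : Field D p) : ∃ T : TField N D p, toField T = youngT N X :=
  ⟨⟨fun x => mapT (evalAt x) (youngT N X),
    contDiff_pi.2 fun μ => contDiff_coe (youngT N X μ),
    fun x => ⟨_, (evalAt_youngT X x).symm⟩⟩, rfl⟩

theorem exists_youngT_toField (hN : 2 ≤ N) (p : ℕ) : ∃ κ : ℝ, κ ≠ 0 ∧
    ∀ {D : ℕ} (T : TField N D p), youngT N (toField T) = κ • toField T := by
  obtain ⟨κ, h0, hκ⟩ := exists_young_sq_ne_zero hN p
  refine ⟨κ, h0, fun {D} T => field_ext fun x => ?_⟩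
  rw [evalAt_youngT]
  obtain ⟨t, ht⟩ := T.2.2 x
  have h : mapT (evalAt x) (toField T) = young N D p t := ht.symm
  refine (congrArg _ h).trans ?_
  change _ = κ • mapT (evalAt x) (toField T)
  rw [h]
  exact hκ D ℝ t

theorem toField_dDeg (T : TField N D p) : toField (dDeg N D p T) = youngT N (gradT (toField T)) :=
  field_ext fun x => (evalAt_youngT (gradT (toField T)) x).symm

/-- Row permutations of the smaller diagram lift to row permutations of the larger one, which
absorbs them. -/
theorem rowSymT_gradT_rowSymT (X : Field D p) :
    rowSymT N (gradT (rowSymT N X)) = rowSymT N (gradT X) := by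
  rw [rowSymT_apply N X, map_smul, map_smul, map_sum, map_sum,
    Finset.sum_congr rfl (g := fun _ => rowSymT N (gradT X)), Finset.sum_const,
    ← Nat.cast_smul_eq_nsmul ℝ, inv_smul_smul₀ (card_rowPerms_ne_zero N p)]
  intro σ hσ
  rw [gradT_permT, rowSymT_permT (liftPerm_mem_rowPerms.2 hσ)]

/-- The multi-form of an element of `Ω_N^p(ℝ^D)`. -/
def form (N D p : ℕ) : TField N D p →ₗ[ℝ] Multiform D := colForm N ∘ₗ toField

theorem form_apply (T : TField N D p) : form N D p T = colForm N (toField T) := rfl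

theorem colAltT_toField (hN : 2 ≤ N) (T : TField N D p) :
    colAltT N (toField T) = toField T := by
  obtain ⟨κ, h0, hκ⟩ := exists_youngT_toField hN p
  rw [← inv_smul_smul₀ h0 (toField T), ← hκ, map_smul, youngT_apply, colAltT_colAltT]

theorem form_injective (hN : 2 ≤ N) : Function.Injective (form N D p) := fun S T h =>
  toField_injective (colForm_injOn N (colAltT_toField hN S) (colAltT_toField hN T) h)

theorem colForm_youngT (X : Field D p) : colForm N (youngT N X) = colForm N (rowSymT N X) := by
  rw [youngT_apply, colForm_colAltT]

/-- Column antisymmetrization is invisible in `colForm`. Symmetrizing the rows of `T` before taking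
the gradient changes nothing, and costs only the factor `κ` of the Young symmetrizer. -/
theorem exists_form_dDeg (hN : 2 ≤ N) (p : ℕ) : ∃ c : ℝ, c ≠ 0 ∧ ∀ {D : ℕ} (T : TField N D p),
    form N D (p + 1) (dDeg N D p T) = c • rowD D (p % (N - 1)) (form N D p T) := by
  obtain ⟨κ, h0, hκ⟩ := exists_youngT_toField hN p
  refine ⟨((p % (N - 1) : ℕ) + 1 : ℝ)⁻¹ * κ, mul_ne_zero (by positivity) h0, fun {D} T => ?_⟩
  rw [form_apply, toField_dDeg, colForm_youngT, ← rowSymT_gradT_rowSymT,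
    colForm_rowSymT_gradT hN (isRowSym_rowSymT N _), ← colForm_youngT, hκ, map_smul, map_smul,
    mul_smul, form_apply]

/-- The multi-forms of the elements of `Ω_N^p(ℝ^D)` are those of the row symmetric tensor
fields. -/
theorem mem_range_form_iff (hN : 2 ≤ N) {v : Multiform D} :
    v ∈ LinearMap.range (form N D p) ↔ ∃ X : Field D p, IsRowSym N X ∧ colForm N X = v := by
  constructor
  · rintro ⟨T, rfl⟩
    obtain ⟨κ, h0, hκ⟩ := exists_youngT_toField hN p
    refine ⟨rowSymT N (κ⁻¹ • toField T), isRowSym_rowSymT N _, ?_⟩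
    rw [← colForm_youngT, map_smul, hκ, inv_smul_smul₀ h0, form_apply]
  · rintro ⟨X, hX, rfl⟩
    obtain ⟨T, hT⟩ := exists_toField_eq_youngT (N := N) X
    exact ⟨T, by rw [form_apply, hT, colForm_youngT, rowSymT_eq_self hX]⟩

theorem rowD_mem_range_form (hN : 2 ≤ N) {v : Multiform D}
    (hv : v ∈ LinearMap.range (form N D p)) :
    rowD D (p % (N - 1)) v ∈ LinearMap.range (form N D (p + 1)) := by
  obtain ⟨T, rfl⟩ := hv
  obtain ⟨c, h0, hc⟩ := exists_form_dDeg hN p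
  exact ⟨c⁻¹ • dDeg N D p T, by rw [map_smul, hc, inv_smul_smul₀ h0]⟩

theorem tensorEnd_one_toForm (φ : Smooth D →ₗ[ℝ] Smooth D) (κ : Fin p → ℕ) (X : Field D p) :
    tensorEnd 1 φ (toForm κ X) = toForm κ (mapT φ X) := by
  rw [toForm_apply, toForm_apply, map_sum]
  rfl

theorem IsRowSym.mapT {X : Field D p} (hX : IsRowSym N X) (φ : Smooth D →ₗ[ℝ] Smooth D) :
    IsRowSym N (mapT φ X) := fun σ hσ => by rw [← mapT_permT, hX σ hσ]

theorem tensorEnd_one_mem_range_form (hN : 2 ≤ N) (φ : Smooth D →ₗ[ℝ] Smooth D) {v : Multiform D}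
    (hv : v ∈ LinearMap.range (form N D p)) : tensorEnd 1 φ v ∈ LinearMap.range (form N D p) := by
  obtain ⟨X, hX, rfl⟩ := (mem_range_form_iff hN).1 hv
  exact (mem_range_form_iff hN).2 ⟨_, hX.mapT φ, (tensorEnd_one_toForm φ _ X).symm⟩

section rectangular

variable {n P : ℕ} {v : Multiform D}

theorem isBalanced_of_mem_range_form (hN : 2 ≤ N) (hP : P = (N - 1) * n)
    (hv : v ∈ LinearMap.range (form N D P)) : IsBalanced (N - 1) n v := by
  subst hP
  obtain ⟨X, hX, rfl⟩ := (mem_range_form_iff hN).1 hv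
  exact isBalanced_colForm hX

theorem contrTop_mem_range_form (hN : 2 ≤ N) (hn : 1 ≤ n) (hP : P = (N - 1) * n)
    (hv : v ∈ LinearMap.range (form N D P)) {q : ℕ} (hq : q ≤ N - 1) (hp : p + q = P) :
    contrTop D (N - 1) q v ∈ LinearMap.range (form N D p) := by
  obtain ⟨T, rfl⟩ := hv
  obtain ⟨κ, h0, hκ⟩ := exists_youngT_toField hN P
  -- The Young symmetrizer acts on `T` as `κ`; applying it twice and dividing by `κ ^ 2` presents
  -- the form of `T` through `rowSymT (colAltT Z)`, as Garnir requires.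
  obtain ⟨X, hX, c, hc, h⟩ := exists_colForm_eq_contrTop hN hn hP
    (κ⁻¹ • κ⁻¹ • rowSymT N (toField T)) hq hp
  have h1 : colForm N (rowSymT N (colAltT N (κ⁻¹ • κ⁻¹ • rowSymT N (toField T)))) =
      form N D P T := by
    simp only [map_smul]
    rw [← youngT_apply, hκ, map_smul, map_smul, inv_smul_smul₀ h0, ← colForm_youngT, hκ, map_smul,
      inv_smul_smul₀ h0, form_apply]
  rw [h1] at h
  rw [← inv_smul_smul₀ hc (contrTop D (N - 1) q _), ← h]
  exact Submodule.smul_mem _ _ ((mem_range_form_iff hN).2 ⟨X, hX, rfl⟩)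

/-- The operator `A` is the contraction of the last column followed by `rowD`, and each of these
maps forms of `Ω` to forms of `Ω`. -/
theorem casimir_mem_range_form (hN : 2 ≤ N) (hn : 1 ≤ n) (hP : P = (N - 1) * n)
    (hv : v ∈ LinearMap.range (form N D P)) :
    casimir D (N - 1) v ∈ LinearMap.range (form N D P) := by
  have hbal := isBalanced_of_mem_range_form hN hP hv
  obtain ⟨p, rfl⟩ : ∃ p, P = p + 1 := ⟨P - 1, by
    have : 0 < (N - 1) * n := Nat.mul_pos (by omega) hn
    omega⟩
  have h1 := rowD_mem_range_form hN
    (contrTop_mem_range_form hN hn hP hv (q := 1) (by omega) rfl)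
  have h2 := (mod_div_of_add_eq (m := N - 1) (p := p) (k := 0) (n := n) (by omega) hP).1
  rw [h2, rowD_contrTop hbal (by omega)] at h1
  rw [casimir, LinearMap.sum_apply]
  exact h1

end rectangular

/-- The `k`-th power of the operator `d`, on elements of degree `p`. -/
def dPow (N D p : ℕ) : (k : ℕ) → TField N D p →ₗ[ℝ] TField N D (p + k)
  | 0 => LinearMap.id
  | k + 1 => dDeg N D (p + k) ∘ₗ dPow N D p k

theorem dPow_succ (k : ℕ) (T : TField N D p) :
    dPow N D p (k + 1) T = dDeg N D (p + k) (dPow N D p k T) := rfl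

theorem d_lof (T : TField N D p) : d N D (DirectSum.lof ℝ ℕ (fun q => TField N D q) p T) =
    DirectSum.lof ℝ ℕ (fun q => TField N D q) (p + 1) (dDeg N D p T) :=
  DirectSum.toModule_lof ..

theorem d_pow_lof (k : ℕ) (T : TField N D p) :
    (d N D ^ k) (DirectSum.lof ℝ ℕ (fun q => TField N D q) p T) =
      DirectSum.lof ℝ ℕ (fun q => TField N D q) (p + k) (dPow N D p k T) := by
  induction k with
  | zero => rfl
  | succ k ih => rw [pow_succ', Module.End.mul_apply, ih, d_lof]; rfl

theorem lof_injective (p : ℕ) :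
    Function.Injective (DirectSum.lof ℝ ℕ (fun q => TField N D q) p) :=
  DirectSum.of_injective p

theorem mem_Z_iff {k : ℕ} {T : TField N D p} : T ∈ Z N D k p ↔ dPow N D p k T = 0 := by
  rw [Z, Submodule.mem_comap, LinearMap.mem_ker, d_pow_lof]
  exact map_eq_zero_iff _ (lof_injective _)

theorem exists_form_dPow (hN : 2 ≤ N) {n : ℕ} (hp : p = (N - 1) * n) {k : ℕ} (hk : k ≤ N - 1) :
    ∃ c : ℝ, c ≠ 0 ∧ ∀ {D : ℕ} (T : TField N D p),
      form N D (p + k) (dPow N D p k T) = c • extLow D k (form N D p T) := by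
  induction k with
  | zero => exact ⟨1, one_ne_zero, fun T => by rw [one_smul]; rfl⟩
  | succ k ih =>
    obtain ⟨c, h0, hc⟩ := ih (by omega)
    obtain ⟨c', h0', hc'⟩ := exists_form_dDeg hN (p + k)
    have hmod : (p + k) % (N - 1) = k := by
      rw [hp, Nat.mul_add_mod, Nat.mod_eq_of_lt (by omega)]
    refine ⟨c' * (c * (k + 1)), mul_ne_zero h0' (mul_ne_zero h0 (by positivity)), fun {D} T => ?_⟩
    rw [dPow_succ]
    refine (hc' _).trans ?_
    rw [hc, hmod, map_smul, rowD_extLow]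
    module

/-- Every application of `d` trades one contraction for one root factor. At `r = 0` all contractions
are used up, and `w'` is a multiple of `rootProd q w`. -/
theorem exists_dPow_eq_contrTop (hN : 2 ≤ N) {n : ℕ} (hn : 1 ≤ n) {q : ℕ} (hq : q ≤ N - 1)
    (hp : p + q = (N - 1) * n) {w : Multiform D} (hw : w ∈ LinearMap.range (form N D (p + q)))
    {T : TField N D p} (hT : form N D p T = contrTop D (N - 1) q w) {j r : ℕ} (hj : j + r = q) :
    ∃ w' ∈ LinearMap.range (form N D (p + q)),
      form N D (p + j) (dPow N D p j T) = contrTop D (N - 1) r w' ∧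
      ∃ c : ℝ, c ≠ 0 ∧ rootProd D (N - 1) n r w' = c • rootProd D (N - 1) n q w := by
  induction j generalizing r with
  | zero =>
    obtain rfl : r = q := by omega
    exact ⟨w, hw, hT, 1, one_ne_zero, by rw [one_smul]⟩
  | succ j ih =>
    obtain ⟨w', hw', hT', c, hc, hprod⟩ := ih (r := r + 1) (by omega)
    obtain ⟨c', h0', hc'⟩ := exists_form_dDeg hN (p + j)
    have hmod := (mod_div_of_add_eq (m := N - 1) (p := p + j) (k := r) (n := n) (by omega)
      (by omega)).1
    have hbal := isBalanced_of_mem_range_form hN hp hw'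
    refine ⟨c' • (casimir D (N - 1) - rootOp D (N - 1) n r) w', ?_, ?_, c' * c,
      mul_ne_zero h0' hc, ?_⟩
    · exact Submodule.smul_mem _ _ (rootFactor_mem
        (fun v hv => casimir_mem_range_form hN hn hp hv)
        (fun v hv => tensorEnd_one_mem_range_form hN euler hv) r hw')
    · rw [dPow_succ]
      refine (hc' _).trans ?_
      rw [hT', hmod, rowD_contrTop hbal (by omega), sum_extD_contr_contrTop hbal (by omega),
        map_smul]
      rfl
    · rw [map_smul, mul_smul, ← hprod]
      rfl

theorem exists_dPow_eq_of_dPow_eq_zero (hN : 2 ≤ N) {n : ℕ} (hn : 1 ≤ n) {k q : ℕ} (hk : k ≤ N - 1)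
    (hkq : k + q = N) (hq : q ≤ N - 1) (hp : p + q = (N - 1) * n) (T : TField N D (p + q))
    (hT : dPow N D (p + q) k T = 0) : ∃ S : TField N D p, dPow N D p q S = T := by
  obtain ⟨c, h0, hc⟩ := exists_form_dPow hN hp hk
  have h1 := hc T
  rw [hT, map_zero, eq_comm, smul_eq_zero] at h1
  have h2 := mem_of_extLow_eq_zero (W := LinearMap.range (form N D (p + q)))
    (I := LinearMap.range (form N D (p + q) ∘ₗ dPow N D p q)) (q := q) (k := k) hn
    (fun v hv => isBalanced_of_mem_range_form hN hp hv)
    (fun v hv => casimir_mem_range_form hN hn hp hv)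
    (fun v hv => tensorEnd_one_mem_range_form hN euler hv) ?_ ?_ (by omega) _ ⟨T, rfl⟩
    (h1.resolve_left h0)
  · obtain ⟨S, hS⟩ := h2
    exact ⟨S, form_injective hN hS⟩
  · intro c v hv
    obtain ⟨G, hG⟩ := exists_euler_add_inverse (D := D) c
    refine ⟨_, tensorEnd_one_mem_range_form hN G hv, ?_⟩
    let G' : Module.End ℝ (Smooth D) := G
    let E : Module.End ℝ (Smooth D) := euler
    have hE : eulerF D = tensorEnd 1 E := rfl
    have h3 : eulerF D * (eulerF D * tensorEnd 1 G' + (c : ℝ) • tensorEnd 1 G' - 1) +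
        (c : ℝ) • (eulerF D * tensorEnd 1 G' + (c : ℝ) • tensorEnd 1 G' - 1) = 0 := by
      rw [← tensorEnd_one, hE, tensorEnd_mul, one_mul, ← map_smul, ← map_add, ← map_sub,
        tensorEnd_mul, one_mul, ← map_smul, ← map_add]
      have h4 : E * (E * G' + (c : ℝ) • G' - 1) + (c : ℝ) • (E * G' + (c : ℝ) • G' - 1) = 0 :=
        LinearMap.ext hG
      rw [h4, map_zero]
    exact LinearMap.congr_fun h3 v
  -- The primitive of `rootProd q w` is, up to a constant, the element of `Ω` whose form is the
  -- `q`-fold contraction of `w`.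
  · intro w hw
    obtain ⟨S, hS⟩ := contrTop_mem_range_form hN hn hp hw hq rfl
    obtain ⟨w', -, h3, c, hc, h4⟩ := exists_dPow_eq_contrTop hN hn hq hp hw hS (add_zero q)
    refine ⟨c⁻¹ • S, ?_⟩
    rw [LinearMap.comp_apply, map_smul, map_smul, h3, inv_smul_eq_iff₀ hc, ← h4]
    rfl

theorem Z_le_B (hN : 2 ≤ N) {n k : ℕ} (hn : 1 ≤ n) (hk : 1 ≤ k) (hk' : k ≤ N - 1) :
    Z N D k ((N - 1) * n) ≤ B N D (N - k) ((N - 1) * n) := by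
  have hle : N - 1 ≤ (N - 1) * n := Nat.le_mul_of_pos_right _ hn
  obtain ⟨p, hp⟩ : ∃ p, p + (N - k) = (N - 1) * n := ⟨(N - 1) * n - (N - k), by omega⟩
  rw [← hp]
  intro T hT
  obtain ⟨S, rfl⟩ := exists_dPow_eq_of_dPow_eq_zero hN hn hk' (by omega) (by omega) hp T
    (mem_Z_iff.1 hT)
  exact ⟨DirectSum.lof ℝ ℕ (fun q => TField N D q) p S, d_pow_lof _ _⟩

end

/-! ### Nilpotency of `d`, and degree zero -/

section


open Equiv

variable {N D p : ℕ}

/-- The iterated gradient of a tensor field. -/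
def gradPow : (a : ℕ) → Field D p →ₗ[ℝ] Field D (p + a)
  | 0 => LinearMap.id
  | a + 1 => gradT ∘ₗ gradPow a

theorem gradPow_succ (a : ℕ) (X : Field D p) : gradPow (a + 1) X = gradT (gradPow a X) := rfl

theorem gradT_gradT_swap (X : Field D p) :
    permT (swap 0 1) (gradT (gradT X)) = gradT (gradT X) := by
  funext μ
  rw [permT_apply, gradT_apply, gradT_apply, gradT_apply, gradT_apply, partialD_comm]
  have h : Fin.tail (Fin.tail (μ ∘ swap 0 1)) = Fin.tail (Fin.tail μ) := by
    funext i
    simp only [Fin.tail, Function.comp_apply]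
    rw [swap_apply_of_ne_of_ne (Fin.succ_ne_zero _) (by
        rw [← Fin.succ_zero_eq_one]
        exact fun h => Fin.succ_ne_zero _ (Fin.succ_injective _ h))]
  rw [h]
  have h1 : Fin.tail (μ ∘ swap 0 1) 0 = μ 0 := by
    simp [Fin.tail]
  have h2 : (μ ∘ swap 0 1) 0 = Fin.tail μ 0 := by
    simp [Fin.tail]
  rw [h1, h2]

/-- Second derivatives commute, which gives the swap of the two newest indices; conjugating by it
brings in the swaps known in lower order. -/
theorem permT_swap_gradPow (X : Field D p) : ∀ (a : ℕ) (i j : Fin (p + a)), (i : ℕ) < a →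
    (j : ℕ) < a → permT (swap i j) (gradPow a X) = gradPow a X := by
  intro a
  induction a with
  | zero => intro i j hi; omega
  | succ a ih =>
    have hzero : ∀ j : Fin (p + a), (j : ℕ) < a →
        permT (swap 0 j.succ) (gradPow (a + 1) X) = gradPow (a + 1) X := by
      intro j hj
      obtain ⟨b, rfl⟩ : ∃ b, a = b + 1 := ⟨a - 1, by omega⟩
      have h01 : permT (swap 0 1) (gradPow (b + 1 + 1) X) = gradPow (b + 1 + 1) X :=
        gradT_gradT_swap (gradPow b X)
      have h1j : permT (swap 1 j.succ) (gradPow (b + 1 + 1) X) = gradPow (b + 1 + 1) X := by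
        have h := ih 0 j (Nat.succ_pos b) hj
        have h' := congrArg gradT h
        rw [gradT_permT, liftPerm_swap] at h'
        exact h'
      rcases eq_or_ne j 0 with rfl | hj0
      · exact h01
      · have hne : j.succ ≠ 1 := by
          rw [← Fin.succ_zero_eq_one]
          exact fun h => hj0 (Fin.succ_injective _ h)
        have h2 : swap 0 1 * swap 1 j.succ * swap 0 1 = swap (0 : Fin (p + b + 1 + 1)) j.succ := by
          rw [swap_comm 0 1, swap_comm 1 j.succ]
          exact swap_mul_swap_mul_swap hne (Fin.succ_ne_zero j)
        have h3 : permT (swap 0 1 * swap 1 j.succ * swap 0 1) (gradPow (b + 1 + 1) X) =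
            gradPow (b + 1 + 1) X := by
          rw [← permT_permT, ← permT_permT, h01, h1j, h01]
        rw [h2] at h3
        exact h3
    intro i
    refine Fin.cases (fun j => ?_) (fun i j => ?_) i
    · refine Fin.cases (fun _ _ => ?_) (fun j _ hj => ?_) j
      · rw [swap_self]; rfl
      · exact hzero j (by simpa using hj)
    · refine Fin.cases (fun hi _ => ?_) (fun j hi hj => ?_) j
      · rw [swap_comm]; exact hzero i (by simpa using hi)
      · rw [gradPow_succ, ← liftPerm_swap, ← gradT_permT,
          ih i j (by simpa using hi) (by simpa using hj)]

theorem youngT_mem_of_invariant {S : Submodule ℝ (Field D p)}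
    (hS : ∀ σ : Perm (Fin p), ∀ X ∈ S, permT σ X ∈ S) {X : Field D p} (hX : X ∈ S) :
    youngT N X ∈ S := by
  have hrow : rowSymT N X ∈ S := by
    rw [rowSymT_apply]
    exact S.smul_mem _ (S.sum_mem fun σ _ => hS σ X hX)
  rw [youngT_apply, colAltT_apply]
  exact S.smul_mem _ (S.sum_mem fun σ _ => S.smul_mem _ (hS σ _ hrow))

/-- The span of the tensor fields obtained from `X` by permutations of the indices. -/
def permSpan (X : Field D p) : Submodule ℝ (Field D p) :=
  Submodule.span ℝ (Set.range fun σ => permT σ X)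

theorem permT_mem_permSpan (X : Field D p) (σ : Perm (Fin p)) : ∀ Y ∈ permSpan X,
    permT σ Y ∈ permSpan X := by
  intro Y hY
  have h : permSpan X ≤ (permSpan X).comap (permT σ) := by
    refine Submodule.span_le.2 ?_
    rintro _ ⟨τ, rfl⟩
    exact Submodule.subset_span ⟨σ * τ, (permT_permT σ τ X).symm⟩
  exact h hY

theorem gradT_mem_permSpan {X Y : Field D p} (hY : Y ∈ permSpan X) :
    gradT Y ∈ permSpan (gradT X) := by
  have h : permSpan X ≤ (permSpan (gradT X)).comap gradT := by
    refine Submodule.span_le.2 ?_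
    rintro _ ⟨τ, rfl⟩
    exact Submodule.subset_span ⟨liftPerm τ, (gradT_permT τ X).symm⟩
  exact h hY

/-- Young symmetrizers are combinations of permutations, and permutations pass through the gradient,
so the intermediate projections never leave this span. -/
theorem toField_dPow_mem (a : ℕ) (T : TField N D p) :
    toField (dPow N D p a T) ∈ permSpan (gradPow a (toField T)) := by
  induction a with
  | zero => exact Submodule.subset_span ⟨1, rfl⟩
  | succ a ih =>
    rw [dPow_succ]
    have h := toField_dDeg (dPow N D p a T)
    refine h.symm ▸ youngT_mem_of_invariant (permT_mem_permSpan _) (gradT_mem_permSpan ih)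

/-- Of the `N` derivative indices two land in the same of `N - 1` columns, where the tensor is
symmetric in them. -/
theorem colAltT_permT_gradPow (hN : 2 ≤ N) (X : Field D p) (σ : Perm (Fin (p + N))) :
    colAltT N (permT σ (gradPow N X)) = 0 := by
  obtain ⟨i, -, j, -, hij, h⟩ := Finset.exists_ne_map_eq_of_card_lt_of_maps_to
    (s := (Finset.univ : Finset (Fin N))) (t := Finset.range (N - 1))
    (f := fun i => (cell N (p + N) (σ (Fin.castLE (Nat.le_add_left N p) i))).2)
    (by rw [Finset.card_range, Finset.card_univ, Fintype.card_fin]; omega)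
    (fun i _ => Finset.mem_coe.2 (Finset.mem_range.2 (cell_snd_lt hN _)))
  set i' := Fin.castLE (Nat.le_add_left N p) i with hi'
  set j' := Fin.castLE (Nat.le_add_left N p) j with hj'
  have hij' : i' ≠ j' := fun h => hij (Fin.castLE_injective _ h)
  have h1 : permT (swap i' j') (gradPow N X) = gradPow N X :=
    permT_swap_gradPow X N i' j' i.isLt j.isLt
  apply eq_zero_of_eq_neg
  conv_lhs => rw [← h1, permT_permT, mul_swap_eq_swap_mul, ← permT_permT,
    colAltT_swap (σ.injective.ne hij') h]

theorem dPow_eq_zero (hN : 2 ≤ N) (T : TField N D p) : dPow N D p N T = 0 := by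
  apply toField_injective
  rw [map_zero, ← colAltT_toField hN]
  have h : permSpan (gradPow N (toField T)) ≤ LinearMap.ker (colAltT N) := by
    refine Submodule.span_le.2 ?_
    rintro _ ⟨σ, rfl⟩
    exact colAltT_permT_gradPow hN _ σ
  exact h (toField_dPow_mem N T)

theorem d_pow_eq_zero (hN : 2 ≤ N) : d N D ^ N = 0 := by
  refine DirectSum.linearMap_ext ℝ fun p => LinearMap.ext fun T => ?_
  rw [LinearMap.comp_apply, d_pow_lof, dPow_eq_zero hN, map_zero]
  rfl

/-- Symmetric tensors of degree less than `N` have the Young symmetry type of their degree. -/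
theorem youngT_eq_self (hp : p ≤ N - 1) {X : Field D p} (hX : ∀ σ, permT σ X = X) :
    youngT N X = X := by
  -- With at most `N - 1` cells all indices lie in one row, in different columns.
  have hcol : colPerms N p = {1} := by
    refine Finset.eq_singleton_iff_unique_mem.2 ⟨one_mem_colPerms N p, fun σ hσ => ?_⟩
    ext i
    have h := mem_colPerms.1 hσ i
    have hlt : ∀ j : Fin p, (cell N p j).2 = (j.rev : ℕ) := fun j =>
      Nat.mod_eq_of_lt (j.rev.isLt.trans_le hp)
    rw [hlt, hlt] at h
    exact congrArg Fin.val (Fin.rev_injective (Fin.ext h))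
  rw [youngT_apply, rowSymT_eq_self fun σ _ => hX σ, colAltT_apply, hcol]
  simp [permT_one]

theorem permT_eq_self_of_swap {X : Field D p} (h : ∀ i j, permT (swap i j) X = X)
    (σ : Perm (Fin p)) : permT σ X = X := by
  induction σ using Perm.swap_induction_on with
  | one => rfl
  | swap_mul σ i j _ ih => rw [← permT_permT, ih, h]

theorem toField_dPow_zero (T : TField N D 0) {k : ℕ} (hk : k ≤ N - 1) :
    toField (dPow N D 0 k T) = gradPow k (toField T) := by
  induction k with
  | zero => rfl
  | succ k ih =>
    rw [dPow_succ]
    refine (toField_dDeg _).trans ?_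
    rw [ih (by omega)]
    exact youngT_eq_self (p := 0 + k + 1) (by omega)
      (permT_eq_self_of_swap fun i j => permT_swap_gradPow (toField T) (k + 1) i j
        (by omega) (by omega))

/-- Polynomial functions of degree less than `k`. -/
def polyLT (D : ℕ) : ℕ → Submodule ℝ (Smooth D)
  | 0 => ⊥
  | k + 1 => LinearMap.range evalZero ⊔ ⨆ ν, (polyLT D k).map (coordMul ν)

theorem evalZero_mem_polyLT (k : ℕ) (f : Smooth D) : evalZero f ∈ polyLT D (k + 1) :=
  Submodule.mem_sup_left ⟨f, rfl⟩

theorem coordMul_mem_polyLT {k : ℕ} {f : Smooth D} (hf : f ∈ polyLT D k) (ν : Fin D) :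
    coordMul ν f ∈ polyLT D (k + 1) :=
  Submodule.mem_sup_right (Submodule.mem_iSup_of_mem ν ⟨f, hf, rfl⟩)

theorem polyLT_succ_le {k : ℕ} {S : Submodule ℝ (Smooth D)} (h0 : ∀ f, evalZero f ∈ S)
    (h1 : ∀ f ∈ polyLT D k, ∀ ν, coordMul ν f ∈ S) : polyLT D (k + 1) ≤ S := by
  refine sup_le ?_ (iSup_le fun ν => ?_)
  · rintro _ ⟨f, rfl⟩; exact h0 f
  · rintro _ ⟨f, hf, rfl⟩; exact h1 f hf ν

theorem polyLT_le_succ (k : ℕ) : polyLT D k ≤ polyLT D (k + 1) := by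
  induction k with
  | zero => exact bot_le
  | succ k ih => exact polyLT_succ_le (evalZero_mem_polyLT _) fun f hf ν =>
      coordMul_mem_polyLT (ih hf) ν

theorem partialD_evalZero (ν : Fin D) (f : Smooth D) : partialD ν (evalZero f) = 0 := by
  ext x
  change fderiv ℝ (fun _ : Fin D → ℝ => f.1 0) x (Pi.single ν 1) = 0
  simp

theorem partialD_mem_polyLT {k : ℕ} (ν : Fin D) :
    polyLT D (k + 1) ≤ (polyLT D k).comap (partialD ν) := by
  induction k with
  | zero =>
    refine polyLT_succ_le (fun f => ?_) fun f hf μ => ?_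
    · rw [Submodule.mem_comap, partialD_evalZero]; exact Submodule.zero_mem _
    · rw [(Submodule.mem_bot ℝ).1 hf, map_zero]; exact Submodule.zero_mem _
  | succ k ih =>
    refine polyLT_succ_le (fun f => ?_) fun f hf μ => ?_
    · rw [Submodule.mem_comap, partialD_evalZero]; exact Submodule.zero_mem _
    · rw [Submodule.mem_comap, partialD_coordMul]
      refine Submodule.add_mem _ (coordMul_mem_polyLT (ih hf) μ) ?_
      split_ifs
      · exact hf
      · exact Submodule.zero_mem _

/-- The exponent varies in the induction because taking out a coordinate raises it by one. -/
theorem radialInt_mem_polyLT {k : ℕ} (a : ℕ) : polyLT D k ≤ (polyLT D k).comap (radialInt a) := by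
  induction k generalizing a with
  | zero => exact bot_le
  | succ k ih =>
    refine polyLT_succ_le (fun f => ?_) fun f hf μ => ?_
    · have h := radialInt_euler_add a (evalZero f)
      rw [euler_evalZero, map_zero, zero_add] at h
      have h0 : ((a : ℝ) + 1) ≠ 0 := by positivity
      rw [Submodule.mem_comap, ← inv_smul_smul₀ h0 (radialInt a (evalZero f)), h]
      exact Submodule.smul_mem _ _ (evalZero_mem_polyLT k f)
    · rw [Submodule.mem_comap, ← coordMul_radialInt]
      exact coordMul_mem_polyLT (ih (a + 1) hf) μ

/-- A function is rebuilt from its value at the origin and its partial derivatives by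
`eq_evalZero_add`, and radial integration does not raise the degree. -/
theorem mem_polyLT_succ_iff {k : ℕ} {f : Smooth D} :
    f ∈ polyLT D (k + 1) ↔ ∀ ν, partialD ν f ∈ polyLT D k := by
  refine ⟨fun h ν => partialD_mem_polyLT ν h, fun h => ?_⟩
  rw [eq_evalZero_add f]
  exact Submodule.add_mem _ (evalZero_mem_polyLT k f) (Submodule.sum_mem _ fun ν _ =>
    coordMul_mem_polyLT (radialInt_mem_polyLT 0 (h ν)) ν)

theorem gradPow_mapT_partialD (ν : Fin D) (k : ℕ) (X : Field D p) :
    gradPow k (mapT (partialD ν) X) = mapT (partialD ν) (gradPow k X) := by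
  induction k with
  | zero => rfl
  | succ k ih =>
    rw [gradPow_succ, ih, gradPow_succ]
    funext μ
    exact partialD_comm _ _ _

theorem gradPow_eq_zero_iff {k : ℕ} {X : Field D 0} :
    gradPow k X = 0 ↔ X default ∈ polyLT D k := by
  induction k generalizing X with
  | zero =>
    constructor
    · intro h; exact (Submodule.mem_bot ℝ).2 (congrFun (show X = 0 from h) default)
    · intro h
      change X = 0
      funext μ
      rw [Subsingleton.elim μ default]
      exact (Submodule.mem_bot ℝ).1 h
  | succ k ih =>
    rw [mem_polyLT_succ_iff]
    have h1 : ∀ ν, partialD ν (X default) ∈ polyLT D k ↔ mapT (partialD ν) (gradPow k X) = 0 :=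
      fun ν => by rw [← gradPow_mapT_partialD, ih, mapT_apply]
    simp only [h1]
    constructor
    · intro h ν
      funext μ
      exact congrFun h (Fin.cons ν μ)
    · intro h
      funext μ
      exact congrFun (h (μ 0)) (Fin.tail μ)

theorem mem_polyFun_iff {m : ℕ} {g : (Fin D → ℝ) → ℝ} : g ∈ polyFun D m ↔
    ∃ P : MvPolynomial (Fin D) ℝ, P.totalDegree ≤ m ∧ ∀ x, MvPolynomial.eval x P = g x := by
  rw [polyFun, Submodule.mem_map]
  refine exists_congr fun P => ?_
  rw [MvPolynomial.mem_restrictTotalDegree, funext_iff]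
  simp only [LinearMap.pi_apply, AlgHom.toLinearMap_apply, MvPolynomial.aeval_eq_eval]

theorem coe_mem_polyFun_of_mem_polyLT {k : ℕ} :
    polyLT D (k + 1) ≤ (polyFun D k).comap (Smooth D).subtype := by
  induction k with
  | zero =>
    refine polyLT_succ_le (fun f => ?_) fun f hf μ => ?_
    · exact mem_polyFun_iff.2 ⟨MvPolynomial.C (f.1 0), by simp, fun x => by simp; rfl⟩
    · rw [(Submodule.mem_bot ℝ).1 hf, map_zero]; exact Submodule.zero_mem _
  | succ k ih =>
    refine polyLT_succ_le (fun f => ?_) fun f hf μ => ?_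
    · exact mem_polyFun_iff.2 ⟨MvPolynomial.C (f.1 0), by simp, fun x => by simp; rfl⟩
    · obtain ⟨P, hP, h⟩ := mem_polyFun_iff.1 (ih hf)
      refine mem_polyFun_iff.2 ⟨MvPolynomial.X μ * P, ?_, fun x => ?_⟩
      · refine (MvPolynomial.totalDegree_mul _ _).trans ?_
        rw [MvPolynomial.totalDegree_X]; omega
      · rw [map_mul, MvPolynomial.eval_X, h]; rfl

theorem exists_mem_polyLT_eq_monomial (s : Fin D →₀ ℕ) (c : ℝ) : ∀ k, s.degree ≤ k →
    ∃ f ∈ polyLT D (k + 1), ∀ x, f.1 x = MvPolynomial.eval x (MvPolynomial.monomial s c) := by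
  intro k
  induction k generalizing s with
  | zero =>
    intro hs
    obtain rfl : s = 0 := (Finsupp.degree_eq_zero_iff s).1 (Nat.le_zero.1 hs)
    refine ⟨evalZero ⟨fun _ => c, (contDiff_const : ContDiff ℝ ∞ fun _ : Fin D → ℝ => c)⟩,
      evalZero_mem_polyLT _ _, fun x => ?_⟩
    simp; rfl
  | succ k ih =>
    intro hs
    rcases eq_or_ne s 0 with rfl | h0
    · obtain ⟨f, hf, h⟩ := ih 0 (by simp)
      exact ⟨f, polyLT_le_succ _ hf, h⟩
    · obtain ⟨ν, hν⟩ := Finsupp.ne_iff.1 h0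
      have hle : Finsupp.single ν 1 ≤ s := Finsupp.single_le_iff.2 (Nat.one_le_iff_ne_zero.2 hν)
      obtain ⟨t, rfl⟩ := exists_add_of_le hle
      rw [map_add, Finsupp.degree_single] at hs
      obtain ⟨f, hf, h⟩ := ih t (by omega)
      refine ⟨coordMul ν f, coordMul_mem_polyLT hf ν, fun x => ?_⟩
      rw [MvPolynomial.monomial_single_add, map_mul, ← h]
      simp; rfl

theorem exists_mem_polyLT_of_mem_polyFun {k : ℕ} {g : (Fin D → ℝ) → ℝ} (hg : g ∈ polyFun D k) :
    ∃ f ∈ polyLT D (k + 1), f.1 = g := by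
  obtain ⟨P, hP, h⟩ := mem_polyFun_iff.1 hg
  have h1 : ∀ s : P.support, ∃ f ∈ polyLT D (k + 1),
      ∀ x, f.1 x = MvPolynomial.eval x (MvPolynomial.monomial s.1 (P.coeff s.1)) := fun s =>
    exists_mem_polyLT_eq_monomial s.1 _ k ((MvPolynomial.le_totalDegree s.2).trans hP)
  choose f hf hfx using h1
  refine ⟨∑ s, f s, Submodule.sum_mem _ fun s _ => hf s, funext fun x => ?_⟩
  rw [smooth_coe_sum, ← h, Finset.sum_congr rfl fun s _ => hfx s x]
  conv_rhs => rw [P.as_sum, map_sum]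
  exact Finset.sum_coe_sort P.support fun s => MvPolynomial.eval x (MvPolynomial.monomial s (P.coeff s))

section degreeZero

variable {k : ℕ}

theorem mem_Z_zero_iff (hk : k ≤ N - 1) {T : TField N D 0} :
    T ∈ Z N D k 0 ↔ toField T default ∈ polyLT D k := by
  rw [mem_Z_iff, ← gradPow_eq_zero_iff, ← toField_dPow_zero T hk]
  exact (map_eq_zero_iff _ toField_injective).symm

theorem d_apply_zero (x : OmegaTot N D) : d N D x 0 = 0 := by
  induction x using DirectSum.induction_on with
  | zero => rw [map_zero]; rfl
  | of p T =>
    refine (congrArg (fun y : OmegaTot N D => y 0) (d_lof T)).trans ?_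
    exact DirectSum.of_eq_of_ne _ _ _ (Nat.succ_ne_zero p).symm
  | add x y hx hy => rw [map_add, DirectSum.add_apply, hx, hy, add_zero]

/-- The operator `d` raises the degree, so its values have no component in degree zero. -/
theorem B_zero_eq_bot {j : ℕ} (hj : 1 ≤ j) : B N D j 0 = ⊥ := by
  refine (Submodule.eq_bot_iff _).2 fun T hT => ?_
  obtain ⟨x, hx⟩ := hT
  obtain ⟨i, rfl⟩ : ∃ i, j = i + 1 := ⟨j - 1, by omega⟩
  rw [pow_succ', Module.End.mul_apply] at hx
  have h := d_apply_zero ((d N D ^ i) x)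
  rw [hx] at h
  exact (DirectSum.of_eq_same 0 T).symm.trans h

/-- The function underlying an element of `Ker d^k` of degree zero. -/
def kerToPolyFun (hk : 1 ≤ k) (hk' : k ≤ N - 1) : Z N D k 0 →ₗ[ℝ] polyFun D (k - 1) :=
  LinearMap.codRestrict (polyFun D (k - 1))
    (LinearMap.pi (fun x => LinearMap.proj ![] ∘ₗ LinearMap.proj x ∘ₗ comps) ∘ₗ
      (Z N D k 0).subtype) fun T => by
    have h := (mem_Z_zero_iff hk').1 T.2
    obtain ⟨i, rfl⟩ : ∃ i, k = i + 1 := ⟨k - 1, by omega⟩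
    have h' := coe_mem_polyFun_of_mem_polyLT h
    have he : (![] : Fin 0 → Fin D) = default := Subsingleton.elim _ _
    rw [he]
    exact h'

theorem kerToPolyFun_apply (hk : 1 ≤ k) (hk' : k ≤ N - 1) (T : Z N D k 0) (x : Fin D → ℝ) :
    (kerToPolyFun hk hk' T : (Fin D → ℝ) → ℝ) x = comps T.1 x ![] := rfl

theorem kerToPolyFun_bijective (hk : 1 ≤ k) (hk' : k ≤ N - 1) :
    Function.Bijective (kerToPolyFun (N := N) (D := D) hk hk') := by
  constructor
  · intro S T h
    apply Subtype.ext
    apply toField_injective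
    funext μ
    ext x
    rw [toField_apply, toField_apply, Subsingleton.elim μ ![], ← kerToPolyFun_apply hk hk', h,
      kerToPolyFun_apply]
  · rintro ⟨g, hg⟩
    obtain ⟨f, hf, rfl⟩ := exists_mem_polyLT_of_mem_polyFun hg
    rw [Nat.sub_add_cancel hk] at hf
    obtain ⟨T, hT⟩ := exists_toField_eq_youngT (N := N) (fun _ : Fin 0 → Fin D => f)
    rw [youngT_eq_self (Nat.zero_le _) fun _ => rfl] at hT
    refine ⟨⟨T, (mem_Z_zero_iff hk').2 (by rwa [hT])⟩, ?_⟩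
    apply Subtype.ext
    funext x
    rw [kerToPolyFun_apply, ← toField_apply, hT]

end degreeZero

end

end

end GenPoincare

theorem theorem1 (N : ℕ) (hN : 2 ≤ N) (D : ℕ) :
    GenPoincare.d N D ^ N = 0 ∧
    ∀ k : ℕ, 1 ≤ k → k ≤ N - 1 →
      (∀ n : ℕ, 1 ≤ n → Subsingleton (GenPoincare.H N D k ((N - 1) * n))) ∧
      ∃ Φ : GenPoincare.H N D k 0 ≃ₗ[ℝ] GenPoincare.polyFun D (k - 1),
        ∀ (f : GenPoincare.Z N D k 0) (x : Fin D → ℝ),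
          (Φ (Submodule.Quotient.mk f) : (Fin D → ℝ) → ℝ) x
            = GenPoincare.comps f.1 x ![] := by
  refine ⟨GenPoincare.d_pow_eq_zero hN, fun k hk hk' => ⟨fun n hn => ?_, ?_⟩⟩
  · rw [Submodule.Quotient.subsingleton_iff, Submodule.submoduleOf, Submodule.comap_subtype_eq_top]
    exact GenPoincare.Z_le_B hN hn hk hk'
  · have hbot : (GenPoincare.B N D (N - k) 0).submoduleOf (GenPoincare.Z N D k 0) = ⊥ := by
      rw [GenPoincare.B_zero_eq_bot (by omega), Submodule.submoduleOf, Submodule.comap_bot,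
        Submodule.ker_subtype]
    exact ⟨(Submodule.quotEquivOfEqBot _ hbot).trans
      (LinearEquiv.ofBijective _ (GenPoincare.kerToPolyFun_bijective hk hk')), fun f x => rfl⟩
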